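/- **Setting.** Let $n\ge 2$ and let $W,V$ be finite-dimensional real vector spaces. A field on an $n$-manifold $M$ is a pair $\phi=(A,\varphi)$ of a smooth $W$-valued 1-form and a smooth $V$-valued function. Let $L$ be a generally covariant first-order Lagrangian $n$-form $L(\phi)=\ell(A,\varphi,dA,d\varphi)$, where $\ell$ is smooth on an open $GL(n)$-stable set of values $(A,\varphi,dA,d\varphi)$ at a point and $GL(n)$-equivariant (so that $L(f^*\phi)=f^*L(\phi)$ for diffeomorphisms $f$; Lagrangians $\tilde L(\phi,D\phi)$ of gauge theories are of this form). Write $$\delta L=\delta A\wedge \tfrac{\partial L}{\partial A}+\delta\varphi\,\tfrac{\partial L}{\partial \varphi}+d\delta A\wedge \tfrac{\partial L}{\partial (dA)}+d\delta\varphi\wedge \tfrac{\partial L}{\partial (d\varphi)}=E(\delta\phi;\phi)+d\theta(\delta\phi;\phi),$$ $$\theta(\delta\phi;\phi)=\delta A\wedge \tfrac{\partial L}{\partial (dA)}+\delta\varphi\,\tfrac{\partial L}{\partial (d\varphi)},\qquad E(\delta\phi;\phi)=\delta A\wedge\Big(\tfrac{\partial L}{\partial A}+d\tfrac{\partial L}{\partial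 (dA)}\Big)+\delta\varphi\Big(\tfrac{\partial L}{\partial \varphi}-d\tfrac{\partial L}{\partial (d\varphi)}\Big).$$ Let $\Phi$ be a set of such fields, stable under $\phi\mapsto\psi^*\phi$, $\psi\in\mathrm{Diff}(M)$, with the smooth structure given by smooth finite-dimensional families. On $\Phi$, $\boldsymbol d$ denotes the exterior derivative, $\boldsymbol\theta=\theta(\boldsymbol d\phi;\phi)$, $\boldsymbol E=E(\boldsymbol d\phi;\phi)$ and $\boldsymbol\Theta=\boldsymbol d\boldsymbol\theta$. For a vector field $X$ on $M$, $\theta(\iota_X\phi;\phi)$ and $E(\iota_X\phi;\phi)$ are obtained by replacing $\delta\phi$ by $\iota_X\phi=(\iota_XA,0)$, and $\mathfrak L_X=\iota_Xd+d\iota_X$. Let $\Sigma$ be a compact oriented $(n-1)$-manifold with boundary, mapped smoothly to $M$ (for instance a submanifold), and $\boldsymbol\Theta_\Sigma=\int_\Sigma\boldsymbol\Theta$. **Statement.** (1) Let $\boldsymbol\psi:\Phi\to \mathrm{Diff}(M)$ be smooth. Let $\boldsymbol\Theta^{\boldsymbol\psi}$ be the pullback of $\boldsymbol\Theta$ by the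 map $\phi\mapsto\boldsymbol\psi(\phi)^*\phi$, let $\boldsymbol\Theta_\Sigma^{\boldsymbol\psi}=\int_{\boldsymbol\psi^{-1}(\Sigma)}\boldsymbol\Theta^{\boldsymbol\psi}$, and let $X=\boldsymbol d\boldsymbol\psi\circ\boldsymbol\psi^{-1}$, a 1-form on $\Phi$ with values in vector fields on $M$. Then $$\boldsymbol\Theta_\Sigma^{\boldsymbol\psi}=\int_\Sigma\boldsymbol\Theta+\int_{\partial\Sigma}\Big(\boldsymbol d\,\theta(\iota_X\phi;\phi)+\iota_X\boldsymbol\theta+\mathfrak L_X\,\theta(\iota_X\phi;\phi)+\tfrac12\,\iota_X\iota_XL\Big)-\int_\Sigma\Big(\iota_X\boldsymbol E+\boldsymbol d\,E(\iota_X\phi;\phi)+\mathfrak L_X\,E(\iota_X\phi;\phi)\Big).$$ Here a product of two 1-forms on $\Phi$ with values $B(\mathfrak a,\mathfrak b)$ is evaluated on tangent vectors as $B(\mathfrak a,\mathfrak b)-B(\mathfrak b,\mathfrak a)$; e.g. $\iota_X\boldsymbol\theta$ gives $\iota_{X(\mathfrak a)}\boldsymbol\theta(\mathfrak b)-\iota_{X(\mathfrak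 b)}\boldsymbol\theta(\mathfrak a)$ and $\tfrac12\iota_X\iota_XL$ gives $\iota_{X(\mathfrak a)}\iota_{X(\mathfrak b)}L$. On shell, i.e. on the set of solutions of $E=0$ and its tangent directions, only boundary terms remain: $$\boldsymbol\Theta_\Sigma^{\boldsymbol\psi}=\int_\Sigma\boldsymbol\Theta+\int_{\partial\Sigma}\Big(\boldsymbol d\,\theta(\iota_X\phi;\phi)+\iota_X\boldsymbol\theta+\mathfrak L_X\,\theta(\iota_X\phi;\phi)+\tfrac12\,\iota_X\iota_XL\Big).$$ (2) Let $N$ be an $n$-manifold and let $\boldsymbol u:\Phi\to\mathrm{Diff}(N,M)$ be a dressing field, i.e. smooth with $\boldsymbol u(\psi^*\phi)=\psi^{-1}\circ\boldsymbol u(\phi)$ for all $\psi\in\mathrm{Diff}(M)$. Then the dressed (relational) presymplectic 2-form $\boldsymbol\Theta_\Sigma^{\boldsymbol u}=\int_{\boldsymbol u^{-1}(\Sigma)}\boldsymbol\Theta^{\boldsymbol u}$ is given by the same two formulas with $\boldsymbol\psi$ replaced by $\boldsymbol u$. -/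

import Mathlib

open Set Filter Topology MeasureTheory
open scoped Manifold ContDiff

namespace CovPhase

noncomputable section

/-! ### Differential forms on manifolds (possibly with boundary)

The tangent space `TangentSpace I x` of Mathlib is, by definition, the model vector space `E`
(through the preferred chart at `x`). A `k`-form with values in `F` on a manifold `M` modelled on
`I : ModelWithCorners ℝ E H` is a function `M → E [⋀^Fin k]→L[ℝ] F`, and a vector field on `M` is a
function `M → E`. -/

section Forms

variable {E H E' H' F : Type*}
  [NormedAddCommGroup E] [NormedSpace ℝ E] [TopologicalSpace H]
  [NormedAddCommGroup E'] [NormedSpace ℝ E'] [TopologicalSpace H']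
  [NormedAddCommGroup F] [NormedSpace ℝ F]
  {M : Type*} [TopologicalSpace M] [ChartedSpace H M]
  {M' : Type*} [TopologicalSpace M'] [ChartedSpace H' M']
  {k : ℕ}

/-- The coordinate expression, in the chart centred at `c`, of a differential form `η`: the pullback
of `η` by the inverse of that chart. -/
def chartRep (I : ModelWithCorners ℝ E H) (c : M) (η : M → E [⋀^Fin k]→L[ℝ] F) (y : E) :
    E [⋀^Fin k]→L[ℝ] F :=
  (η ((extChartAt I c).symm y)).compContinuousLinearMap
    (mfderivWithin 𝓘(ℝ, E) I (extChartAt I c).symm (range I) y : E →L[ℝ] E)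

/-- Smoothness of a differential form: all its coordinate expressions are smooth. -/
def SmoothForm (I : ModelWithCorners ℝ E H) (η : M → E [⋀^Fin k]→L[ℝ] F) : Prop :=
  ∀ c : M, ContDiffOn ℝ ∞ (chartRep I c η) (extChartAt I c).target

/-- Joint smoothness of a family of differential forms depending on finitely many real parameters:
all coordinate expressions are smooth in the parameters and the coordinates together. -/
def SmoothFormFamily (I : ModelWithCorners ℝ E H) {r : ℕ}
    (η : EuclideanSpace ℝ (Fin r) → M → E [⋀^Fin k]→L[ℝ] F) : Prop :=
  ∀ c : M, ContDiffOn ℝ ∞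
    (fun z : EuclideanSpace ℝ (Fin r) × E => chartRep I c (η z.1) z.2)
    (univ ×ˢ (extChartAt I c).target)

/-- The exterior derivative `d` of a differential form on `M`, computed at each point `x` in the
preferred chart at `x`. -/
def extD (I : ModelWithCorners ℝ E H) (η : M → E [⋀^Fin k]→L[ℝ] F) (x : M) :
    E [⋀^Fin (k + 1)]→L[ℝ] F :=
  extDerivWithin (chartRep I x η) (range I) (extChartAt I x x)

/-- The pullback `f^* η`. -/
def pullForm (I : ModelWithCorners ℝ E H) (I' : ModelWithCorners ℝ E' H') (f : M → M')
    (η : M' → E' [⋀^Fin k]→L[ℝ] F) (x : M) : E [⋀^Fin k]→L[ℝ] F :=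
  (η (f x)).compContinuousLinearMap (mfderiv I I' f x : E →L[ℝ] E')

/-- The interior product `ι_X η`. -/
def intProd (X : M → E) (η : M → E [⋀^Fin (k + 1)]→L[ℝ] F) (x : M) : E [⋀^Fin k]→L[ℝ] F :=
  (η x).curryLeft (X x)

/-- The Lie derivative `𝔏_X = ι_X d + d ι_X` on differential forms. -/
def lieD (I : ModelWithCorners ℝ E H) (X : M → E) :
    {k : ℕ} → (M → E [⋀^Fin k]→L[ℝ] F) → (M → E [⋀^Fin k]→L[ℝ] F)
  | 0, η => intProd X (extD I η)
  | _ + 1, η => intProd X (extD I η) + extD I (intProd X η)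

end Forms

/-! ### Integration over a compact oriented manifold with boundary -/

section Integration

variable (m : ℕ) (S : Type*) [TopologicalSpace S] [ChartedSpace (EuclideanHalfSpace (m + 1)) S]

/-- An orientation of the `(m+1)`-manifold with boundary `S`, given by a smooth nowhere vanishing
form of top degree. -/
structure OrientationForm where
  form : S → EuclideanSpace ℝ (Fin (m + 1)) [⋀^Fin (m + 1)]→L[ℝ] ℝ
  smooth : SmoothForm (𝓡∂ (m + 1)) form
  ne_zero : ∀ x, form x ≠ 0

variable {m} {S}

/-- The standard basis vector `e_i` of `ℝⁿ`. -/
def basisVec {n : ℕ} (i : Fin n) : EuclideanSpace ℝ (Fin n) := EuclideanSpace.single i 1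

/-- `±1` according to whether the chart at `c` preserves or reverses the orientation at the point
with coordinates `y`. -/
def OrientationForm.sgn (o : OrientationForm m S) (c : S) (y : EuclideanSpace ℝ (Fin (m + 1))) : ℝ :=
  Real.sign (chartRep (𝓡∂ (m + 1)) c o.form y basisVec)

variable (m S) in
/-- A smooth partition of unity on `S` subordinate to the cover by the preferred charts. -/
def chartPartition [IsManifold (𝓡∂ (m + 1)) ∞ S] [CompactSpace S] [T2Space S] :
    SmoothPartitionOfUnity S (𝓡∂ (m + 1)) S univ :=
  Classical.choose (SmoothPartitionOfUnity.exists_isSubordinate_chartAt_source (𝓡∂ (m + 1)) S)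

/-- The integral `∫_S η` of an `(m+1)`-form. -/
def integral [IsManifold (𝓡∂ (m + 1)) ∞ S] [CompactSpace S] [T2Space S] (o : OrientationForm m S)
    (η : S → EuclideanSpace ℝ (Fin (m + 1)) [⋀^Fin (m + 1)]→L[ℝ] ℝ) : ℝ :=
  ∑ᶠ c : S, ∫ y in (extChartAt (𝓡∂ (m + 1)) c).target,
    o.sgn c y * chartPartition m S c ((extChartAt (𝓡∂ (m + 1)) c).symm y) *
      chartRep (𝓡∂ (m + 1)) c η y basisVec

/-- The inclusion `z ↦ (0, z)` of the boundary hyperplane of the half space `{y | 0 ≤ y₀}`. -/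
def bdryIncl (z : EuclideanSpace ℝ (Fin m)) : EuclideanSpace ℝ (Fin (m + 1)) :=
  WithLp.toLp 2 (Fin.cons 0 z.ofLp)

/-- The integral `∫_{∂S} η` of (the restriction to `∂S` of) an `m`-form on `S`, the boundary being
oriented by the outward normal first. In a chart with values in `{y | 0 ≤ y₀}` the outward normal
is `-e₀`, whence the sign in front. -/
def bdryIntegral [IsManifold (𝓡∂ (m + 1)) ∞ S] [CompactSpace S] [T2Space S] (o : OrientationForm m S)
    (η : S → EuclideanSpace ℝ (Fin (m + 1)) [⋀^Fin m]→L[ℝ] ℝ) : ℝ :=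
  -∑ᶠ c : S, ∫ z in {z : EuclideanSpace ℝ (Fin m) |
      bdryIncl z ∈ (extChartAt (𝓡∂ (m + 1)) c).target},
    o.sgn c (bdryIncl z) *
      chartPartition m S c ((extChartAt (𝓡∂ (m + 1)) c).symm (bdryIncl z)) *
      chartRep (𝓡∂ (m + 1)) c η (bdryIncl z) (fun i : Fin m => basisVec i.succ)

end Integration

/-! ### Algebra of covectors: wedge products and coefficients of linear functionals -/

section Algebra

variable {n k : ℕ} {W : Type*} [NormedAddCommGroup W] [NormedSpace ℝ W]

/-- The pairing `c · P` of a vector `c` of `W` (a `0`-covector) with a covector `P` valued in the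
dual of `W`. -/
def pairZero (c : W) (P : EuclideanSpace ℝ (Fin n) [⋀^Fin k]→L[ℝ] (W →L[ℝ] ℝ)) :
    EuclideanSpace ℝ (Fin n) [⋀^Fin k]→L[ℝ] ℝ :=
  (ContinuousLinearMap.apply ℝ ℝ c).compContinuousAlternatingMap P

/-- The pairing `c ↦ c · P` as a continuous linear map. -/
def pairCLM (P : EuclideanSpace ℝ (Fin n) [⋀^Fin k]→L[ℝ] (W →L[ℝ] ℝ)) :
    W →L[ℝ] (EuclideanSpace ℝ (Fin n) [⋀^Fin k]→L[ℝ] ℝ) :=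
  LinearMap.mkContinuous
    { toFun := fun c => pairZero c P
      map_add' := fun c c' => by
        ext v
        simp [pairZero]
      map_smul' := fun r c => by
        ext v
        simp [pairZero] }
    ‖P‖ fun c => by
      refine ContinuousAlternatingMap.opNorm_le_bound _
        (mul_nonneg (norm_nonneg P) (norm_nonneg c)) fun v => ?_
      calc ‖P v c‖ ≤ ‖P v‖ * ‖c‖ := (P v).le_opNorm c
        _ ≤ (‖P‖ * ∏ i, ‖v i‖) * ‖c‖ := by gcongr; exact P.le_opNorm v
        _ = ‖P‖ * ‖c‖ * ∏ i, ‖v i‖ := by ring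

/-- The wedge product `a ∧ P` of a `W`-valued `1`-covector `a` with a `k`-covector `P` valued in the
dual of `W`, the values being paired: `(a ∧ P)(v₀, …, v_k) = ∑ᵢ (-1)ⁱ P(v₀, …, v̂ᵢ, …, v_k)(a(vᵢ))`. -/
def wedgeOne (a : EuclideanSpace ℝ (Fin n) [⋀^Fin 1]→L[ℝ] W)
    (P : EuclideanSpace ℝ (Fin n) [⋀^Fin k]→L[ℝ] (W →L[ℝ] ℝ)) :
    EuclideanSpace ℝ (Fin n) [⋀^Fin (k + 1)]→L[ℝ] ℝ :=
  ContinuousAlternatingMap.alternatizeUncurryFin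
    ((pairCLM P).comp
      ((ContinuousAlternatingMap.ofSubsingleton ℝ (EuclideanSpace ℝ (Fin n)) W (0 : Fin 1)).symm a))

/-- The dual basis covector `ξ^i`. -/
def basisCovec (i : Fin n) : EuclideanSpace ℝ (Fin n) →L[ℝ] ℝ := EuclideanSpace.proj i

/-- The `1`-covector `ξ^i ⊗ w`, linearly in `w`. -/
def covec1 (i : Fin n) : W →L[ℝ] (EuclideanSpace ℝ (Fin n) [⋀^Fin 1]→L[ℝ] W) :=
  ((ContinuousAlternatingMap.ofSubsingletonLIE (𝕜 := ℝ) (E := EuclideanSpace ℝ (Fin n)) (F := W) (0 : Fin 1)) :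
    _ →L[ℝ] _).comp (ContinuousLinearMap.smulRightL ℝ (EuclideanSpace ℝ (Fin n)) W (basisCovec i))

/-- The `2`-covector `(ξ^i ∧ ξ^j) ⊗ w`, linearly in `w`. -/
def covec2 (i j : Fin n) : W →L[ℝ] (EuclideanSpace ℝ (Fin n) [⋀^Fin 2]→L[ℝ] W) :=
  (ContinuousAlternatingMap.alternatizeUncurryFinCLM ℝ (EuclideanSpace ℝ (Fin n)) W).comp
    ((ContinuousLinearMap.smulRightL ℝ (EuclideanSpace ℝ (Fin n))
      (EuclideanSpace ℝ (Fin n) [⋀^Fin 1]→L[ℝ] W) (basisCovec i)).comp (covec1 j))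

/-- Contraction `ι_{e_i}` of a covector with a basis vector. -/
def contract (i : Fin n) : (EuclideanSpace ℝ (Fin n) [⋀^Fin (k + 1)]→L[ℝ] ℝ) →L[ℝ]
    (EuclideanSpace ℝ (Fin n) [⋀^Fin k]→L[ℝ] ℝ) :=
  (ContinuousLinearMap.apply ℝ _ (basisVec i)).comp
    (ContinuousAlternatingMap.curryLeftLI (𝕜 := ℝ) (E := EuclideanSpace ℝ (Fin n)) (F := ℝ)
      (n := k)).toContinuousLinearMap

/-- For a linear map `T` from `W`-valued `0`-covectors to `k`-covectors, the covector `P` with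
`T(c) = c · P`. -/
def coeff0 (T : (EuclideanSpace ℝ (Fin n) [⋀^Fin 0]→L[ℝ] W) →L[ℝ]
    (EuclideanSpace ℝ (Fin n) [⋀^Fin k]→L[ℝ] ℝ)) :
    EuclideanSpace ℝ (Fin n) [⋀^Fin k]→L[ℝ] (W →L[ℝ] ℝ) :=
  ContinuousLinearMap.flipAlternating
    (T.comp ((ContinuousAlternatingMap.constOfIsEmptyLIE ℝ (EuclideanSpace ℝ (Fin n)) W (Fin 0)) :
      _ →L[ℝ] _))

/-- For a linear map `T` from `W`-valued `1`-covectors to covectors of top degree, the covector `P`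
with `T(a) = a ∧ P`. -/
def coeff1 (T : (EuclideanSpace ℝ (Fin n) [⋀^Fin 1]→L[ℝ] W) →L[ℝ]
    (EuclideanSpace ℝ (Fin n) [⋀^Fin (k + 1)]→L[ℝ] ℝ)) :
    EuclideanSpace ℝ (Fin n) [⋀^Fin k]→L[ℝ] (W →L[ℝ] ℝ) :=
  ContinuousLinearMap.flipAlternating
    (∑ i : Fin n, (contract i).comp (T.comp (covec1 i)))

/-- For a linear map `T` from `W`-valued `2`-covectors to covectors of top degree, the covector `Q`
with `T(b) = b ∧ Q`; explicitly `Q(w) = ½ ∑_{i,j} ι_{e_j} ι_{e_i} T((ξ^i ∧ ξ^j) ⊗ w)`. -/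
def coeff2 (T : (EuclideanSpace ℝ (Fin n) [⋀^Fin 2]→L[ℝ] W) →L[ℝ]
    (EuclideanSpace ℝ (Fin n) [⋀^Fin (k + 2)]→L[ℝ] ℝ)) :
    EuclideanSpace ℝ (Fin n) [⋀^Fin k]→L[ℝ] (W →L[ℝ] ℝ) :=
  ContinuousLinearMap.flipAlternating
    ((1 / 2 : ℝ) • ∑ i : Fin n, ∑ j : Fin n,
      (contract j).comp ((contract i).comp (T.comp (covec2 i j))))

end Algebra

/-! ### Fields and first-order generally covariant Lagrangians

The spacetime dimension is `n = m + 2`. A field `φ = (A, ϕ)` consists of a `W`-valued `1`-form `A`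
(the connection variables) and a `V`-valued `0`-form `ϕ` (the matter variables). -/

section Lagrangian

/-- Field configurations `φ = (A, ϕ)` on `M`; also the type of their variations `δφ = (δA, δϕ)`. -/
abbrev Fields (m : ℕ) (W V M : Type*) [NormedAddCommGroup W] [NormedSpace ℝ W]
    [NormedAddCommGroup V] [NormedSpace ℝ V] : Type _ :=
  (M → EuclideanSpace ℝ (Fin (m + 2)) [⋀^Fin 1]→L[ℝ] W) ×
    (M → EuclideanSpace ℝ (Fin (m + 2)) [⋀^Fin 0]→L[ℝ] V)

/-- Values `(A, ϕ, dA, dϕ)` at a point. -/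
abbrev Jet (m : ℕ) (W V : Type*) [NormedAddCommGroup W] [NormedSpace ℝ W]
    [NormedAddCommGroup V] [NormedSpace ℝ V] : Type _ :=
  (EuclideanSpace ℝ (Fin (m + 2)) [⋀^Fin 1]→L[ℝ] W) ×
    (EuclideanSpace ℝ (Fin (m + 2)) [⋀^Fin 0]→L[ℝ] V) ×
    (EuclideanSpace ℝ (Fin (m + 2)) [⋀^Fin 2]→L[ℝ] W) ×
    (EuclideanSpace ℝ (Fin (m + 2)) [⋀^Fin 1]→L[ℝ] V)

variable {m : ℕ} {W V : Type*} [NormedAddCommGroup W] [NormedSpace ℝ W]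
    [NormedAddCommGroup V] [NormedSpace ℝ V]

/-- The action of a linear change of frame on `(A, ϕ, dA, dϕ)`. -/
def Jet.pull (g : EuclideanSpace ℝ (Fin (m + 2)) ≃L[ℝ] EuclideanSpace ℝ (Fin (m + 2)))
    (J : Jet m W V) : Jet m W V :=
  (J.1.compContinuousLinearMap g, J.2.1.compContinuousLinearMap g,
    J.2.2.1.compContinuousLinearMap g, J.2.2.2.compContinuousLinearMap g)

variable (m W V) in
/-- A generally covariant Lagrangian of first order, `L(φ) = ℓ(A, ϕ, dA, dϕ)`: a smooth density `ℓ`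
with values in forms of top degree, defined for the values `(A, ϕ, dA, dϕ)` in an open set (which
may encode, e.g., the nondegeneracy of a soldering form) and natural under changes of frame, so that
`L(f^*φ) = f^* L(φ)` for diffeomorphisms `f`. The curvature `F = dA + ½[A, A]` and the covariant
derivative `Dϕ = dϕ + ρ_*(A)ϕ` are functions of `(A, ϕ, dA, dϕ)`, so Lagrangians `L̃(φ, Dφ)` of gauge
theories are of this form. -/
structure Lagrangian where
  dom : Set (Jet m W V)
  isOpen_dom : IsOpen dom
  density : Jet m W V → EuclideanSpace ℝ (Fin (m + 2)) [⋀^Fin (m + 2)]→L[ℝ] ℝ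
  smooth : ContDiffOn ℝ ∞ density dom
  pull_mem : ∀ g, ∀ J ∈ dom, Jet.pull g J ∈ dom
  natural : ∀ g, ∀ J ∈ dom, density (Jet.pull g J) = (density J).compContinuousLinearMap g

variable {M : Type*} [TopologicalSpace M] [ChartedSpace (EuclideanSpace ℝ (Fin (m + 2))) M]
  {N : Type*} [TopologicalSpace N] [ChartedSpace (EuclideanSpace ℝ (Fin (m + 2))) N]

/-- The values `(A, ϕ, dA, dϕ)` of a field at `x`. -/
def jet (φ : Fields m W V M) (x : M) : Jet m W V :=
  (φ.1 x, φ.2 x, extD (𝓡 (m + 2)) φ.1 x, extD (𝓡 (m + 2)) φ.2 x)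

/-- The pullback `f^* φ = (f^* A, f^* ϕ)`. -/
def pullFields (f : N → M) (φ : Fields m W V M) : Fields m W V N :=
  (pullForm (𝓡 (m + 2)) (𝓡 (m + 2)) f φ.1, pullForm (𝓡 (m + 2)) (𝓡 (m + 2)) f φ.2)

namespace Lagrangian

variable (L : Lagrangian m W V) (φ : Fields m W V M)

/-- The Lagrangian `n`-form `L(φ)`. -/
def form (x : M) : EuclideanSpace ℝ (Fin (m + 2)) [⋀^Fin (m + 2)]→L[ℝ] ℝ :=
  L.density (jet φ x)

/-- The coefficient `∂L/∂A` in `δL = δA ∧ ∂L/∂A + δϕ · ∂L/∂ϕ + d(δA) ∧ ∂L/∂(dA) + d(δϕ) ∧ ∂L/∂(dϕ)`. -/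
def momA (x : M) : EuclideanSpace ℝ (Fin (m + 2)) [⋀^Fin (m + 1)]→L[ℝ] (W →L[ℝ] ℝ) :=
  coeff1 ((fderiv ℝ L.density (jet φ x)).comp (ContinuousLinearMap.inl ℝ _ _))

/-- The coefficient `∂L/∂ϕ`. -/
def momPhi (x : M) : EuclideanSpace ℝ (Fin (m + 2)) [⋀^Fin (m + 2)]→L[ℝ] (V →L[ℝ] ℝ) :=
  coeff0 ((fderiv ℝ L.density (jet φ x)).comp
    ((ContinuousLinearMap.inr ℝ _ _).comp (ContinuousLinearMap.inl ℝ _ _)))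

/-- The coefficient `∂L/∂(dA)`. -/
def momDA (x : M) : EuclideanSpace ℝ (Fin (m + 2)) [⋀^Fin m]→L[ℝ] (W →L[ℝ] ℝ) :=
  coeff2 ((fderiv ℝ L.density (jet φ x)).comp
    ((ContinuousLinearMap.inr ℝ _ _).comp
      ((ContinuousLinearMap.inr ℝ _ _).comp (ContinuousLinearMap.inl ℝ _ _))))

/-- The coefficient `∂L/∂(dϕ)`. -/
def momDPhi (x : M) : EuclideanSpace ℝ (Fin (m + 2)) [⋀^Fin (m + 1)]→L[ℝ] (V →L[ℝ] ℝ) :=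
  coeff1 ((fderiv ℝ L.density (jet φ x)).comp
    ((ContinuousLinearMap.inr ℝ _ _).comp
      ((ContinuousLinearMap.inr ℝ _ _).comp (ContinuousLinearMap.inr ℝ _ _))))

/-- The Euler-Lagrange form of `A`: `∂L/∂A + d(∂L/∂(dA))`. -/
def eulerA (x : M) : EuclideanSpace ℝ (Fin (m + 2)) [⋀^Fin (m + 1)]→L[ℝ] (W →L[ℝ] ℝ) :=
  L.momA φ x + extD (𝓡 (m + 2)) (L.momDA φ) x

/-- The Euler-Lagrange form of `ϕ`: `∂L/∂ϕ - d(∂L/∂(dϕ))`. -/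
def eulerPhi (x : M) : EuclideanSpace ℝ (Fin (m + 2)) [⋀^Fin (m + 2)]→L[ℝ] (V →L[ℝ] ℝ) :=
  L.momPhi φ x - extD (𝓡 (m + 2)) (L.momDPhi φ) x

/-- The field equations `E = 0`. -/
def OnShell : Prop := ∀ x, L.eulerA φ x = 0 ∧ L.eulerPhi φ x = 0

/-- The field equations functional `E(δφ; φ)` in `δL = E(δφ; φ) + dθ(δφ; φ)`. -/
def E (δ : Fields m W V M) (x : M) : EuclideanSpace ℝ (Fin (m + 2)) [⋀^Fin (m + 2)]→L[ℝ] ℝ :=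
  wedgeOne (δ.1 x) (L.eulerA φ x) + pairZero (δ.2 x 0) (L.eulerPhi φ x)

/-- The presymplectic potential current `θ(δφ; φ)` in `δL = E(δφ; φ) + dθ(δφ; φ)`. -/
def theta (δ : Fields m W V M) (x : M) : EuclideanSpace ℝ (Fin (m + 2)) [⋀^Fin (m + 1)]→L[ℝ] ℝ :=
  wedgeOne (δ.1 x) (L.momDA φ x) + pairZero (δ.2 x 0) (L.momDPhi φ x)

/-- `E(ι_X φ; φ)`: the functional expression `E(δφ; φ)` with `δφ` replaced by
`ι_X φ = (ι_X A, ι_X ϕ) = (ι_X A, 0)`. -/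
def insE (X : M → EuclideanSpace ℝ (Fin (m + 2))) (x : M) :
    EuclideanSpace ℝ (Fin (m + 2)) [⋀^Fin (m + 1)]→L[ℝ] ℝ :=
  pairZero (intProd X φ.1 x 0) (L.eulerA φ x)

/-- `θ(ι_X φ; φ)`: the functional expression `θ(δφ; φ)` with `δφ` replaced by
`ι_X φ = (ι_X A, ι_X ϕ) = (ι_X A, 0)`. -/
def insTheta (X : M → EuclideanSpace ℝ (Fin (m + 2))) (x : M) :
    EuclideanSpace ℝ (Fin (m + 2)) [⋀^Fin m]→L[ℝ] ℝ :=
  pairZero (intProd X φ.1 x 0) (L.momDA φ x)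

/-- The presymplectic `2`-form current `Θ(α, β; φ) = α · θ(β; φ) - β · θ(α; φ)`, i.e. `Θ = 𝐝θ`
evaluated on two (constant) variations `α`, `β` at `φ`. -/
def presymp (α β : Fields m W V M) (x : M) :
    EuclideanSpace ℝ (Fin (m + 2)) [⋀^Fin (m + 1)]→L[ℝ] ℝ :=
  deriv (fun s : ℝ => L.theta (φ + s • α) β x) 0 - deriv (fun s : ℝ => L.theta (φ + s • β) α x) 0

end Lagrangian

end Lagrangian

/-! ### Field space, its tangent vectors, field-dependent diffeomorphisms -/

section FieldSpace

variable {m : ℕ} {W V : Type*} [NormedAddCommGroup W] [NormedSpace ℝ W]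
    [NormedAddCommGroup V] [NormedSpace ℝ V]
  {M : Type*} [TopologicalSpace M] [ChartedSpace (EuclideanSpace ℝ (Fin (m + 2))) M]
  {N : Type*} [TopologicalSpace N] [ChartedSpace (EuclideanSpace ℝ (Fin (m + 2))) N]

variable (M) in
/-- A field space `Φ` for the Lagrangian `L`: a set of smooth fields on `M`, on which `L` is defined,
stable under the right action `φ ↦ ψ^* φ` of the diffeomorphism group of `M`. -/
structure FieldSpace (L : Lagrangian m W V) where
  carrier : Set (Fields m W V M)
  smooth : ∀ φ ∈ carrier, SmoothForm (𝓡 (m + 2)) φ.1 ∧ SmoothForm (𝓡 (m + 2)) φ.2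
  jet_mem : ∀ φ ∈ carrier, ∀ x, jet φ x ∈ L.dom
  pull_mem : ∀ ψ : M ≃ₘ^∞⟮𝓡 (m + 2), 𝓡 (m + 2)⟯ M, ∀ φ ∈ carrier, pullFields ψ φ ∈ carrier

variable {L : Lagrangian m W V}

/-- The right action `R_ψ φ = ψ^* φ` on field space. -/
def FieldSpace.act (Φ : FieldSpace M L) (ψ : M ≃ₘ^∞⟮𝓡 (m + 2), 𝓡 (m + 2)⟯ M) (φ : Φ.carrier) :
    Φ.carrier :=
  ⟨pullFields ψ φ.1, Φ.pull_mem ψ φ.1 φ.2⟩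

/-- Smooth `r`-parameter families of points of field space (plots). -/
def FieldSpace.IsPlot (Φ : FieldSpace M L) {r : ℕ} (p : EuclideanSpace ℝ (Fin r) → Φ.carrier) :
    Prop :=
  SmoothFormFamily (𝓡 (m + 2)) (fun q => (p q).1.1) ∧
    SmoothFormFamily (𝓡 (m + 2)) (fun q => (p q).1.2)

/-- Smoothness of a map `u : Φ → Diff(N, M)`: along each smooth finite-dimensional family of fields,
`u` gives a smooth family of diffeomorphisms. -/
def FieldSpace.IsSmoothMap (Φ : FieldSpace M L)
    (u : Φ.carrier → (N ≃ₘ^∞⟮𝓡 (m + 2), 𝓡 (m + 2)⟯ M)) : Prop :=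
  ∀ (r : ℕ) (p : EuclideanSpace ℝ (Fin r) → Φ.carrier), Φ.IsPlot p →
    ContMDiff (𝓘(ℝ, EuclideanSpace ℝ (Fin r)).prod (𝓡 (m + 2))) (𝓡 (m + 2)) ∞
      (fun z : EuclideanSpace ℝ (Fin r) × N => u (p z.1) z.2)

/-- A dressing field: a smooth map `u : Φ → Diff(N, M)` with `u(ψ^* φ) = ψ⁻¹ ∘ u(φ)`. -/
structure FieldSpace.IsDressing (Φ : FieldSpace M L)
    (u : Φ.carrier → (N ≃ₘ^∞⟮𝓡 (m + 2), 𝓡 (m + 2)⟯ M)) : Prop where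
  smooth : Φ.IsSmoothMap u
  equivariant : ∀ (ψ : M ≃ₘ^∞⟮𝓡 (m + 2), 𝓡 (m + 2)⟯ M) (φ : Φ.carrier),
    u (Φ.act ψ φ) = (u φ).trans ψ.symm

/-- The tangent vector `∂_i p (q)` to a `2`-parameter family of fields. -/
def velocity (p : EuclideanSpace ℝ (Fin 2) → Fields m W V M) (q : EuclideanSpace ℝ (Fin 2))
    (i : Fin 2) : Fields m W V M :=
  (fun x => fderiv ℝ (fun q' => (p q').1 x) q (basisVec i),
    fun x => fderiv ℝ (fun q' => (p q').2 x) q (basisVec i))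

/-- The vector field `X_i = ∂_i u ∘ u⁻¹` on `M`, for a `2`-parameter family `u` of diffeomorphisms
`N → M`: the value of the `𝔛(M)`-valued `1`-form `𝐝u ∘ u⁻¹` on the tangent vector `∂_i`. -/
def logVelocity (u : EuclideanSpace ℝ (Fin 2) → (N ≃ₘ^∞⟮𝓡 (m + 2), 𝓡 (m + 2)⟯ M))
    (i : Fin 2) (q : EuclideanSpace ℝ (Fin 2)) (x : M) : EuclideanSpace ℝ (Fin (m + 2)) :=
  (mfderiv 𝓘(ℝ, EuclideanSpace ℝ (Fin 2)) (𝓡 (m + 2)) (fun q' => u q' ((u q).symm x)) q :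
    EuclideanSpace ℝ (Fin 2) →L[ℝ] EuclideanSpace ℝ (Fin (m + 2))) (basisVec i)

/-- The exterior derivative on field space, along a `2`-parameter family, of a `1`-form with
components `β_0`, `β_1`: `(𝐝β)(∂_0, ∂_1) = ∂_0 β_1 - ∂_1 β_0`. -/
def fieldD {k : ℕ} (β : Fin 2 → EuclideanSpace ℝ (Fin 2) →
      M → EuclideanSpace ℝ (Fin (m + 2)) [⋀^Fin k]→L[ℝ] ℝ)
    (q : EuclideanSpace ℝ (Fin 2)) (x : M) : EuclideanSpace ℝ (Fin (m + 2)) [⋀^Fin k]→L[ℝ] ℝ :=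
  fderiv ℝ (fun q' => β 1 q' x) q (basisVec 0) - fderiv ℝ (fun q' => β 0 q' x) q (basisVec 1)

/-- The value on `(∂_0, ∂_1)` of the product of two `1`-forms on field space, the product of the
values on `∂_i` and `∂_j` being `B i j`. -/
def skew {k : ℕ} (B : Fin 2 → Fin 2 →
      M → EuclideanSpace ℝ (Fin (m + 2)) [⋀^Fin k]→L[ℝ] ℝ) :
    M → EuclideanSpace ℝ (Fin (m + 2)) [⋀^Fin k]→L[ℝ] ℝ :=
  B 0 1 - B 1 0

namespace Lagrangian

variable (L)

/-- The value `Θ(∂_0 p, ∂_1 p)` at `p(q)` of the presymplectic `2`-form current. -/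
def plotPresymp (p : EuclideanSpace ℝ (Fin 2) → Fields m W V M) (q : EuclideanSpace ℝ (Fin 2)) :
    M → EuclideanSpace ℝ (Fin (m + 2)) [⋀^Fin (m + 1)]→L[ℝ] ℝ :=
  L.presymp (p q) (velocity p q 0) (velocity p q 1)

/-- The boundary integrand
`𝐝 θ(ι_X φ; φ) + ι_X θ + 𝔏_X θ(ι_X φ; φ) + ½ ι_X ι_X L`, where `X = 𝐝u ∘ u⁻¹`, evaluated on
`(∂_0 p, ∂_1 p)` at `p(q)`. -/
def bdryTerm (p : EuclideanSpace ℝ (Fin 2) → Fields m W V M)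
    (X : Fin 2 → EuclideanSpace ℝ (Fin 2) → M → EuclideanSpace ℝ (Fin (m + 2)))
    (q : EuclideanSpace ℝ (Fin 2)) : M → EuclideanSpace ℝ (Fin (m + 2)) [⋀^Fin m]→L[ℝ] ℝ :=
  fieldD (fun i q' => L.insTheta (p q') (X i q')) q
    + skew (fun i j => intProd (X i q) (L.theta (p q) (velocity p q j)))
    + skew (fun i j => lieD (𝓡 (m + 2)) (X i q) (L.insTheta (p q) (X j q)))
    + (1 / 2 : ℝ) • skew (fun i j => intProd (X i q) (intProd (X j q) (L.form (p q))))

/-- The bulk integrand `ι_X E + 𝐝 E(ι_X φ; φ) + 𝔏_X E(ι_X φ; φ)`, where `X = 𝐝u ∘ u⁻¹`, evaluated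
on `(∂_0 p, ∂_1 p)` at `p(q)`. -/
def bulkTerm (p : EuclideanSpace ℝ (Fin 2) → Fields m W V M)
    (X : Fin 2 → EuclideanSpace ℝ (Fin 2) → M → EuclideanSpace ℝ (Fin (m + 2)))
    (q : EuclideanSpace ℝ (Fin 2)) : M → EuclideanSpace ℝ (Fin (m + 2)) [⋀^Fin (m + 1)]→L[ℝ] ℝ :=
  skew (fun i j => intProd (X i q) (L.E (p q) (velocity p q j)))
    + fieldD (fun i q' => L.insE (p q') (X i q')) q
    + skew (fun i j => lieD (𝓡 (m + 2)) (X i q) (L.insE (p q) (X j q)))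

end Lagrangian

/-! ### Presymplectic 2-form of a hypersurface

The hypersurface `Σ` is a compact oriented `(n-1)`-manifold with boundary `S` mapped smoothly to
spacetime; forms on spacetime are pulled back to `S`. -/

variable {S : Type*} [TopologicalSpace S] [ChartedSpace (EuclideanHalfSpace (m + 1)) S]
  [IsManifold (𝓡∂ (m + 1)) ∞ S] [CompactSpace S] [T2Space S]

/-- `∫_Σ η` for the hypersurface `j : S → M`. -/
def hyperIntegral (o : OrientationForm m S) (j : S → M)
    (η : M → EuclideanSpace ℝ (Fin (m + 2)) [⋀^Fin (m + 1)]→L[ℝ] ℝ) : ℝ :=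
  integral o (pullForm (𝓡∂ (m + 1)) (𝓡 (m + 2)) j η)

/-- `∫_{∂Σ} η` for the hypersurface `j : S → M`. -/
def hyperBdryIntegral (o : OrientationForm m S) (j : S → M)
    (η : M → EuclideanSpace ℝ (Fin (m + 2)) [⋀^Fin m]→L[ℝ] ℝ) : ℝ :=
  bdryIntegral o (pullForm (𝓡∂ (m + 1)) (𝓡 (m + 2)) j η)

/-- The presymplectic `2`-form `Θ_Σ(∂_0 p, ∂_1 p)` at `p(q)`. -/
def Lagrangian.hyperPresymp (L : Lagrangian m W V) (o : OrientationForm m S) (j : S → M)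
    (p : EuclideanSpace ℝ (Fin 2) → Fields m W V M) (q : EuclideanSpace ℝ (Fin 2)) : ℝ :=
  hyperIntegral o j (L.plotPresymp p q)

/-- The transformed presymplectic `2`-form `Θ_Σ^u = ∫_{u⁻¹(Σ)} Θ^u`, evaluated on `(∂_0 p, ∂_1 p)`
at `p(q)`. Here `Θ^u` is the pullback of `Θ` by the map `φ ↦ u(φ)^* φ` on field space, so
`Θ^u(∂_0 p, ∂_1 p) = Θ(∂_0 p^u, ∂_1 p^u)` at `p^u(q)`, with `p^u(q) = u(p(q))^* p(q)`, and the
hypersurface `u⁻¹(Σ)` is `u(p(q))⁻¹ ∘ j`. -/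
def FieldSpace.transPresymp (Φ : FieldSpace M L) (o : OrientationForm m S) (j : S → M)
    (u : Φ.carrier → (N ≃ₘ^∞⟮𝓡 (m + 2), 𝓡 (m + 2)⟯ M))
    (p : EuclideanSpace ℝ (Fin 2) → Φ.carrier) (q : EuclideanSpace ℝ (Fin 2)) : ℝ :=
  L.hyperPresymp o ((u (p q)).symm ∘ j) (fun q' => pullFields (u (p q')) (p q').1) q

end FieldSpace

end

end CovPhase

open Set Filter Topology MeasureTheory
open scoped Manifold ContDiff

set_option linter.unusedSectionVars false

namespace CovPhase

open ContinuousAlternatingMap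

/-! ### Alternating maps on finite-dimensional spaces -/

section FiniteDim

variable {E F G : Type*} [NormedAddCommGroup E] [NormedSpace ℝ E] [FiniteDimensional ℝ E]
  [NormedAddCommGroup F] [NormedSpace ℝ F] [FiniteDimensional ℝ F]
  [NormedAddCommGroup G] [NormedSpace ℝ G] {k : ℕ}

/-! The statement concerns a 2-form on field space, so it can be checked along a two-parameter
family `p` of fields. Write `u_q` for the diffeomorphism attached to `p q`, `X_i = ∂_i u ∘ u⁻¹` for
its velocities, and `θ_i = θ(∂_i p; p)`. Everything happens before integration, as an identity of
forms on spacetime.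

Cartan's formula for families (`pd_pullForm`) gives `∂_i (u^* p) = u^* (∂_i p + 𝔏_{X_i} p)`. The
momenta are natural under changes of frame because the density is, so `θ` is covariant
(`theta_pullFields`). The potential of the transformed family is therefore `u^* τ_i` with `τ_i =
θ(∂_i p + 𝔏_{X_i} p; p)`. Since `Θ` is the field-space derivative of `θ` (`plotPresymp_eq`), a
second use of Cartan's formula yields `Θ^u = u^* (∂_0 τ_1 + 𝔏_{X_0} τ_1 - (0 ↔ 1))`.

Two identities evaluate the bracket. The Noether identity `theta_lieFields` says `τ_i = θ_i +
ι_{X_i} L + dθ(ι_{X_i} p; p) - E(ι_{X_i} p; p)`; it follows from the pointwise formula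
`curryLeft_density` for `ι_v L`, which is the infinitesimal form of covariance under rank one
endomorphisms `ξ ⊗ v`. The Maurer-Cartan equation `maurerCartan` says that `∂_0 X_1 - ∂_1 X_0`
cancels the bracket `[X_0, X_1]`, by symmetry of second derivatives of `u`.

Now expand. The `θ_i` give `Θ`, the exact terms `d ι_X θ`, and terms `ι_X dθ`. The Noether terms in
`dθ(ι_X p; p)` and `E(ι_X p; p)` give the corresponding boundary and bulk terms, because `d`
commutes with `∂_i` and with `𝔏_X`. For the terms `ι_{X_i} L`, the Maurer-Cartan equation and
closedness of top-degree forms leave `ι_{X_1} ∂_0 L - ι_{X_0} ∂_1 L + d ι_{X_0} ι_{X_1} L`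
(`pd_intProd_top`). Inserting `∂_i L = E_i + dθ_i` (`pd_form`), with `E_i = E(∂_i p; p)`, cancels
all `ι_X dθ` and leaves `-ι_X E`. This is `transformed_potential`.

Integrating over `u⁻¹(Σ)` undoes the pullback `u^*`, and Stokes' theorem turns the exact part into a
boundary integral. Stokes (`integral_extD`) is proved for the integrals defined by charts: the
divergence theorem on a box in the half space, the change of variables formula between charts, and
the partition of unity. -/

instance finiteDimensional_alternating : FiniteDimensional ℝ (E [⋀^Fin k]→L[ℝ] F) := by
  let f : (E [⋀^Fin k]→L[ℝ] F) →ₗ[ℝ] MultilinearMap ℝ (fun _ : Fin k => E) F :=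
    { toFun := fun η => η.toContinuousMultilinearMap.toMultilinearMap
      map_add' := fun _ _ => rfl
      map_smul' := fun _ _ => rfl }
  refine Module.Finite.of_injective f fun a b h => ?_
  ext v
  exact congrArg (fun g : MultilinearMap ℝ (fun _ : Fin k => E) F => g v) h

variable {s : Set G} {x : G} {n : WithTop ℕ∞}

/-- Smoothness of a function valued in alternating maps is smoothness of all its evaluations. -/
theorem contDiffWithinAt_alternating_iff {f : G → E [⋀^Fin k]→L[ℝ] F} :
    ContDiffWithinAt ℝ n f s x ↔ ∀ v, ContDiffWithinAt ℝ n (fun y => f y v) s x := by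
  constructor
  · intro h v
    exact (ContinuousAlternatingMap.apply ℝ E F v).contDiff.comp_contDiffWithinAt h
  · intro h
    let b := Module.finBasis ℝ E
    -- Evaluation on all tuples of basis vectors is injective, so it has a linear left inverse,
    -- which is continuous by finite dimension. Composing with it recovers `f` from finitely many
    -- smooth evaluations.
    let T : (E [⋀^Fin k]→L[ℝ] F) →ₗ[ℝ] ((Fin k → Fin (Module.finrank ℝ E)) → F) :=
      { toFun := fun η σ => η (fun i => b (σ i))
        map_add' := fun _ _ => rfl
        map_smul' := fun _ _ => rfl }
    have hT : LinearMap.ker T = ⊥ := by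
      refine LinearMap.ker_eq_bot'.2 fun η hη => ?_
      apply ContinuousAlternatingMap.toAlternatingMap_injective
      refine Module.Basis.ext_alternating b fun σ _ => ?_
      exact congrFun hη σ
    obtain ⟨R, hR⟩ := LinearMap.exists_leftInverse_of_injective T hT
    have h2 : ContDiffWithinAt ℝ n (fun y => T (f y)) s x :=
      contDiffWithinAt_pi.2 fun σ => h _
    have h3 := (LinearMap.toContinuousLinearMap R).contDiff.comp_contDiffWithinAt h2
    refine h3.congr (fun y _ => ?_) ?_ <;>
    · simp only [Function.comp, LinearMap.coe_toContinuousLinearMap']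
      rw [← LinearMap.comp_apply, hR]; rfl

/-- Induction on the degree: inserting one moving vector is a continuous bilinear operation and
lowers the degree by one. -/
theorem contDiffWithinAt_alternating_apply {f : G → E [⋀^Fin k]→L[ℝ] F} {v : Fin k → G → E}
    (hf : ContDiffWithinAt ℝ n f s x) (hv : ∀ i, ContDiffWithinAt ℝ n (v i) s x) :
    ContDiffWithinAt ℝ n (fun y => f y (fun i => v i y)) s x := by
  induction k with
  | zero =>
    have : (fun y => f y (fun i => v i y)) = fun y => f y ![] := by
      ext y; congr 1; ext i; exact i.elim0
    rw [this]
    exact contDiffWithinAt_alternating_iff.1 hf _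
  | succ k ih =>
    have h1 : ContDiffWithinAt ℝ n (fun y => (f y).curryLeft (v 0 y)) s x :=
      by
      let T : (E [⋀^Fin (k + 1)]→L[ℝ] F) →L[ℝ] (E →L[ℝ] E [⋀^Fin k]→L[ℝ] F) :=
        (curryLeftLI (𝕜 := ℝ) (E := E) (F := F) (n := k)).toContinuousLinearMap
      have h0 := (ContinuousLinearMap.contDiff (E := E [⋀^Fin (k + 1)]→L[ℝ] F)
        (F := E →L[ℝ] E [⋀^Fin k]→L[ℝ] F) (n := n) T).comp_contDiffWithinAt hf
      exact h0.clm_apply (hv 0)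
    have h2 := ih (f := fun y => (f y).curryLeft (v 0 y)) (v := fun i => v i.succ) h1
      fun i => hv _
    refine h2.congr_of_eventuallyEq (Eventually.of_forall fun y => ?_) ?_ <;>
    · simp only [curryLeft_apply_apply]
      congr 1
      ext i
      refine Fin.cases ?_ (fun i => ?_) i <;> simp

variable {E' : Type*} [NormedAddCommGroup E'] [NormedSpace ℝ E']

theorem contDiffWithinAt_compContinuousLinearMap [FiniteDimensional ℝ E'] {f : G → E' [⋀^Fin k]→L[ℝ] F}
    {g : G → E →L[ℝ] E'} (hf : ContDiffWithinAt ℝ n f s x) (hg : ContDiffWithinAt ℝ n g s x) :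
    ContDiffWithinAt ℝ n (fun y => (f y).compContinuousLinearMap (g y)) s x := by
  refine contDiffWithinAt_alternating_iff.2 fun v => ?_
  exact contDiffWithinAt_alternating_apply (f := f) (v := fun i y => g y (v i)) hf
    fun i => hg.clm_apply contDiffWithinAt_const

end FiniteDim

/-! ### Antisymmetrisation and contraction -/

section Alt

variable {E E' F : Type*} [NormedAddCommGroup E] [NormedSpace ℝ E]
  [NormedAddCommGroup E'] [NormedSpace ℝ E']
  [NormedAddCommGroup F] [NormedSpace ℝ F] {k : ℕ}

/-- `ι_v` as a continuous linear map. -/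
noncomputable def iota (k : ℕ) (F : Type*) [NormedAddCommGroup F] [NormedSpace ℝ F] (v : E) :
    (E [⋀^Fin (k + 1)]→L[ℝ] F) →L[ℝ] (E [⋀^Fin k]→L[ℝ] F) :=
  (ContinuousLinearMap.apply ℝ _ v).comp (curryLeftLI (𝕜 := ℝ) (E := E) (F := F)
      (n := k)).toContinuousLinearMap

@[simp] theorem iota_apply (v : E) (η : E [⋀^Fin (k + 1)]→L[ℝ] F) :
    iota k F v η = η.curryLeft v := rfl

/-- The antiderivation rule `ι_v (ξ ∧ η) = ξ(v) η - ξ ∧ ι_v η`. The summand of index `0` in the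
alternating sum puts `v` into the first argument of `f`, and each remaining one puts `v` into the
form, with sign shifted by one. It is the algebra behind Cartan's formula and behind the coefficient
identities. -/
theorem curryLeft_alternatizeUncurryFin (f : E →L[ℝ] E [⋀^Fin (k + 1)]→L[ℝ] F) (v : E) :
    (alternatizeUncurryFin f).curryLeft v =
      f v - alternatizeUncurryFin ((iota k F v).comp f) := by
  ext w
  simp only [curryLeft_apply_apply, alternatizeUncurryFin_apply, ContinuousAlternatingMap.sub_apply]
  rw [Fin.sum_univ_succ, sub_eq_add_neg, ← Finset.sum_neg_distrib]
  congr 1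
  · simp
  · refine Finset.sum_congr rfl fun i _ => ?_
    simp only [Matrix.cons_val_succ, ContinuousLinearMap.comp_apply, iota_apply,
      curryLeft_apply_apply, Fin.val_succ, pow_succ, mul_neg, mul_one, neg_smul]
    congr 3
    ext j
    refine Fin.cases ?_ (fun j => ?_) j
    · simp [Fin.removeNth]
    · simp [Fin.removeNth]

theorem curryLeft_alternatizeUncurryFin_zero (f : E →L[ℝ] E [⋀^Fin 0]→L[ℝ] F) (v : E) :
    (alternatizeUncurryFin f).curryLeft v = f v := by
  ext w
  simp only [curryLeft_apply_apply, alternatizeUncurryFin_apply]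
  simp

theorem alternatizeUncurryFin_compContinuousLinearMap (f : E' →L[ℝ] E' [⋀^Fin k]→L[ℝ] F)
    (g : E →L[ℝ] E') :
    (alternatizeUncurryFin f).compContinuousLinearMap g =
      alternatizeUncurryFin (((compContinuousLinearMapCLM g).comp f).comp g) := by
  ext v
  simp only [compContinuousLinearMap_apply, alternatizeUncurryFin_apply]
  rfl

/-- The part of `ι_X d η + d ι_X η` which is algebraic in `η`. -/
theorem fderivComp_id (η : E [⋀^Fin (k + 1)]→L[ℝ] F) (h : E →L[ℝ] E) :
    η.fderivCompContinuousLinearMap (ContinuousLinearMap.id ℝ E) h =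
      alternatizeUncurryFin (η.curryLeft.comp h) := by
  rw [fderivCompContinuousLinearMap_eq_alternatizeUncurryFin]
  simp only [ContinuousLinearMap.comp_apply, alternatizeUncurryFinCLM_apply]
  congr 1

/-- If `g_t` moves with velocity `h ∘ g`, the derivative of `g_t^* η` is the infinitesimal action of
`h` followed by pullback along `g`. In `pd_pullForm` this extracts `u^*` from the derivative of a
pullback. -/
theorem fderivComp_mul (η : E' [⋀^Fin k]→L[ℝ] F) (g : E →L[ℝ] E') (h : E' →L[ℝ] E') :
    η.fderivCompContinuousLinearMap g (h.comp g) =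
      (η.fderivCompContinuousLinearMap (ContinuousLinearMap.id ℝ E') h).compContinuousLinearMap
        g := by
  ext v
  simp only [fderivCompContinuousLinearMap_apply, compContinuousLinearMap_apply]
  refine Finset.sum_congr rfl fun i _ => ?_
  congr 1
  ext j
  by_cases hj : j = i
  · subst hj; simp
  · simp [Function.update_of_ne hj]

end Alt

/-! ### Wedge products and coefficients -/

section Bilinear

variable {E F G : Type*} [NormedAddCommGroup E] [NormedSpace ℝ E] [FiniteDimensional ℝ E]
  [NormedAddCommGroup F] [NormedSpace ℝ F] [FiniteDimensional ℝ F]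
  [NormedAddCommGroup G] [NormedSpace ℝ G]

/-- A bilinear map on finite-dimensional spaces as a continuous bilinear map. -/
noncomputable def bilinCLM (B : E →ₗ[ℝ] F →ₗ[ℝ] G) : E →L[ℝ] F →L[ℝ] G :=
  LinearMap.toContinuousLinearMap
    ((LinearMap.toContinuousLinearMap : (F →ₗ[ℝ] G) ≃ₗ[ℝ] _).toLinearMap.comp B)

@[simp] theorem bilinCLM_apply (B : E →ₗ[ℝ] F →ₗ[ℝ] G) (x : E) (y : F) :
    bilinCLM B x y = B x y := rfl

end Bilinear

section Wedge

variable {n k : ℕ} {W : Type*} [NormedAddCommGroup W] [NormedSpace ℝ W]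

theorem pairZero_apply (c : W) (P : EuclideanSpace ℝ (Fin n) [⋀^Fin k]→L[ℝ] (W →L[ℝ] ℝ)) (v) :
    pairZero c P v = P v c := rfl

@[simp] theorem pairCLM_apply (c : W)
    (P : EuclideanSpace ℝ (Fin n) [⋀^Fin k]→L[ℝ] (W →L[ℝ] ℝ)) :
    pairCLM P c = pairZero c P := rfl

theorem pairZero_flip (c : W)
    (f : W →L[ℝ] (EuclideanSpace ℝ (Fin n) [⋀^Fin k]→L[ℝ] ℝ)) :
    pairZero c f.flipAlternating = f c := by
  ext v; rfl

theorem pairCLM_flip (f : W →L[ℝ] (EuclideanSpace ℝ (Fin n) [⋀^Fin k]→L[ℝ] ℝ)) :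
    pairCLM f.flipAlternating = f := by
  ext c v; rfl

theorem wedgeOne_apply (a : EuclideanSpace ℝ (Fin n) [⋀^Fin 1]→L[ℝ] W)
    (P : EuclideanSpace ℝ (Fin n) [⋀^Fin k]→L[ℝ] (W →L[ℝ] ℝ)) (v) :
    wedgeOne a P v = ∑ i : Fin (k + 1), (-1) ^ (i : ℕ) * P (i.removeNth v) (a fun _ => v i) := by
  rw [wedgeOne, alternatizeUncurryFin_apply]
  simp [pairZero_apply]

variable (n k W) in
/-- The wedge product as a bilinear map. -/
noncomputable def wedgeBil : (EuclideanSpace ℝ (Fin n) [⋀^Fin 1]→L[ℝ] W) →ₗ[ℝ]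
    (EuclideanSpace ℝ (Fin n) [⋀^Fin k]→L[ℝ] (W →L[ℝ] ℝ)) →ₗ[ℝ]
      (EuclideanSpace ℝ (Fin n) [⋀^Fin (k + 1)]→L[ℝ] ℝ) :=
  LinearMap.mk₂ ℝ wedgeOne
    (fun a b P => by ext v; simp [wedgeOne_apply, mul_add, Finset.sum_add_distrib])
    (fun r a P => by ext v; simp [wedgeOne_apply, mul_left_comm, Finset.mul_sum])
    (fun a P Q => by ext v; simp [wedgeOne_apply, mul_add, Finset.sum_add_distrib])
    (fun r a P => by ext v; simp [wedgeOne_apply, mul_left_comm, Finset.mul_sum])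

theorem wedgeBil_apply (a : EuclideanSpace ℝ (Fin n) [⋀^Fin 1]→L[ℝ] W)
    (P : EuclideanSpace ℝ (Fin n) [⋀^Fin k]→L[ℝ] (W →L[ℝ] ℝ)) :
    wedgeBil n k W a P = wedgeOne a P := rfl

variable (n k W) in
/-- The pairing with a `0`-covector as a bilinear map. -/
noncomputable def pairBil : W →ₗ[ℝ]
    (EuclideanSpace ℝ (Fin n) [⋀^Fin k]→L[ℝ] (W →L[ℝ] ℝ)) →ₗ[ℝ]
      (EuclideanSpace ℝ (Fin n) [⋀^Fin k]→L[ℝ] ℝ) :=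
  LinearMap.mk₂ ℝ pairZero
    (fun a b P => by ext v; simp [pairZero_apply])
    (fun r a P => by ext v; simp [pairZero_apply])
    (fun a P Q => by ext v; simp [pairZero_apply])
    (fun r a P => by ext v; simp [pairZero_apply])

theorem pairBil_apply (c : W)
    (P : EuclideanSpace ℝ (Fin n) [⋀^Fin k]→L[ℝ] (W →L[ℝ] ℝ)) :
    pairBil n k W c P = pairZero c P := rfl

variable {l : ℕ}

theorem wedgeOne_comp (a : EuclideanSpace ℝ (Fin n) [⋀^Fin 1]→L[ℝ] W)
    (P : EuclideanSpace ℝ (Fin n) [⋀^Fin k]→L[ℝ] (W →L[ℝ] ℝ))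
    (g : EuclideanSpace ℝ (Fin l) →L[ℝ] EuclideanSpace ℝ (Fin n)) :
    (wedgeOne a P).compContinuousLinearMap g =
      wedgeOne (a.compContinuousLinearMap g) (P.compContinuousLinearMap g) := by
  ext v
  simp only [compContinuousLinearMap_apply, wedgeOne_apply]
  rfl

theorem pairZero_comp (c : W)
    (P : EuclideanSpace ℝ (Fin n) [⋀^Fin k]→L[ℝ] (W →L[ℝ] ℝ))
    (g : EuclideanSpace ℝ (Fin l) →L[ℝ] EuclideanSpace ℝ (Fin n)) :
    (pairZero c P).compContinuousLinearMap g = pairZero c (P.compContinuousLinearMap g) := by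
  ext v; rfl

/-- Forms of degree above the dimension vanish. -/
theorem eq_zero_of_lt {F : Type*} [NormedAddCommGroup F] [NormedSpace ℝ F] (h : n < k)
    (η : EuclideanSpace ℝ (Fin n) [⋀^Fin k]→L[ℝ] F) : η = 0 := by
  apply ContinuousAlternatingMap.toAlternatingMap_injective
  refine Module.Basis.ext_alternating (EuclideanSpace.basisFun (Fin n) ℝ).toBasis fun σ hσ => ?_
  have := Fintype.card_le_of_injective σ hσ
  simp at this
  omega

theorem ext_basisVec {F : Type*} [NormedAddCommGroup F] [NormedSpace ℝ F]
    {η ζ : EuclideanSpace ℝ (Fin n) [⋀^Fin k]→L[ℝ] F}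
    (h : ∀ σ : Fin k → Fin n, Function.Injective σ →
      η (fun i => basisVec (σ i)) = ζ (fun i => basisVec (σ i))) : η = ζ := by
  apply ContinuousAlternatingMap.toAlternatingMap_injective
  refine Module.Basis.ext_alternating (EuclideanSpace.basisFun (Fin n) ℝ).toBasis fun σ hσ => ?_
  simpa [basisVec] using h σ hσ

@[simp] theorem basisCovec_basisVec (i j : Fin n) :
    basisCovec i (basisVec j) = if i = j then (1 : ℝ) else 0 := by
  simp [basisCovec, basisVec]

@[simp] theorem covec1_apply (i : Fin n) (c : W) (v : Fin 1 → EuclideanSpace ℝ (Fin n)) :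
    covec1 i c v = basisCovec i (v 0) • c := rfl

theorem covec2_apply (i j : Fin n) (c : W) (v : Fin 2 → EuclideanSpace ℝ (Fin n)) :
    covec2 i j c v = (basisCovec i (v 0) * basisCovec j (v 1)) • c
      - (basisCovec i (v 1) * basisCovec j (v 0)) • c := by
  have : covec2 i j c = alternatizeUncurryFin ((basisCovec i).smulRight (covec1 j c)) := rfl
  rw [this, alternatizeUncurryFin_apply, Fin.sum_univ_two]
  simp [mul_smul, Fin.removeNth, sub_eq_add_neg, Fin.succAbove]
  rfl

theorem covec2_swap (i j : Fin n) (c : W) : covec2 i j c = - covec2 j i c := by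
  ext v
  simp only [covec2_apply, ContinuousAlternatingMap.neg_apply, neg_sub, mul_comm]

theorem contract_eq_iota (i : Fin n) :
    contract (k := k) i = iota k ℝ (basisVec i) := rfl

theorem sum_covec1 (a : EuclideanSpace ℝ (Fin n) [⋀^Fin 1]→L[ℝ] W) :
    ∑ i, covec1 i (a fun _ => basisVec i) = a := by
  refine ext_basisVec fun σ _ => ?_
  simp [ContinuousAlternatingMap.sum_apply]
  congr 1
  ext i
  fin_cases i
  rfl

/-- The sum runs over all ordered pairs without a factor one half: `f` need not be antisymmetric,
and each `covec2 i j` already antisymmetrises. -/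
theorem sum_covec2 (f : EuclideanSpace ℝ (Fin n) →L[ℝ]
      (EuclideanSpace ℝ (Fin n) [⋀^Fin 1]→L[ℝ] W)) :
    ∑ i, ∑ j, covec2 i j (f (basisVec i) fun _ => basisVec j) = alternatizeUncurryFin f := by
  refine ext_basisVec fun σ _ => ?_
  rw [alternatizeUncurryFin_apply, Fin.sum_univ_two]
  simp only [ContinuousAlternatingMap.sum_apply, covec2_apply, basisCovec_basisVec, mul_smul,
    Finset.sum_sub_distrib, ite_smul, one_smul, zero_smul]
  simp [sub_eq_add_neg]
  congr 3 <;> ext i <;> fin_cases i <;> rfl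

/-- The antisymmetrisation of `f` has degree above the dimension and vanishes, so the antiderivation
rule reduces to this equality. It says `∑ ξ^i ∧ ι_v ω_i = ∑ ξ^i(v) ω_i` for forms `ω_i` of top
degree. -/
theorem alternatize_iota_top {n : ℕ} {F : Type*} [NormedAddCommGroup F] [NormedSpace ℝ F]
    (f : EuclideanSpace ℝ (Fin (n + 1)) →L[ℝ] (EuclideanSpace ℝ (Fin (n + 1)) [⋀^Fin (n + 1)]→L[ℝ] F))
    (v) : alternatizeUncurryFin ((iota n F v).comp f) = f v := by
  have h := curryLeft_alternatizeUncurryFin f v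
  rw [eq_zero_of_lt (by omega) (alternatizeUncurryFin f), curryLeft_zero] at h
  exact (sub_eq_zero.1 (by simpa using h.symm)).symm

theorem alternatizeUncurryFin_sum {ι E F : Type*} [NormedAddCommGroup E] [NormedSpace ℝ E]
    [NormedAddCommGroup F] [NormedSpace ℝ F] (s : Finset ι)
    (f : ι → E →L[ℝ] (E [⋀^Fin k]→L[ℝ] F)) :
    alternatizeUncurryFin (∑ i ∈ s, f i) = ∑ i ∈ s, alternatizeUncurryFin (f i) :=
  _root_.map_sum (alternatizeUncurryFinCLM ℝ E F) f s

/-- A `1`-covector as a linear map. -/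
noncomputable abbrev oneLin (a : EuclideanSpace ℝ (Fin n) [⋀^Fin 1]→L[ℝ] W) :
    EuclideanSpace ℝ (Fin n) →L[ℝ] W :=
  (ContinuousAlternatingMap.ofSubsingleton ℝ (EuclideanSpace ℝ (Fin n)) W (0 : Fin 1)).symm a

theorem oneLin_apply (a : EuclideanSpace ℝ (Fin n) [⋀^Fin 1]→L[ℝ] W) (v) :
    oneLin a v = a (fun _ => v) := rfl

theorem wedgeOne_flip (a : EuclideanSpace ℝ (Fin n) [⋀^Fin 1]→L[ℝ] W)
    (f : W →L[ℝ] (EuclideanSpace ℝ (Fin n) [⋀^Fin k]→L[ℝ] ℝ)) :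
    wedgeOne a f.flipAlternating = alternatizeUncurryFin (f.comp (oneLin a)) := by
  rw [wedgeOne, pairCLM_flip]

/-- Each summand `ι_{e_i} T(ξ^i ⊗ ·)` of the coefficient wedged with `a` becomes `T(ξ^i ⊗ a(e_i))`
by `alternatize_iota_top`, and these add up to `T a`. -/
theorem wedgeOne_coeff1 {n : ℕ} (T : (EuclideanSpace ℝ (Fin (n + 1)) [⋀^Fin 1]→L[ℝ] W) →L[ℝ]
    (EuclideanSpace ℝ (Fin (n + 1)) [⋀^Fin (n + 1)]→L[ℝ] ℝ)) (a) :
    wedgeOne a (coeff1 T) = T a := by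
  have : (∑ i, (contract i).comp (T.comp (covec1 i))).comp (oneLin a) =
      ∑ i, (iota n ℝ (basisVec i)).comp ((T.comp (covec1 i)).comp (oneLin a)) := by
    ext; simp [contract_eq_iota]
  rw [coeff1, wedgeOne_flip, this, alternatizeUncurryFin_sum]
  simp only [alternatize_iota_top]
  conv_rhs => rw [← sum_covec1 a, _root_.map_sum]
  rfl

theorem pairZero_coeff0 (T : (EuclideanSpace ℝ (Fin n) [⋀^Fin 0]→L[ℝ] W) →L[ℝ]
    (EuclideanSpace ℝ (Fin n) [⋀^Fin k]→L[ℝ] ℝ)) (b : EuclideanSpace ℝ (Fin n) [⋀^Fin 0]→L[ℝ] W) :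
    pairZero (b 0) (coeff0 T) = T b := by
  rw [coeff0, pairZero_flip]
  simp
  congr 1
  ext v
  simp
  congr 1
  exact Subsingleton.elim _ _

/-- Half of the defining property of `coeff2`: one of its two contractions is removed by wedging
with a `1`-covector. The other is removed in `alternatize_wedgeOne_coeff2`. -/
theorem wedgeOne_coeff2_eq {n : ℕ} (T : (EuclideanSpace ℝ (Fin (n + 2)) [⋀^Fin 2]→L[ℝ] W) →L[ℝ]
    (EuclideanSpace ℝ (Fin (n + 2)) [⋀^Fin (n + 2)]→L[ℝ] ℝ)) (a) :
    wedgeOne a (coeff2 T) =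
      ∑ i, ∑ j, (T (covec2 i j (a fun _ => basisVec j))).curryLeft (basisVec i) := by
  have h1 : ((1 / 2 : ℝ) • ∑ i, ∑ j,
      (contract j).comp ((contract i).comp (T.comp (covec2 i j)))).comp (oneLin a) =
      (1 / 2 : ℝ) • ∑ i, ∑ j, (iota n ℝ (basisVec j)).comp
        ((iota (n + 1) ℝ (basisVec i)).comp ((T.comp (covec2 i j)).comp (oneLin a))) := by
    ext; simp [contract_eq_iota]
  -- Antiderivation rule for `ι_{e_j}`, with `alternatize_iota_top` removing `ι_{e_i}` in the
  -- correction term. Its minus sign is absorbed by the antisymmetry of `covec2`.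
  have h2 : ∀ i j : Fin (n + 2), alternatizeUncurryFin ((iota n ℝ (basisVec j)).comp
        ((iota (n + 1) ℝ (basisVec i)).comp ((T.comp (covec2 i j)).comp (oneLin a)))) =
      (T (covec2 i j (a fun _ => basisVec j))).curryLeft (basisVec i)
      + (T (covec2 j i (a fun _ => basisVec i))).curryLeft (basisVec j) := by
    intro i j
    have h3 := curryLeft_alternatizeUncurryFin
      ((iota (n + 1) ℝ (basisVec i)).comp ((T.comp (covec2 i j)).comp (oneLin a))) (basisVec j)
    rw [alternatize_iota_top] at h3
    rw [eq_sub_iff_add_eq, ← eq_sub_iff_add_eq'] at h3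
    rw [h3, sub_eq_add_neg]
    congr 1
    simp only [ContinuousLinearMap.comp_apply, oneLin_apply]
    rw [covec2_swap i j, map_neg]
    ext; simp
  rw [coeff2, wedgeOne_flip, h1, alternatizeUncurryFin_smul, alternatizeUncurryFin_sum]
  simp only [alternatizeUncurryFin_sum, h2, Finset.sum_add_distrib]
  -- After exchanging indices the two terms have the same double sum, and the resulting factor `2`
  -- cancels the `1 / 2` in `coeff2`.
  rw [Finset.sum_comm (f := fun i j => (T (covec2 j i (a fun _ => basisVec i))).curryLeft
    (basisVec j)), ← two_smul ℝ, smul_smul]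
  norm_num

variable [FiniteDimensional ℝ W]

/-- Wedge product with a fixed covector on the right. -/
noncomputable def wedgeRight (P : EuclideanSpace ℝ (Fin n) [⋀^Fin k]→L[ℝ] (W →L[ℝ] ℝ)) :
    (EuclideanSpace ℝ (Fin n) [⋀^Fin 1]→L[ℝ] W) →L[ℝ]
      (EuclideanSpace ℝ (Fin n) [⋀^Fin (k + 1)]→L[ℝ] ℝ) :=
  (bilinCLM (wedgeBil n k W)).flip P

@[simp] theorem wedgeRight_apply (P : EuclideanSpace ℝ (Fin n) [⋀^Fin k]→L[ℝ] (W →L[ℝ] ℝ)) (a) :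
    wedgeRight P a = wedgeOne a P := rfl

/-- The property `T(b) = b ∧ coeff2 T`, for `b` the antisymmetrisation of `f`, with `b ∧ Q`
expressed as the antisymmetrisation of `v ↦ f(v) ∧ Q`. In this shape `d(δA) ∧ ∂L/∂(dA)` occurs in
`dθ`. -/
theorem alternatize_wedgeOne_coeff2 {n : ℕ}
    (T : (EuclideanSpace ℝ (Fin (n + 2)) [⋀^Fin 2]→L[ℝ] W) →L[ℝ]
      (EuclideanSpace ℝ (Fin (n + 2)) [⋀^Fin (n + 2)]→L[ℝ] ℝ))
    (f : EuclideanSpace ℝ (Fin (n + 2)) →L[ℝ]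
      (EuclideanSpace ℝ (Fin (n + 2)) [⋀^Fin 1]→L[ℝ] W)) :
    alternatizeUncurryFin ((wedgeRight (coeff2 T)).comp f) = T (alternatizeUncurryFin f) := by
  have h1 : (wedgeRight (coeff2 T)).comp f = ∑ i, ∑ j, (iota (n + 1) ℝ (basisVec i)).comp
      ((T.comp (covec2 i j)).comp ((ContinuousAlternatingMap.apply ℝ _ W
        (fun _ : Fin 1 => basisVec j)).comp f)) := by
    ext v : 1
    simp [wedgeOne_coeff2_eq]
  rw [h1, alternatizeUncurryFin_sum]
  simp only [alternatizeUncurryFin_sum, alternatize_iota_top]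
  rw [← sum_covec2 f]
  simp

/-- Wedge product with a fixed `1`-covector on the left. -/
noncomputable def wedgeLeft (k : ℕ) (a : EuclideanSpace ℝ (Fin n) [⋀^Fin 1]→L[ℝ] W) :
    (EuclideanSpace ℝ (Fin n) [⋀^Fin k]→L[ℝ] (W →L[ℝ] ℝ)) →L[ℝ]
      (EuclideanSpace ℝ (Fin n) [⋀^Fin (k + 1)]→L[ℝ] ℝ) :=
  bilinCLM (E := EuclideanSpace ℝ (Fin n) [⋀^Fin 1]→L[ℝ] W)
    (F := EuclideanSpace ℝ (Fin n) [⋀^Fin k]→L[ℝ] (W →L[ℝ] ℝ))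
    (G := EuclideanSpace ℝ (Fin n) [⋀^Fin (k + 1)]→L[ℝ] ℝ) (wedgeBil n k W) a

@[simp] theorem wedgeLeft_apply (P : EuclideanSpace ℝ (Fin n) [⋀^Fin k]→L[ℝ] (W →L[ℝ] ℝ)) (a) :
    wedgeLeft k a P = wedgeOne a P := rfl

/-- `P ↦ a ∧ P` anticommutes with multiplication by scalar `1`-covectors. -/
theorem alternatize_wedgeLeft (a : EuclideanSpace ℝ (Fin n) [⋀^Fin 1]→L[ℝ] W)
    (g : EuclideanSpace ℝ (Fin n) →L[ℝ] (EuclideanSpace ℝ (Fin n) [⋀^Fin k]→L[ℝ] (W →L[ℝ] ℝ))) :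
    alternatizeUncurryFin ((wedgeLeft k a).comp g) = - wedgeOne a (alternatizeUncurryFin g) := by
  -- A symmetric bilinear map antisymmetrised twice is zero. For this symmetrised product of `a` and
  -- `g`, the two halves of the vanishing sum are the two sides of the claim.
  let f : EuclideanSpace ℝ (Fin n) →L[ℝ] EuclideanSpace ℝ (Fin n) →L[ℝ]
      (EuclideanSpace ℝ (Fin n) [⋀^Fin k]→L[ℝ] ℝ) :=
    bilinCLM (LinearMap.mk₂ ℝ
      (fun w w' => pairZero (oneLin a w') (g w) + pairZero (oneLin a w) (g w'))
      (fun _ _ _ => by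
        ext v
        simp only [map_add, ContinuousAlternatingMap.add_apply, pairZero_apply,
          _root_.add_apply]
        ring)
      (fun _ _ _ => by
        ext v
        simp only [map_smul, ContinuousAlternatingMap.add_apply, pairZero_apply,
          _root_.smul_apply, ContinuousAlternatingMap.smul_apply, smul_add])
      (fun _ _ _ => by
        ext v
        simp only [map_add, ContinuousAlternatingMap.add_apply, pairZero_apply,
          _root_.add_apply]
        ring)
      (fun _ _ _ => by
        ext v
        simp only [map_smul, ContinuousAlternatingMap.add_apply, pairZero_apply,
          _root_.smul_apply, ContinuousAlternatingMap.smul_apply, smul_add]))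
  have hf : ∀ w w', f w w' = pairZero (oneLin a w') (g w) + pairZero (oneLin a w) (g w') :=
    fun _ _ => rfl
  have h := alternatizeUncurryFin_alternatizeUncurryFinCLM_comp_of_symmetric (f := f)
    (fun x y => by rw [hf, hf, add_comm])
  rw [eq_neg_iff_add_eq_zero, ← h, wedgeOne, ← alternatizeUncurryFin_add]
  congr 1
  ext w v
  simp only [_root_.add_apply, ContinuousLinearMap.comp_apply,
    ContinuousAlternatingMap.add_apply, wedgeLeft_apply, wedgeOne_apply,
    alternatizeUncurryFinCLM_apply, alternatizeUncurryFin_apply, hf, pairCLM_apply,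
    pairZero_apply, smul_add, Finset.sum_add_distrib]
  simp [oneLin]

/-! ### Uniqueness and naturality of coefficients -/

/-- Below top degree, any list of `k` basis vectors omits some `e_i`. Evaluating `ξ^i ∧ η` on `e_i`
followed by that list returns the value of `η` on the list. -/
theorem eq_zero_of_alternatize {F : Type*} [NormedAddCommGroup F] [NormedSpace ℝ F] (hk : k < n)
    (η : EuclideanSpace ℝ (Fin n) [⋀^Fin k]→L[ℝ] F)
    (h : ∀ ξ : EuclideanSpace ℝ (Fin n) →L[ℝ] ℝ, alternatizeUncurryFin (ξ.smulRight η) = 0) :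
    η = 0 := by
  refine ext_basisVec fun σ _ => ?_
  obtain ⟨i, hi⟩ : ∃ i, ∀ j, σ j ≠ i := by
    by_contra! hc
    have := Fintype.card_le_of_surjective σ hc
    simp at this
    omega
  have h1 := congrArg (fun θ => θ (Fin.cons (basisVec i) fun j => basisVec (σ j)))
    (h (basisCovec i))
  simp only [alternatizeUncurryFin_apply, Fin.sum_univ_succ] at h1
  simpa [Ne.symm (hi _)] using h1

omit [FiniteDimensional ℝ W] in
-- Testing with `a = ξ ⊗ c` gives `ξ ∧ (c · P) = 0` for all `ξ` and `c`, which reduces to scalar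
-- forms.
theorem eq_zero_of_wedgeOne (hk : k < n)
    (P : EuclideanSpace ℝ (Fin n) [⋀^Fin k]→L[ℝ] (W →L[ℝ] ℝ))
    (h : ∀ a, wedgeOne a P = 0) : P = 0 := by
  have h1 : ∀ c, pairZero c P = 0 := fun c => by
    refine eq_zero_of_alternatize hk _ fun ξ => ?_
    rw [← h (ContinuousAlternatingMap.ofSubsingleton ℝ _ W (0 : Fin 1) (ξ.smulRight c))]
    ext v
    simp [alternatizeUncurryFin_apply, wedgeOne_apply, pairZero_apply]
  ext v c
  exact congrArg (fun θ => θ v) (h1 c)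

/-- Naturality of the coefficient of a map on `1`-covectors. -/
theorem coeff1_natural {n : ℕ} {T T' : (EuclideanSpace ℝ (Fin (n + 1)) [⋀^Fin 1]→L[ℝ] W) →L[ℝ]
    (EuclideanSpace ℝ (Fin (n + 1)) [⋀^Fin (n + 1)]→L[ℝ] ℝ)}
    (g : EuclideanSpace ℝ (Fin (n + 1)) ≃L[ℝ] EuclideanSpace ℝ (Fin (n + 1)))
    (h : ∀ a, T' (a.compContinuousLinearMap g) = (T a).compContinuousLinearMap g) :
    coeff1 T' = (coeff1 T).compContinuousLinearMap g := by
  rw [← sub_eq_zero]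
  -- A coefficient below top degree is determined by its wedge products with all `a`, and those are
  -- the values of `T'` and of the transported `T`. Every `a` is a pullback along the invertible
  -- `g`, so `h` covers all cases.
  refine eq_zero_of_wedgeOne (by omega) _ fun a => ?_
  have h2 : a = (a.compContinuousLinearMap
      (g.symm : EuclideanSpace ℝ (Fin (n + 1)) →L[ℝ] EuclideanSpace ℝ (Fin (n + 1)))).compContinuousLinearMap
        (g : EuclideanSpace ℝ (Fin (n + 1)) →L[ℝ] EuclideanSpace ℝ (Fin (n + 1))) := by
    ext v; simp; congr 1; ext; simp
  rw [← wedgeLeft_apply, map_sub, wedgeLeft_apply, wedgeLeft_apply, wedgeOne_coeff1, sub_eq_zero]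
  conv_rhs => rw [h2]
  rw [← wedgeOne_comp, wedgeOne_coeff1, ← h, ← h2]

/-- Naturality of the coefficient of a map on `2`-covectors. -/
theorem coeff2_natural {n : ℕ} {T T' : (EuclideanSpace ℝ (Fin (n + 2)) [⋀^Fin 2]→L[ℝ] W) →L[ℝ]
    (EuclideanSpace ℝ (Fin (n + 2)) [⋀^Fin (n + 2)]→L[ℝ] ℝ)}
    (g : EuclideanSpace ℝ (Fin (n + 2)) ≃L[ℝ] EuclideanSpace ℝ (Fin (n + 2)))
    (h : ∀ a, T' (a.compContinuousLinearMap g) = (T a).compContinuousLinearMap g) :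
    coeff2 T' = (coeff2 T).compContinuousLinearMap g := by
  -- The two candidates for the coefficient have the same product with every antisymmetrised `f`,
  -- obtained by transporting `f` along `g⁻¹`, applying `T`, and transporting back.
  have key : ∀ f : EuclideanSpace ℝ (Fin (n + 2)) →L[ℝ]
        (EuclideanSpace ℝ (Fin (n + 2)) [⋀^Fin 1]→L[ℝ] W), alternatizeUncurryFin ((wedgeRight (coeff2 T')).comp f) =
      alternatizeUncurryFin ((wedgeRight ((coeff2 T).compContinuousLinearMap
        (g : EuclideanSpace ℝ (Fin (n + 2)) →L[ℝ] EuclideanSpace ℝ (Fin (n + 2))))).comp f) := by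
    intro f
    let f' : EuclideanSpace ℝ (Fin (n + 2)) →L[ℝ]
        (EuclideanSpace ℝ (Fin (n + 2)) [⋀^Fin 1]→L[ℝ] W) :=
      ((compContinuousLinearMapCLM (g.symm : EuclideanSpace ℝ (Fin (n + 2)) →L[ℝ]
        EuclideanSpace ℝ (Fin (n + 2)))).comp f).comp
          (g.symm : EuclideanSpace ℝ (Fin (n + 2)) →L[ℝ] EuclideanSpace ℝ (Fin (n + 2)))
    have hf : ∀ v, (f' (g v)).compContinuousLinearMap g = f v := fun v => by
      ext w; simp [f']; congr 1; ext; simp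
    have h1 : alternatizeUncurryFin f = (alternatizeUncurryFin f').compContinuousLinearMap g := by
      rw [alternatizeUncurryFin_compContinuousLinearMap]
      congr 1
      ext v : 1
      exact (hf v).symm
    rw [alternatize_wedgeOne_coeff2, h1, h, ← alternatize_wedgeOne_coeff2,
      alternatizeUncurryFin_compContinuousLinearMap]
    congr 1
    ext v : 1
    simp only [ContinuousLinearMap.comp_apply, compContinuousLinearMapCLM_apply, wedgeRight_apply,
      wedgeOne_comp]
    exact congrArg (fun a => wedgeOne a _) (hf v)
  rw [← sub_eq_zero]
  -- With `f = ξ ⊗ a` the identity `key` reads `ξ ∧ a ∧ (difference) = 0`. First `ξ` and then `a`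
  -- can be removed, both factors being wedged onto forms below top degree.
  refine eq_zero_of_wedgeOne (by omega) _ fun a => eq_zero_of_alternatize (by omega) _ fun ξ => ?_
  have h3 := key (ξ.smulRight a)
  rw [← sub_eq_zero, ← alternatizeUncurryFinCLM_apply, ← alternatizeUncurryFinCLM_apply,
    ← map_sub] at h3
  rw [← h3]
  rw [alternatizeUncurryFinCLM_apply]
  congr 1
  ext v : 1
  simp only [ContinuousLinearMap.smulRight_apply, _root_.sub_apply,
    ContinuousLinearMap.comp_apply, map_smul, wedgeRight_apply, ← smul_sub]
  rw [← wedgeLeft_apply, map_sub]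
  rfl

omit [FiniteDimensional ℝ W] in
theorem coeff0_natural {T T' : (EuclideanSpace ℝ (Fin n) [⋀^Fin 0]→L[ℝ] W) →L[ℝ]
    (EuclideanSpace ℝ (Fin n) [⋀^Fin k]→L[ℝ] ℝ)}
    (g : EuclideanSpace ℝ (Fin n) ≃L[ℝ] EuclideanSpace ℝ (Fin n))
    (h : ∀ a, T' (a.compContinuousLinearMap g) = (T a).compContinuousLinearMap g) :
    coeff0 T' = (coeff0 T).compContinuousLinearMap g := by
  have key : ∀ c, pairZero c (coeff0 T') =
      pairZero c ((coeff0 T).compContinuousLinearMap (g : _ →L[ℝ] _)) := fun c => by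
    have h1 := pairZero_coeff0 T' (constOfIsEmpty ℝ _ (Fin 0) c)
    have h2 := pairZero_coeff0 T (constOfIsEmpty ℝ _ (Fin 0) c)
    have h3 := h (constOfIsEmpty ℝ _ (Fin 0) c)
    rw [← pairZero_comp]
    simp only [constOfIsEmpty_apply] at h1 h2
    rw [h1, h2, ← h3]
    congr 1
  ext v c
  exact congrArg (fun θ => θ v) (key c)

end Wedge

/-! ### Pointwise consequences of general covariance -/

section Covariance

variable {m : ℕ} {W V : Type*} [NormedAddCommGroup W] [NormedSpace ℝ W]
    [NormedAddCommGroup V] [NormedSpace ℝ V]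

namespace Lagrangian

variable (L : Lagrangian m W V)

theorem contDiffAt_density {J : Jet m W V} (hJ : J ∈ L.dom) : ContDiffAt ℝ ∞ L.density J :=
  L.smooth.contDiffAt (L.isOpen_dom.mem_nhds hJ)

theorem differentiableAt_density {J : Jet m W V} (hJ : J ∈ L.dom) :
    DifferentiableAt ℝ L.density J :=
  (L.contDiffAt_density hJ).differentiableAt (by simp)

end Lagrangian

/-- Pullback of jets by a linear map, as a continuous linear map. -/
noncomputable def Jet.pullL (m : ℕ) (W V : Type*) [NormedAddCommGroup W] [NormedSpace ℝ W]
    [NormedAddCommGroup V] [NormedSpace ℝ V]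
    (g : EuclideanSpace ℝ (Fin (m + 2)) →L[ℝ] EuclideanSpace ℝ (Fin (m + 2))) :
    Jet m W V →L[ℝ] Jet m W V :=
  (compContinuousLinearMapCLM g).prodMap ((compContinuousLinearMapCLM g).prodMap
    ((compContinuousLinearMapCLM g).prodMap (compContinuousLinearMapCLM g)))

theorem Jet.pullL_apply (g : EuclideanSpace ℝ (Fin (m + 2)) ≃L[ℝ] EuclideanSpace ℝ (Fin (m + 2)))
    (J : Jet m W V) : Jet.pullL m W V g J = Jet.pull g J := rfl

namespace Lagrangian

variable (L : Lagrangian m W V)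

/-- Differentiate the covariance identity in `J`. It holds on the whole open set `dom`, hence on a
neighbourhood of `J`, so the derivatives of its two sides agree. -/
theorem fderiv_density_pull
    (g : EuclideanSpace ℝ (Fin (m + 2)) ≃L[ℝ] EuclideanSpace ℝ (Fin (m + 2)))
    {J : Jet m W V} (hJ : J ∈ L.dom) (K : Jet m W V) :
    fderiv ℝ L.density (Jet.pull g J) (Jet.pull g K) =
      (fderiv ℝ L.density J K).compContinuousLinearMap g := by
  have h1 : HasFDerivAt (fun J' => L.density (Jet.pullL m W V g J'))
      ((fderiv ℝ L.density (Jet.pull g J)).comp (Jet.pullL m W V g)) J :=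
    (L.differentiableAt_density (L.pull_mem g J hJ)).hasFDerivAt.comp J
      (Jet.pullL m W V (g : EuclideanSpace ℝ (Fin (m + 2)) →L[ℝ]
        EuclideanSpace ℝ (Fin (m + 2)))).hasFDerivAt
  have h2 := (L.differentiableAt_density hJ).hasFDerivAt
    |>.continuousAlternatingMapCompContinuousLinearMap (hasFDerivAt_const
      (g : EuclideanSpace ℝ (Fin (m + 2)) →L[ℝ] EuclideanSpace ℝ (Fin (m + 2))) J)
  have h3 : (fun J' => L.density (Jet.pullL m W V g J')) =ᶠ[𝓝 J]
      (fun J' => (L.density J').compContinuousLinearMap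
        (g : EuclideanSpace ℝ (Fin (m + 2)) →L[ℝ] EuclideanSpace ℝ (Fin (m + 2)))) := by
    filter_upwards [L.isOpen_dom.mem_nhds hJ] with J' hJ'
    exact L.natural g J' hJ'
  have h4 := h1.unique (h2.congr_of_eventuallyEq h3)
  have h5 := congrArg (fun T => T K) h4
  simpa [Jet.pullL_apply] using h5

/-- The partial derivatives of the density. -/
noncomputable def partA (J : Jet m W V) : (EuclideanSpace ℝ (Fin (m + 2)) [⋀^Fin 1]→L[ℝ] W) →L[ℝ]
    (EuclideanSpace ℝ (Fin (m + 2)) [⋀^Fin (m + 2)]→L[ℝ] ℝ) :=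
  (fderiv ℝ L.density J).comp (ContinuousLinearMap.inl ℝ _ _)

/-- The partial derivative of the density with respect to `ϕ`. -/
noncomputable def partPhi (J : Jet m W V) : (EuclideanSpace ℝ (Fin (m + 2)) [⋀^Fin 0]→L[ℝ] V) →L[ℝ]
    (EuclideanSpace ℝ (Fin (m + 2)) [⋀^Fin (m + 2)]→L[ℝ] ℝ) :=
  (fderiv ℝ L.density J).comp
    ((ContinuousLinearMap.inr ℝ _ _).comp (ContinuousLinearMap.inl ℝ _ _))

/-- The partial derivative of the density with respect to `dA`. -/
noncomputable def partDA (J : Jet m W V) : (EuclideanSpace ℝ (Fin (m + 2)) [⋀^Fin 2]→L[ℝ] W) →L[ℝ]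
    (EuclideanSpace ℝ (Fin (m + 2)) [⋀^Fin (m + 2)]→L[ℝ] ℝ) :=
  (fderiv ℝ L.density J).comp
    ((ContinuousLinearMap.inr ℝ _ _).comp
      ((ContinuousLinearMap.inr ℝ _ _).comp (ContinuousLinearMap.inl ℝ _ _)))

/-- The partial derivative of the density with respect to `dϕ`. -/
noncomputable def partDPhi (J : Jet m W V) :
    (EuclideanSpace ℝ (Fin (m + 2)) [⋀^Fin 1]→L[ℝ] V) →L[ℝ]
    (EuclideanSpace ℝ (Fin (m + 2)) [⋀^Fin (m + 2)]→L[ℝ] ℝ) :=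
  (fderiv ℝ L.density J).comp
    ((ContinuousLinearMap.inr ℝ _ _).comp
      ((ContinuousLinearMap.inr ℝ _ _).comp (ContinuousLinearMap.inr ℝ _ _)))

theorem fderiv_density_apply (J K : Jet m W V) :
    fderiv ℝ L.density J K =
      L.partA J K.1 + L.partPhi J K.2.1 + L.partDA J K.2.2.1 + L.partDPhi J K.2.2.2 := by
  simp only [partA, partPhi, partDA, partDPhi, ContinuousLinearMap.comp_apply, ← map_add]
  congr 1
  simp

section
variable (g : EuclideanSpace ℝ (Fin (m + 2)) ≃L[ℝ] EuclideanSpace ℝ (Fin (m + 2)))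
    {J : Jet m W V} (hJ : J ∈ L.dom)
include hJ

theorem partA_pull (a) : L.partA (Jet.pull g J) (a.compContinuousLinearMap g) =
    (L.partA J a).compContinuousLinearMap g := by
  have := L.fderiv_density_pull g hJ (a, 0, 0, 0)
  exact this

theorem partPhi_pull (a) : L.partPhi (Jet.pull g J) (a.compContinuousLinearMap g) =
    (L.partPhi J a).compContinuousLinearMap g := by
  have := L.fderiv_density_pull g hJ (0, a, 0, 0)
  exact this

theorem partDA_pull (a) : L.partDA (Jet.pull g J) (a.compContinuousLinearMap g) =
    (L.partDA J a).compContinuousLinearMap g := by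
  have := L.fderiv_density_pull g hJ (0, 0, a, 0)
  exact this

theorem partDPhi_pull (a) : L.partDPhi (Jet.pull g J) (a.compContinuousLinearMap g) =
    (L.partDPhi J a).compContinuousLinearMap g := by
  have := L.fderiv_density_pull g hJ (0, 0, 0, a)
  exact this

end

theorem _root_.CovPhase.hasDerivAt_comp_of_id {k : ℕ} {E F : Type*} [NormedAddCommGroup E]
    [NormedSpace ℝ E] [NormedAddCommGroup F] [NormedSpace ℝ F] (η : E [⋀^Fin k]→L[ℝ] F)
    {g : ℝ → E →L[ℝ] E} {h : E →L[ℝ] E} (hg : HasDerivAt g h 0)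
    (hg0 : g 0 = ContinuousLinearMap.id ℝ E) :
    HasDerivAt (fun t => η.compContinuousLinearMap (g t))
      (η.fderivCompContinuousLinearMap (ContinuousLinearMap.id ℝ _) h) 0 := by
  have h1 := (hasFDerivAt_const η (0 : ℝ)).continuousAlternatingMapCompContinuousLinearMap
    hg.hasFDerivAt
  have h2 := h1.hasDerivAt
  rw [hg0] at h2
  simpa using h2

/-- Infinitesimal covariance of the density under `ξ ⊗ v`. -/
theorem fderiv_density_infinitesimal {J : Jet m W V} (hJ : J ∈ L.dom)
    (h : EuclideanSpace ℝ (Fin (m + 2)) →L[ℝ] EuclideanSpace ℝ (Fin (m + 2))) :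
    fderiv ℝ L.density J
      (J.1.fderivCompContinuousLinearMap (ContinuousLinearMap.id ℝ _) h,
        J.2.1.fderivCompContinuousLinearMap (ContinuousLinearMap.id ℝ _) h,
        J.2.2.1.fderivCompContinuousLinearMap (ContinuousLinearMap.id ℝ _) h,
        J.2.2.2.fderivCompContinuousLinearMap (ContinuousLinearMap.id ℝ _) h) =
    (L.density J).fderivCompContinuousLinearMap (ContinuousLinearMap.id ℝ _) h := by
  let g : ℝ → EuclideanSpace ℝ (Fin (m + 2)) →L[ℝ] EuclideanSpace ℝ (Fin (m + 2)) :=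
    fun t => ContinuousLinearMap.id ℝ _ + t • h
  have hg : HasDerivAt g h 0 := by
    have := ((hasDerivAt_id (0 : ℝ)).smul_const h).const_add (ContinuousLinearMap.id ℝ _)
    rwa [one_smul] at this
  have hg0 : g 0 = ContinuousLinearMap.id ℝ _ := by
    ext v; simp [g]
  have h1 : HasDerivAt (fun t => L.density (Jet.pullL m W V (g t) J)) (fderiv ℝ L.density J
      (J.1.fderivCompContinuousLinearMap (ContinuousLinearMap.id ℝ _) h,
        J.2.1.fderivCompContinuousLinearMap (ContinuousLinearMap.id ℝ _) h,
        J.2.2.1.fderivCompContinuousLinearMap (ContinuousLinearMap.id ℝ _) h,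
        J.2.2.2.fderivCompContinuousLinearMap (ContinuousLinearMap.id ℝ _) h)) 0 := by
    have h2 : HasDerivAt (fun t => Jet.pullL m W V (g t) J) _ 0 :=
      (hasDerivAt_comp_of_id J.1 hg hg0).prodMk ((hasDerivAt_comp_of_id J.2.1 hg hg0).prodMk
        ((hasDerivAt_comp_of_id J.2.2.1 hg hg0).prodMk (hasDerivAt_comp_of_id J.2.2.2 hg hg0)))
    have h3 : Jet.pullL m W V (g 0) J = J := by
      rw [hg0]; rfl
    have h4 : HasFDerivAt L.density (fderiv ℝ L.density J) (Jet.pullL m W V (g 0) J) := by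
      rw [h3]; exact (L.differentiableAt_density hJ).hasFDerivAt
    exact h4.comp_hasDerivAt 0 h2
  have h2 := hasDerivAt_comp_of_id (L.density J) hg hg0
  refine h1.unique (h2.congr_of_eventuallyEq ?_)
  -- Covariance is assumed for invertible frame changes only. These form an open set, so `id + t h`
  -- is one of them for small `t`.
  have h3 : ∀ᶠ t in 𝓝 (0 : ℝ), g t ∈ range ((↑) : (EuclideanSpace ℝ (Fin (m + 2)) ≃L[ℝ]
      EuclideanSpace ℝ (Fin (m + 2))) → _) := by
    apply hg.continuousAt.eventually_mem
    rw [hg0]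
    exact ContinuousLinearEquiv.nhds (ContinuousLinearEquiv.refl ℝ _)
  filter_upwards [h3] with t ⟨e, he⟩
  rw [← he]
  exact L.natural e J hJ

/-- Since `T(ξ ⊗ b) = (ξ ⊗ b) ∧ coeff1 T`, the covector `ξ` can be factored out. This treats the `A`
and `dϕ` terms of infinitesimal covariance. -/
theorem apply_alternatize_smulRight {U : Type*} [NormedAddCommGroup U] [NormedSpace ℝ U]
    (T : (EuclideanSpace ℝ (Fin (m + 2)) [⋀^Fin 1]→L[ℝ] U) →L[ℝ]
      (EuclideanSpace ℝ (Fin (m + 2)) [⋀^Fin (m + 2)]→L[ℝ] ℝ))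
    (ξ : EuclideanSpace ℝ (Fin (m + 2)) →L[ℝ] ℝ)
    (b : EuclideanSpace ℝ (Fin (m + 2)) [⋀^Fin 0]→L[ℝ] U) :
    T (alternatizeUncurryFin (ξ.smulRight b)) =
      alternatizeUncurryFin (ξ.smulRight (pairZero (b 0) (coeff1 T))) := by
  rw [← wedgeOne_coeff1, wedgeOne]
  congr 1
  ext w z
  simp [pairZero_apply, alternatizeUncurryFin_apply]
  left; congr 1
  exact congrArg b (Subsingleton.elim _ _)

/-- A rank one endomorphism `ξ ⊗ v` acts on forms as `ξ ∧ ι_v`. -/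
theorem fderivComp_smulRight {k : ℕ} {F : Type*} [NormedAddCommGroup F] [NormedSpace ℝ F]
    {E : Type*} [NormedAddCommGroup E] [NormedSpace ℝ E]
    (η : E [⋀^Fin (k + 1)]→L[ℝ] F) (ξ : E →L[ℝ] ℝ) (v : E) :
    η.fderivCompContinuousLinearMap (ContinuousLinearMap.id ℝ E) (ξ.smulRight v) =
      alternatizeUncurryFin (ξ.smulRight (η.curryLeft v)) := by
  rw [fderivComp_id]
  congr 1
  ext w
  simp

variable [FiniteDimensional ℝ W]

/-- The contraction of the Lagrangian form in terms of the coefficients of its variation. -/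
theorem curryLeft_density {J : Jet m W V} (hJ : J ∈ L.dom) (v) :
    (L.density J).curryLeft v =
      pairZero (J.1.curryLeft v 0) (coeff1 (L.partA J))
      + wedgeOne (J.2.2.1.curryLeft v) (coeff2 (L.partDA J))
      + pairZero (J.2.2.2.curryLeft v 0) (coeff1 (L.partDPhi J)) := by
  rw [← sub_eq_zero]
  -- Both sides have degree one below the top, so it suffices to compare them after wedging with
  -- every `ξ`. That comparison is infinitesimal covariance under `ξ ⊗ v`, each of whose terms has
  -- the form `ξ ∧ (…)`.
  refine eq_zero_of_alternatize (by omega) _ fun ξ => ?_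
  have h := L.fderiv_density_infinitesimal hJ (ξ.smulRight v)
  rw [fderiv_density_apply] at h
  simp only [fderivComp_smulRight] at h
  -- A `0`-covector has no slot on which a frame change could act, so `∂L/∂ϕ` does not contribute.
  have h0 : J.2.1.fderivCompContinuousLinearMap (ContinuousLinearMap.id ℝ _) (ξ.smulRight v) = 0 := by
    rw [fderivCompContinuousLinearMap_of_isEmpty]; rfl
  have e2 : ∀ b : EuclideanSpace ℝ (Fin (m + 2)) [⋀^Fin 1]→L[ℝ] W,
      L.partDA J (alternatizeUncurryFin (ξ.smulRight b)) =
        alternatizeUncurryFin (ξ.smulRight (wedgeOne b (coeff2 (L.partDA J)))) := by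
    intro b
    rw [← alternatize_wedgeOne_coeff2]
    congr 1
    ext w : 1
    simp
  rw [h0, _root_.map_zero, add_zero, apply_alternatize_smulRight, apply_alternatize_smulRight, e2, ← alternatizeUncurryFin_add,
    ← alternatizeUncurryFin_add] at h
  have h5 : ∀ a b : EuclideanSpace ℝ (Fin (m + 2)) [⋀^Fin (m + 1)]→L[ℝ] ℝ,
      alternatizeUncurryFin (ξ.smulRight (a - b)) =
        alternatizeUncurryFin (ξ.smulRight a) - alternatizeUncurryFin (ξ.smulRight b) := by
    intro a b
    ext z
    simp [alternatizeUncurryFin_apply, mul_sub, Finset.sum_sub_distrib]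
  rw [h5, ← h, sub_eq_zero]
  congr 1
  ext w z
  simp

end Lagrangian

end Covariance

/-! ### Coordinate expressions, pullbacks and the exterior derivative -/

section Coordinates

variable {E H E' H' F : Type*}
  [NormedAddCommGroup E] [NormedSpace ℝ E] [TopologicalSpace H]
  [NormedAddCommGroup E'] [NormedSpace ℝ E'] [TopologicalSpace H']
  [NormedAddCommGroup F] [NormedSpace ℝ F]
  {M : Type*} [TopologicalSpace M] [ChartedSpace H M]
  {M' : Type*} [TopologicalSpace M'] [ChartedSpace H' M']
  {k : ℕ} {I : ModelWithCorners ℝ E H} {I' : ModelWithCorners ℝ E' H'}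

/-- The coordinate expression of a map in the charts centred at `c` and `c'`. -/
noncomputable def coordMap (I : ModelWithCorners ℝ E H) (I' : ModelWithCorners ℝ E' H') (c : M) (c' : M')
    (f : M → M') : E → E' :=
  extChartAt I' c' ∘ f ∘ (extChartAt I c).symm

theorem coordMap_apply (c : M) (c' : M') (f : M → M') (y : E) :
    coordMap I I' c c' f y = extChartAt I' c' (f ((extChartAt I c).symm y)) := rfl

theorem uniqueDiffWithinAt_range {c : M} {y : E} (hy : y ∈ (extChartAt I c).target) :
    UniqueDiffWithinAt ℝ (range I) y :=
  I.uniqueDiffOn y (extChartAt_target_subset_range c hy)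

theorem extChartAt_target_mem {c : M} {y : E} (hy : y ∈ (extChartAt I c).target) :
    (extChartAt I c).target ∈ 𝓝[range I] y :=
  extChartAt_target_mem_nhdsWithin_of_mem hy

theorem pullForm_id (η : M → E [⋀^Fin k]→L[ℝ] F) : pullForm I I id η = η := by
  funext x
  have h : mfderiv I I id x = ContinuousLinearMap.id ℝ (TangentSpace I x) := mfderiv_id
  rw [pullForm, h]
  rfl

theorem chartRep_add (c : M) (η ζ : M → E [⋀^Fin k]→L[ℝ] F) :
    chartRep I c (η + ζ) = chartRep I c η + chartRep I c ζ := rfl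

theorem chartRep_sub (c : M) (η ζ : M → E [⋀^Fin k]→L[ℝ] F) :
    chartRep I c (η - ζ) = chartRep I c η - chartRep I c ζ := rfl

theorem chartRep_smul (c : M) (r : ℝ) (η : M → E [⋀^Fin k]→L[ℝ] F) :
    chartRep I c (r • η) = r • chartRep I c η := rfl

section
variable [IsManifold I 1 M] [IsManifold I' 1 M']

theorem chartRep_center (x : M) (η : M → E [⋀^Fin k]→L[ℝ] F) :
    chartRep I x η (extChartAt I x x) = η x := by
  have h := mfderivWithin_range_extChartAt_symm (I := I) (x := x)
  rw [chartRep]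
  erw [h]
  rw [extChartAt_to_inv]
  rfl

theorem fderivWithin_coordMap {c : M} {c' : M'} {f : M → M'} {y : E}
    (hy : y ∈ (extChartAt I c).target)
    (hf : MDifferentiableAt I I' f ((extChartAt I c).symm y))
    (hc : f ((extChartAt I c).symm y) ∈ (extChartAt I' c').source) :
    fderivWithin ℝ (coordMap I I' c c' f) (range I) y =
      (mfderiv I' 𝓘(ℝ, E') (extChartAt I' c') (f ((extChartAt I c).symm y)) : E' →L[ℝ] E') ∘L
        (mfderiv I I' f ((extChartAt I c).symm y) : E →L[ℝ] E') ∘L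
        (mfderivWithin 𝓘(ℝ, E) I (extChartAt I c).symm (range I) y : E →L[ℝ] E) := by
  have U : UniqueMDiffWithinAt 𝓘(ℝ, E) (range I) y :=
    uniqueMDiffWithinAt_iff_uniqueDiffWithinAt.2 (uniqueDiffWithinAt_range hy)
  have h1 := mdifferentiableWithinAt_extChartAt_symm hy
  have h2 : MDifferentiableWithinAt 𝓘(ℝ, E) I' (f ∘ (extChartAt I c).symm) (range I) y :=
    hf.comp_mdifferentiableWithinAt y h1
  rw [extChartAt_source] at hc
  have h3 := mdifferentiableAt_extChartAt (I := I') hc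
  rw [← mfderivWithin_eq_fderivWithin, coordMap]
  have h4 := mfderiv_comp_mfderivWithin y h3 h2 U
  have h5 := mfderiv_comp_mfderivWithin y hf h1 U
  rw [h5] at h4
  exact h4

/-- The derivative of the coordinate map ends with the derivative of the chart at `c'`, while
`chartRep` of `η` begins with the derivative of its inverse. The two cancel and leave the intrinsic
pullback. -/
theorem chartRep_pullForm {c : M} {c' : M'} {f : M → M'} {y : E}
    (hy : y ∈ (extChartAt I c).target)
    (hf : MDifferentiableAt I I' f ((extChartAt I c).symm y))
    (hc : f ((extChartAt I c).symm y) ∈ (extChartAt I' c').source)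
    (η : M' → E' [⋀^Fin k]→L[ℝ] F) :
    chartRep I c (pullForm I I' f η) y =
      (chartRep I' c' η (coordMap I I' c c' f y)).compContinuousLinearMap
        (fderivWithin ℝ (coordMap I I' c c' f) (range I) y) := by
  rw [fderivWithin_coordMap hy hf hc, chartRep, chartRep, pullForm, coordMap_apply,
    (extChartAt I' c').left_inv hc]
  have h := mfderivWithin_extChartAt_symm_comp_mfderiv_extChartAt' hc
  have h' : ∀ w : E', (mfderivWithin 𝓘(ℝ, E') I' (extChartAt I' c').symm (range I')
      (extChartAt I' c' (f ((extChartAt I c).symm y))) : E' →L[ℝ] E')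
      ((mfderiv I' 𝓘(ℝ, E') (extChartAt I' c') (f ((extChartAt I c).symm y)) : E' →L[ℝ] E') w) = w :=
    fun w => congrArg (fun T : E' →L[ℝ] E' => T w) h
  refine ContinuousAlternatingMap.ext fun v => ?_
  refine congrArg (η (f ((extChartAt I c).symm y))) (funext fun i => ?_)
  exact (h' _).symm

theorem chartRep_change {c c' : M} {y : E}
    (hy : y ∈ (extChartAt I c).target)
    (hc : (extChartAt I c).symm y ∈ (extChartAt I c').source)
    (η : M → E [⋀^Fin k]→L[ℝ] F) :
    chartRep I c η y =
      (chartRep I c' η (coordMap I I c c' id y)).compContinuousLinearMap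
        (fderivWithin ℝ (coordMap I I c c' id) (range I) y) := by
  have := chartRep_pullForm (f := (id : M → M)) hy mdifferentiableAt_id hc η
  rwa [pullForm_id] at this

end

theorem contDiffWithinAt_coordMap {n : WithTop ℕ∞} [IsManifold I n M] [IsManifold I' n M']
    {c : M} {c' : M'} {f : M → M'} {y : E}
    (hy : y ∈ (extChartAt I c).target)
    (hf : ContMDiffAt I I' n f ((extChartAt I c).symm y))
    (hc : f ((extChartAt I c).symm y) ∈ (extChartAt I' c').source) :
    ContDiffWithinAt ℝ n (coordMap I I' c c' f) (range I) y := by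
  rw [← contMDiffWithinAt_iff_contDiffWithinAt]
  rw [extChartAt_source] at hc
  have h1 : ContMDiffWithinAt 𝓘(ℝ, E) I n (extChartAt I c).symm (range I) y :=
    (contMDiffOn_extChartAt_symm c y hy).mono_of_mem_nhdsWithin (extChartAt_target_mem hy)
  exact (contMDiffAt_extChartAt' hc).comp_contMDiffWithinAt y (hf.comp_contMDiffWithinAt y h1)

/-- Points near `y` in the half space correspond to points near the point with coordinates `y`. -/
theorem eventually_coord {c : M} {y : E} (hy : y ∈ (extChartAt I c).target) {p : M → Prop}
    (hp : ∀ᶠ x in 𝓝 ((extChartAt I c).symm y), p x) :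
    ∀ᶠ z in 𝓝[range I] y, z ∈ (extChartAt I c).target ∧ p ((extChartAt I c).symm z) := by
  have h := (continuousAt_extChartAt_symm'' (I := I) hy).eventually hp
  exact Filter.Eventually.and (extChartAt_target_mem hy) (h.filter_mono nhdsWithin_le_nhds)

section
variable [IsManifold I 2 M] [IsManifold I' 2 M']

/-- Near `y` the coordinate expression of the pullback is the pullback by the coordinate map, so
naturality of `d` in vector spaces applies. Two derivatives of `f` are needed, as the second one
must drop out by symmetry. -/
theorem extDerivWithin_chartRep_pullForm {c : M} {c' : M'} {f : M → M'} {y : E}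
    (hy : y ∈ (extChartAt I c).target)
    (hf : ContMDiffAt I I' 2 f ((extChartAt I c).symm y))
    (hc : f ((extChartAt I c).symm y) ∈ (extChartAt I' c').source)
    {η : M' → E' [⋀^Fin k]→L[ℝ] F}
    (hη : DifferentiableWithinAt ℝ (chartRep I' c' η) (range I') (coordMap I I' c c' f y)) :
    extDerivWithin (chartRep I c (pullForm I I' f η)) (range I) y =
      (extDerivWithin (chartRep I' c' η) (range I')
        (coordMap I I' c c' f y)).compContinuousLinearMap
          (fderivWithin ℝ (coordMap I I' c c' f) (range I) y) := by
  have : IsManifold I 1 M := IsManifold.of_le (n := 2) (by norm_num)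
  have : IsManifold I' 1 M' := IsManifold.of_le (n := 2) (by norm_num)
  have hyr := extChartAt_target_subset_range c hy
  rw [← extDerivWithin_pullback hη (contDiffWithinAt_coordMap hy hf hc) (by simp)
    I.uniqueDiffOn (I.range_subset_closure_interior hyr) hyr]
  · refine Filter.EventuallyEq.extDerivWithin_eq_of_mem ?_ hyr
    have h1 : ∀ᶠ x in 𝓝 ((extChartAt I c).symm y), MDifferentiableAt I I' f x ∧
        f x ∈ (extChartAt I' c').source := by
      refine Filter.Eventually.and ?_ (hf.continuousAt.eventually_mem
        (extChartAt_source_mem_nhds' hc))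
      filter_upwards [(contMDiffAt_iff_contMDiffAt_nhds (by simp)).1 hf] with x hx
      exact hx.mdifferentiableAt (by simp)
    filter_upwards [eventually_coord hy h1] with z hz
    exact chartRep_pullForm hz.1 hz.2.1 hz.2.2 η
  · intro z _
    exact mem_range_self _

/-- The exterior derivative commutes with pullback. -/
theorem extD_pullForm {f : M → M'} {x : M} (hf : ContMDiffAt I I' 2 f x)
    {η : M' → E' [⋀^Fin k]→L[ℝ] F}
    (hη : DifferentiableWithinAt ℝ (chartRep I' (f x) η) (range I')
      (extChartAt I' (f x) (f x))) :
    extD I (pullForm I I' f η) x = pullForm I I' f (extD I' η) x := by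
  have : IsManifold I 1 M := IsManifold.of_le (n := 2) (by norm_num)
  have : IsManifold I' 1 M' := IsManifold.of_le (n := 2) (by norm_num)
  have hx : (extChartAt I x).symm (extChartAt I x x) = x := extChartAt_to_inv x
  have h := extDerivWithin_chartRep_pullForm (c := x) (c' := f x) (f := f)
    (y := extChartAt I x x) (mem_extChartAt_target x) (by rwa [hx]) (by simp)
    (η := η) (by rwa [coordMap_apply, hx])
  have h2 := (hf.mdifferentiableAt (by simp)).mfderiv
  rw [extD, h, pullForm, coordMap_apply, hx, h2]
  rfl

/-- The exterior derivative in an arbitrary chart. -/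
theorem chartRep_extD {c : M} {y : E} (hy : y ∈ (extChartAt I c).target)
    {η : M → E [⋀^Fin k]→L[ℝ] F}
    (hη : DifferentiableWithinAt ℝ (chartRep I ((extChartAt I c).symm y) η) (range I)
      (extChartAt I ((extChartAt I c).symm y) ((extChartAt I c).symm y))) :
    chartRep I c (extD I η) y = extDerivWithin (chartRep I c η) (range I) y := by
  have : IsManifold I 1 M := IsManifold.of_le (n := 2) (by norm_num)
  have h := extDerivWithin_chartRep_pullForm (c := c) (c' := (extChartAt I c).symm y)
    (f := (id : M → M)) hy contMDiffAt_id (mem_extChartAt_source _) (η := η) hη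
  rw [pullForm_id] at h
  rw [h, chartRep_change hy (mem_extChartAt_source ((extChartAt I c).symm y))]
  congr 1
  rw [coordMap_apply, id, chartRep_center]
  rfl

end

/-! ### Smooth forms on manifolds with boundary -/

section Smooth

theorem SmoothForm.contDiffWithinAt {η : M → E [⋀^Fin k]→L[ℝ] F} (h : SmoothForm I η) {c : M} {y : E}
    (hy : y ∈ (extChartAt I c).target) : ContDiffWithinAt ℝ ∞ (chartRep I c η) (range I) y :=
  (h c y hy).mono_of_mem_nhdsWithin (extChartAt_target_mem hy)

theorem SmoothForm.differentiableWithinAt {η : M → E [⋀^Fin k]→L[ℝ] F} (h : SmoothForm I η)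
    {c : M} {y : E} (hy : y ∈ (extChartAt I c).target) :
    DifferentiableWithinAt ℝ (chartRep I c η) (range I) y :=
  (h.contDiffWithinAt hy).differentiableWithinAt (by simp)

theorem smoothForm_iff {η : M → E [⋀^Fin k]→L[ℝ] F} : SmoothForm I η ↔
    ∀ c : M, ∀ y ∈ (extChartAt I c).target, ContDiffWithinAt ℝ ∞ (chartRep I c η) (range I) y :=
  ⟨fun h _ _ hy => h.contDiffWithinAt hy,
    fun h c y hy => (h c y hy).mono (extChartAt_target_subset_range c)⟩

variable [FiniteDimensional ℝ E] [FiniteDimensional ℝ E'] [FiniteDimensional ℝ F]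
  [IsManifold I ∞ M] [IsManifold I' ∞ M']

theorem SmoothForm.pullForm {f : M → M'} (hf : ContMDiff I I' ∞ f)
    {η : M' → E' [⋀^Fin k]→L[ℝ] F} (hη : SmoothForm I' η) :
    SmoothForm I (pullForm I I' f η) := by
  refine smoothForm_iff.2 fun c y hy => ?_
  set c' := f ((extChartAt I c).symm y) with hc'
  have hcs : f ((extChartAt I c).symm y) ∈ (extChartAt I' c').source := mem_extChartAt_source _
  have h1 := contDiffWithinAt_coordMap (c' := c') hy hf.contMDiffAt hcs
  have hmaps : MapsTo (coordMap I I' c c' f) (range I) (range I') := fun z _ => mem_range_self _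
  have h2 : ContDiffWithinAt ℝ ∞ (fun z => (chartRep I' c' η
      (coordMap I I' c c' f z)).compContinuousLinearMap
        (fderivWithin ℝ (coordMap I I' c c' f) (range I) z)) (range I) y := by
    refine contDiffWithinAt_compContinuousLinearMap ?_ ?_
    · exact (hη.contDiffWithinAt ((extChartAt I' c').map_source hcs)).comp y h1 hmaps
    · exact h1.fderivWithin_right I.uniqueDiffOn (by simp)
        (extChartAt_target_subset_range c hy)
  have h3 : ∀ᶠ x in 𝓝 ((extChartAt I c).symm y), f x ∈ (extChartAt I' c').source :=
    hf.continuous.continuousAt.eventually_mem (extChartAt_source_mem_nhds' hcs)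
  refine h2.congr_of_eventuallyEq ?_ ?_
  · filter_upwards [eventually_coord hy h3] with z hz
    exact chartRep_pullForm hz.1 (hf.mdifferentiableAt (by simp)) hz.2 η
  · exact chartRep_pullForm hy (hf.mdifferentiableAt (by simp)) hcs η

omit [FiniteDimensional ℝ E] [FiniteDimensional ℝ F] in
theorem SmoothForm.chartRep_extD {η : M → E [⋀^Fin k]→L[ℝ] F} (hη : SmoothForm I η) {c : M} {y : E}
    (hy : y ∈ (extChartAt I c).target) :
    chartRep I c (extD I η) y = extDerivWithin (chartRep I c η) (range I) y := by
  exact CovPhase.chartRep_extD hy (hη.differentiableWithinAt (mem_extChartAt_target _))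

end Smooth

end Coordinates

/-- The space of two real parameters. -/
abbrev Par : Type := EuclideanSpace ℝ (Fin 2)

/-- The model space `ℝⁿ`. -/
abbrev Vec (n : ℕ) : Type := EuclideanSpace ℝ (Fin n)

/-! ### Partial derivatives -/

section Partial

variable {P E F : Type*} [NormedAddCommGroup P] [NormedSpace ℝ P]
  [NormedAddCommGroup E] [NormedSpace ℝ E] [NormedAddCommGroup F] [NormedSpace ℝ F]
  {G : P × E → F} {q : P} {y : E}

theorem hasFDerivAt_fst (h : DifferentiableAt ℝ G (q, y)) :
    HasFDerivAt (fun q' => G (q', y)) ((fderiv ℝ G (q, y)).comp (ContinuousLinearMap.inl ℝ P E)) q :=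
  HasFDerivAt.comp (g := G) q h.hasFDerivAt (hasFDerivAt_prodMk_left q y)

theorem hasFDerivAt_snd (h : DifferentiableAt ℝ G (q, y)) :
    HasFDerivAt (fun y' => G (q, y')) ((fderiv ℝ G (q, y)).comp (ContinuousLinearMap.inr ℝ P E)) y :=
  HasFDerivAt.comp (g := G) y h.hasFDerivAt (hasFDerivAt_prodMk_right q y)

theorem ContDiffAt.eventually_differentiableAt (h : ContDiffAt ℝ ∞ G (q, y)) :
    ∀ᶠ z in 𝓝 (q, y), DifferentiableAt ℝ G z := by
  have h1 : ContDiffAt ℝ 1 G (q, y) := h.of_le (by simp)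
  filter_upwards [h1.eventually (by simp)] with z hz
  exact hz.differentiableAt (by simp)

theorem contDiffAt_partial_fst (h : ContDiffAt ℝ ∞ G (q, y)) (v : P) :
    ContDiffAt ℝ ∞ (fun z : P × E => fderiv ℝ (fun q' => G (q', z.2)) z.1 v) (q, y) := by
  have h1 : ContDiffAt ℝ ∞ (fun z => fderiv ℝ G z (v, 0)) (q, y) :=
    (h.fderiv_right (m := ∞) (by simp)).clm_apply contDiffAt_const
  refine h1.congr_of_eventuallyEq ?_
  filter_upwards [ContDiffAt.eventually_differentiableAt h] with z hz
  rw [(hasFDerivAt_fst (q := z.1) (y := z.2) hz).fderiv]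
  simp

theorem contDiffAt_partial_snd (h : ContDiffAt ℝ ∞ G (q, y)) :
    ContDiffAt ℝ ∞ (fun z : P × E => fderiv ℝ (fun y' => G (z.1, y')) z.2) (q, y) := by
  have h1 : ContDiffAt ℝ ∞ (fun z => (fderiv ℝ G z).comp (ContinuousLinearMap.inr ℝ P E)) (q, y) :=
    (h.fderiv_right (m := ∞) (by simp)).clm_comp contDiffAt_const
  refine h1.congr_of_eventuallyEq ?_
  filter_upwards [ContDiffAt.eventually_differentiableAt h] with z hz
  rw [(hasFDerivAt_snd (q := z.1) (y := z.2) hz).fderiv]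

theorem minSmoothness_two_le : minSmoothness ℝ 2 ≤ (∞ : WithTop ℕ∞) := by
  rw [minSmoothness_of_isRCLikeNormedField]
  exact WithTop.coe_le_coe.2 (le_top : (2 : ℕ∞) ≤ ⊤)

theorem fderiv_fderiv_symm (h : ContDiffAt ℝ ∞ G (q, y)) (v w : P × E) :
    fderiv ℝ (fderiv ℝ G) (q, y) v w = fderiv ℝ (fderiv ℝ G) (q, y) w v :=
  (h.isSymmSndFDerivAt minSmoothness_two_le).eq v w

theorem hasFDerivAt_partial_fst_apply (h : ContDiffAt ℝ ∞ G (q, y)) (v : P) :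
    HasFDerivAt (fun z : P × E => fderiv ℝ (fun q' => G (q', z.2)) z.1 v)
      ((fderiv ℝ (fderiv ℝ G) (q, y)).flip (v, 0)) (q, y) := by
  have h1 : HasFDerivAt (fderiv ℝ G) (fderiv ℝ (fderiv ℝ G) (q, y)) (q, y) :=
    ((h.fderiv_right (m := ∞) (by simp)).differentiableAt (by simp)).hasFDerivAt
  have h2 := h1.clm_apply (hasFDerivAt_const ((v, 0) : P × E) (q, y))
  have h3 : HasFDerivAt (fun z => fderiv ℝ G z (v, 0))
      ((fderiv ℝ (fderiv ℝ G) (q, y)).flip (v, 0)) (q, y) := by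
    exact h2.congr_fderiv (by ext w <;> simp)
  refine h3.congr_of_eventuallyEq ?_
  filter_upwards [ContDiffAt.eventually_differentiableAt h] with z hz
  rw [(hasFDerivAt_fst (q := z.1) (y := z.2) hz).fderiv]
  simp

/-- Partial derivatives in the parameters and in the space variables commute. -/
theorem fderiv_fst_fderiv_snd (h : ContDiffAt ℝ ∞ G (q, y)) (v : P) :
    DifferentiableAt ℝ (fun q' => fderiv ℝ (fun y' => G (q', y')) y) q ∧
    (fderiv ℝ (fun q' => fderiv ℝ (fun y' => G (q', y')) y) q) v =
      fderiv ℝ (fun y' => fderiv ℝ (fun q' => G (q', y')) q v) y := by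
  have h1 : HasFDerivAt (fderiv ℝ G) (fderiv ℝ (fderiv ℝ G) (q, y)) (q, y) :=
    ((h.fderiv_right (m := ∞) (by simp)).differentiableAt (by simp)).hasFDerivAt
  have h2 : HasFDerivAt (fun q' => fderiv ℝ G (q', y)) ((fderiv ℝ (fderiv ℝ G) (q, y)).comp
      (ContinuousLinearMap.inl ℝ P E)) q :=
    HasFDerivAt.comp (g := fderiv ℝ G) q h1 (hasFDerivAt_prodMk_left q y)
  have h3 := h2.clm_comp (hasFDerivAt_const (ContinuousLinearMap.inr ℝ P E) q)
  have h4 := h3.congr_of_eventuallyEq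
    (f₁ := fun q' => fderiv ℝ (fun y' => G (q', y')) y) (by
      have h5 : ContinuousAt (fun q' : P => (q', y)) q := by fun_prop
      filter_upwards [h5.eventually (ContDiffAt.eventually_differentiableAt h)] with q' hq'
      rw [(hasFDerivAt_snd hq').fderiv])
  refine ⟨h4.differentiableAt, ?_⟩
  rw [h4.fderiv]
  have h6 := (hasFDerivAt_snd (hasFDerivAt_partial_fst_apply h v).differentiableAt).fderiv
  rw [h6, (hasFDerivAt_partial_fst_apply h v).fderiv]
  ext w
  simp [fderiv_fderiv_symm h (v, 0) (0, w)]

theorem hasFDerivAt_compContinuousLinearMap_const {k : ℕ} {E' : Type*} [NormedAddCommGroup E']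
    [NormedSpace ℝ E'] {f : P → E [⋀^Fin k]→L[ℝ] F} (hf : DifferentiableAt ℝ f q)
    (g : E' →L[ℝ] E) (v : P) :
    DifferentiableAt ℝ (fun q' => (f q').compContinuousLinearMap g) q ∧
    fderiv ℝ (fun q' => (f q').compContinuousLinearMap g) q v =
      (fderiv ℝ f q v).compContinuousLinearMap g := by
  have h := hf.hasFDerivAt.continuousAlternatingMapCompContinuousLinearMap
    (hasFDerivAt_const g q)
  refine ⟨h.differentiableAt, ?_⟩
  rw [h.fderiv]
  ext w
  simp

theorem ContinuousLinearMap.fderiv_comp_apply (T : E →L[ℝ] F) {f : P → E}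
    (hf : DifferentiableAt ℝ f q) (v : P) :
    DifferentiableAt ℝ (fun q' => T (f q')) q ∧
      fderiv ℝ (fun q' => T (f q')) q v = T (fderiv ℝ f q v) := by
  have h := T.hasFDerivAt.comp q hf.hasFDerivAt
  exact ⟨h.differentiableAt, congrArg (fun T => T v) h.fderiv⟩

theorem hasFDerivAt_alternatizeUncurryFin {k : ℕ}
    {f : P → E →L[ℝ] E [⋀^Fin k]→L[ℝ] F} (hf : DifferentiableAt ℝ f q) (v : P) :
    DifferentiableAt ℝ (fun q' => alternatizeUncurryFin (f q')) q ∧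
    fderiv ℝ (fun q' => alternatizeUncurryFin (f q')) q v =
      alternatizeUncurryFin (fderiv ℝ f q v) := by
  let T : (E →L[ℝ] E [⋀^Fin k]→L[ℝ] F) →L[ℝ] E [⋀^Fin (k + 1)]→L[ℝ] F :=
    alternatizeUncurryFinCLM ℝ E F
  exact ContinuousLinearMap.fderiv_comp_apply (E := E →L[ℝ] E [⋀^Fin k]→L[ℝ] F)
    (F := E [⋀^Fin (k + 1)]→L[ℝ] F) T hf v

theorem contDiffAt_alternatizeUncurryFin {k : ℕ} {n : WithTop ℕ∞}
    {f : P → E →L[ℝ] E [⋀^Fin k]→L[ℝ] F} (hf : ContDiffAt ℝ n f q) :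
    ContDiffAt ℝ n (fun q' => alternatizeUncurryFin (f q')) q := by
  let T : (E →L[ℝ] E [⋀^Fin k]→L[ℝ] F) →L[ℝ] E [⋀^Fin (k + 1)]→L[ℝ] F :=
    alternatizeUncurryFinCLM ℝ E F
  exact T.contDiff.contDiffAt.comp q hf

end Partial

/-! ### Families of forms and of vector fields on a manifold without boundary -/

section Families

variable {n k : ℕ} {F : Type*} [NormedAddCommGroup F] [NormedSpace ℝ F]
  {M : Type*} [TopologicalSpace M] [ChartedSpace (Vec n) M]

theorem target_mem_nhds {c : M} {y : Vec n} (hy : y ∈ (extChartAt (𝓡 n) c).target) :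
    (extChartAt (𝓡 n) c).target ∈ 𝓝 y :=
  (isOpen_extChartAt_target c).mem_nhds hy

theorem extD_eq (η : M → Vec n [⋀^Fin k]→L[ℝ] F) (x : M) :
    extD (𝓡 n) η x =
      alternatizeUncurryFin (fderiv ℝ (chartRep (𝓡 n) x η) (extChartAt (𝓡 n) x x)) := by
  simp [extD, extDerivWithin]

theorem smoothFormFamily_iff {η : Par → M → Vec n [⋀^Fin k]→L[ℝ] F} :
    SmoothFormFamily (𝓡 n) η ↔ ∀ c : M, ∀ q : Par, ∀ y ∈ (extChartAt (𝓡 n) c).target,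
      ContDiffAt ℝ ∞ (fun z : Par × Vec n => chartRep (𝓡 n) c (η z.1) z.2) (q, y) := by
  constructor
  · intro h c q y hy
    exact (h c).contDiffAt (prod_mem_nhds univ_mem (target_mem_nhds hy))
  · intro h c z hz
    exact (h c z.1 z.2 hz.2).contDiffWithinAt

theorem SmoothFormFamily.slice {η : Par → M → Vec n [⋀^Fin k]→L[ℝ] F}
    (h : SmoothFormFamily (𝓡 n) η) (q : Par) : SmoothForm (𝓡 n) (η q) := by
  intro c y hy
  have h1 := smoothFormFamily_iff.1 h c q y hy
  have h2 : ContDiffAt ℝ ∞ (fun y' : Vec n => (q, y')) y := by fun_prop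
  exact (h1.comp y h2).contDiffWithinAt

theorem SmoothForm.contDiffAt {η : M → Vec n [⋀^Fin k]→L[ℝ] F} (h : SmoothForm (𝓡 n) η)
    {c : M} {y : Vec n} (hy : y ∈ (extChartAt (𝓡 n) c).target) :
    ContDiffAt ℝ ∞ (chartRep (𝓡 n) c η) y :=
  (h c).contDiffAt (target_mem_nhds hy)

theorem SmoothForm.differentiableAt {η : M → Vec n [⋀^Fin k]→L[ℝ] F} (h : SmoothForm (𝓡 n) η)
    (x : M) : DifferentiableAt ℝ (chartRep (𝓡 n) x η) (extChartAt (𝓡 n) x x) :=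
  (h.contDiffAt (mem_extChartAt_target x)).differentiableAt (by simp)

/-- The coordinate expression of a vector field. -/
noncomputable def chartVec (c : M) (X : M → Vec n) (y : Vec n) : Vec n :=
  (mfderiv (𝓡 n) 𝓘(ℝ, Vec n) (extChartAt (𝓡 n) c) ((extChartAt (𝓡 n) c).symm y) :
    Vec n →L[ℝ] Vec n) (X ((extChartAt (𝓡 n) c).symm y))

/-- Smoothness of a vector field. -/
def SmoothVec (X : M → Vec n) : Prop :=
  ∀ c : M, ∀ y ∈ (extChartAt (𝓡 n) c).target, ContDiffAt ℝ ∞ (chartVec c X) y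

/-- Joint smoothness of a family of vector fields. -/
def SmoothVecFamily (X : Par → M → Vec n) : Prop :=
  ∀ c : M, ∀ q : Par, ∀ y ∈ (extChartAt (𝓡 n) c).target,
    ContDiffAt ℝ ∞ (fun z : Par × Vec n => chartVec c (X z.1) z.2) (q, y)

theorem SmoothVecFamily.slice {X : Par → M → Vec n} (h : SmoothVecFamily X) (q : Par) :
    SmoothVec (X q) := by
  intro c y hy
  have h2 : ContDiffAt ℝ ∞ (fun y' : Vec n => (q, y')) y := by fun_prop
  exact (h c q y hy).comp y h2

/-- The partial derivative of a family of forms with respect to a parameter. -/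
noncomputable def pd (i : Fin 2) (η : Par → M → Vec n [⋀^Fin k]→L[ℝ] F) (q : Par) (x : M) :
    Vec n [⋀^Fin k]→L[ℝ] F :=
  fderiv ℝ (fun q' => η q' x) q (basisVec i)

/-- The derivative of a form at a point, in the preferred chart. -/
noncomputable def dAt (η : M → Vec n [⋀^Fin k]→L[ℝ] F) (x : M) :
    Vec n →L[ℝ] Vec n [⋀^Fin k]→L[ℝ] F :=
  fderiv ℝ (chartRep (𝓡 n) x η) (extChartAt (𝓡 n) x x)

/-- The derivative of a vector field at a point, in the preferred chart. -/
noncomputable def dVec (X : M → Vec n) (x : M) : Vec n →L[ℝ] Vec n :=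
  fderiv ℝ (chartVec x X) (extChartAt (𝓡 n) x x)

theorem extD_eq_dAt (η : M → Vec n [⋀^Fin k]→L[ℝ] F) (x : M) :
    extD (𝓡 n) η x = alternatizeUncurryFin (dAt η x) := extD_eq η x

theorem chartRep_zero_apply (c : M) (b : M → Vec n [⋀^Fin 0]→L[ℝ] F) (y : Vec n) :
    chartRep (𝓡 n) c b y 0 = b ((extChartAt (𝓡 n) c).symm y) 0 := by
  exact congrArg (b ((extChartAt (𝓡 n) c).symm y))
    (Subsingleton.elim (α := Fin 0 → Vec n) _ _)

theorem extD_add {η ζ : M → Vec n [⋀^Fin k]→L[ℝ] F} (hη : SmoothForm (𝓡 n) η)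
    (hζ : SmoothForm (𝓡 n) ζ) : extD (𝓡 n) (η + ζ) = extD (𝓡 n) η + extD (𝓡 n) ζ := by
  funext x
  rw [Pi.add_apply, extD_eq, extD_eq, extD_eq, chartRep_add,
    fderiv_add (hη.differentiableAt x) (hζ.differentiableAt x), alternatizeUncurryFin_add]

theorem extD_smul (r : ℝ) {η : M → Vec n [⋀^Fin k]→L[ℝ] F} (hη : SmoothForm (𝓡 n) η) :
    extD (𝓡 n) (r • η) = r • extD (𝓡 n) η := by
  funext x
  rw [Pi.smul_apply, extD_eq, extD_eq, chartRep_smul,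
    fderiv_const_smul (hη.differentiableAt x), alternatizeUncurryFin_smul]

theorem extD_sub {η ζ : M → Vec n [⋀^Fin k]→L[ℝ] F} (hη : SmoothForm (𝓡 n) η)
    (hζ : SmoothForm (𝓡 n) ζ) : extD (𝓡 n) (η - ζ) = extD (𝓡 n) η - extD (𝓡 n) ζ := by
  funext x
  rw [Pi.sub_apply, extD_eq, extD_eq, extD_eq, chartRep_sub,
    fderiv_sub (hη.differentiableAt x) (hζ.differentiableAt x)]
  exact map_sub (alternatizeUncurryFinCLM ℝ (Vec n) F) _ _

section
variable {η ζ : Par → M → Vec n [⋀^Fin k]→L[ℝ] F}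

theorem SmoothFormFamily.add (hη : SmoothFormFamily (𝓡 n) η) (hζ : SmoothFormFamily (𝓡 n) ζ) :
    SmoothFormFamily (𝓡 n) (fun q => η q + ζ q) :=
  fun c => (hη c).add (hζ c)

theorem SmoothFormFamily.sub (hη : SmoothFormFamily (𝓡 n) η) (hζ : SmoothFormFamily (𝓡 n) ζ) :
    SmoothFormFamily (𝓡 n) (fun q => η q - ζ q) :=
  fun c => (hη c).sub (hζ c)

end

section
variable [IsManifold (𝓡 n) ∞ M]

theorem chartVec_center (x : M) (X : M → Vec n) :
    chartVec x X (extChartAt (𝓡 n) x x) = X x := by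
  have h := mfderiv_extChartAt_self (I := 𝓡 n) (x := x)
  rw [chartVec, extChartAt_to_inv]
  exact congrArg (fun T : Vec n →L[ℝ] Vec n => T (X x)) h

theorem chartRep_intProd {c : M} {y : Vec n} (hy : y ∈ (extChartAt (𝓡 n) c).target)
    (X : M → Vec n) (η : M → Vec n [⋀^Fin (k + 1)]→L[ℝ] F) :
    chartRep (𝓡 n) c (intProd X η) y = (chartRep (𝓡 n) c η y).curryLeft (chartVec c X y) := by
  have h := mfderivWithin_extChartAt_symm_comp_mfderiv_extChartAt hy
  have h' : (mfderivWithin 𝓘(ℝ, Vec n) (𝓡 n) (extChartAt (𝓡 n) c).symm (range (𝓡 n)) y :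
      Vec n →L[ℝ] Vec n) (chartVec c X y) = X ((extChartAt (𝓡 n) c).symm y) :=
    congrArg (fun T : Vec n →L[ℝ] Vec n => T (X ((extChartAt (𝓡 n) c).symm y))) h
  refine ContinuousAlternatingMap.ext fun v => ?_
  refine congrArg (η ((extChartAt (𝓡 n) c).symm y)) (funext fun i => ?_)
  refine Fin.cases ?_ (fun i => ?_) i
  · exact h'.symm
  · rfl

variable {η ζ : Par → M → Vec n [⋀^Fin k]→L[ℝ] F}

/-- At its centre the preferred chart has identity derivative, so the value at the fixed point `x`
is a slice of the jointly smooth coordinate expression. -/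
theorem SmoothFormFamily.contDiffAt_param (hη : SmoothFormFamily (𝓡 n) η) (q : Par) (x : M) :
    ContDiffAt ℝ ∞ (fun q' => η q' x) q := by
  have h1 := smoothFormFamily_iff.1 hη x q _ (mem_extChartAt_target x)
  have h2 : ContDiffAt ℝ ∞ (fun q' : Par => (q', extChartAt (𝓡 n) x x)) q := by fun_prop
  have h3 := h1.comp q h2
  refine h3.congr_of_eventuallyEq (Eventually.of_forall fun q' => ?_)
  exact (chartRep_center x (η q')).symm

theorem SmoothFormFamily.differentiableAt_param (hη : SmoothFormFamily (𝓡 n) η) (q : Par) (x : M) :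
    DifferentiableAt ℝ (fun q' => η q' x) q :=
  (hη.contDiffAt_param q x).differentiableAt (by simp)

theorem pd_add (hη : SmoothFormFamily (𝓡 n) η) (hζ : SmoothFormFamily (𝓡 n) ζ) (i : Fin 2)
    (q : Par) : pd i (fun q => η q + ζ q) q = pd i η q + pd i ζ q := by
  funext x
  have := fderiv_add (hη.differentiableAt_param q x) (hζ.differentiableAt_param q x)
  exact congrArg (fun T => T (basisVec i)) this

theorem pd_sub (hη : SmoothFormFamily (𝓡 n) η) (hζ : SmoothFormFamily (𝓡 n) ζ) (i : Fin 2)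
    (q : Par) : pd i (fun q => η q - ζ q) q = pd i η q - pd i ζ q := by
  funext x
  have := fderiv_sub (hη.differentiableAt_param q x) (hζ.differentiableAt_param q x)
  exact congrArg (fun T => T (basisVec i)) this

/-- The derivative of the inverse chart does not involve the parameter, so `∂_i` passes through the
pullback that defines `chartRep`. -/
theorem chartRep_pd (hη : SmoothFormFamily (𝓡 n) η) (i : Fin 2) (q : Par) (c : M) (y : Vec n) :
    chartRep (𝓡 n) c (pd i η q) y =
      fderiv ℝ (fun q' => chartRep (𝓡 n) c (η q') y) q (basisVec i) := by
  exact (hasFDerivAt_compContinuousLinearMap_const (E := Vec n) (E' := Vec n)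
    (hη.differentiableAt_param q ((extChartAt (𝓡 n) c).symm y))
    (mfderivWithin 𝓘(ℝ, Vec n) (𝓡 n) (extChartAt (𝓡 n) c).symm (range (𝓡 n)) y :
      Vec n →L[ℝ] Vec n) (basisVec i)).2.symm

theorem SmoothFormFamily.pd (hη : SmoothFormFamily (𝓡 n) η) (i : Fin 2) :
    SmoothFormFamily (𝓡 n) (pd i η) := by
  refine smoothFormFamily_iff.2 fun c q y hy => ?_
  have h := contDiffAt_partial_fst (smoothFormFamily_iff.1 hη c q y hy) (basisVec i)
  refine h.congr_of_eventuallyEq (Eventually.of_forall fun z => ?_)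
  exact chartRep_pd hη i z.1 c z.2

theorem SmoothForm.chartRep_extD' {η : M → Vec n [⋀^Fin k]→L[ℝ] F} (hη : SmoothForm (𝓡 n) η)
    {c : M} {y : Vec n} (hy : y ∈ (extChartAt (𝓡 n) c).target) :
    chartRep (𝓡 n) c (extD (𝓡 n) η) y =
      alternatizeUncurryFin (fderiv ℝ (chartRep (𝓡 n) c η) y) := by
  rw [hη.chartRep_extD hy]
  simp [extDerivWithin]

theorem SmoothFormFamily.extD (hη : SmoothFormFamily (𝓡 n) η) :
    SmoothFormFamily (𝓡 n) (fun q => extD (𝓡 n) (η q)) := by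
  refine smoothFormFamily_iff.2 fun c q y hy => ?_
  have h := contDiffAt_partial_snd (smoothFormFamily_iff.1 hη c q y hy)
  have h1 := contDiffAt_alternatizeUncurryFin h
  refine h1.congr_of_eventuallyEq ?_
  have h2 : ∀ᶠ z : Par × Vec n in 𝓝 (q, y), z.2 ∈ (extChartAt (𝓡 n) c).target :=
    continuousAt_snd.eventually_mem (target_mem_nhds hy)
  filter_upwards [h2] with z hz
  exact (hη.slice z.1).chartRep_extD' hz

/-- In the preferred chart at `x` both operations are partial derivatives of one jointly smooth
function, in parameters and in coordinates, and these commute. -/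
theorem pd_extD (hη : SmoothFormFamily (𝓡 n) η) (i : Fin 2) (q : Par) :
    CovPhase.pd i (fun q => CovPhase.extD (𝓡 n) (η q)) q =
      CovPhase.extD (𝓡 n) (CovPhase.pd i η q) := by
  funext x
  have h := smoothFormFamily_iff.1 hη x q _ (mem_extChartAt_target x)
  obtain ⟨h1, h2⟩ := fderiv_fst_fderiv_snd h (basisVec i)
  rw [extD_eq, CovPhase.pd]
  simp only [extD_eq]
  rw [(hasFDerivAt_alternatizeUncurryFin h1 _).2, h2]
  congr 2
  funext y
  exact (chartRep_pd hη i q x y).symm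

/-- `extD` uses a different chart at every point, but near `x` its expression in the chart at `x` is
the flat exterior derivative. The claim then reduces to `d² = 0` in a vector space. -/
theorem SmoothForm.extD_extD {η : M → Vec n [⋀^Fin k]→L[ℝ] F} (hη : SmoothForm (𝓡 n) η) :
    CovPhase.extD (𝓡 n) (CovPhase.extD (𝓡 n) η) = 0 := by
  funext x
  have h1 : chartRep (𝓡 n) x (CovPhase.extD (𝓡 n) η) =ᶠ[𝓝 (extChartAt (𝓡 n) x x)]
      extDeriv (chartRep (𝓡 n) x η) := by
    filter_upwards [target_mem_nhds (mem_extChartAt_target x)] with y hy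
    exact hη.chartRep_extD' hy
  have h2 := extDeriv_extDeriv_apply (hη.contDiffAt (mem_extChartAt_target x)) minSmoothness_two_le
  rw [extD_eq, h1.fderiv_eq]
  exact h2

end

end Families

/-! ### Derivatives of bilinear expressions -/

section Bilinear

variable {P E F G : Type*} [NormedAddCommGroup P] [NormedSpace ℝ P]
  [NormedAddCommGroup E] [NormedSpace ℝ E] [FiniteDimensional ℝ E]
  [NormedAddCommGroup F] [NormedSpace ℝ F] [FiniteDimensional ℝ F]
  [NormedAddCommGroup G] [NormedSpace ℝ G] {f : P → E} {g : P → F} {q : P}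

theorem contDiffAt_bilin (B : E →ₗ[ℝ] F →ₗ[ℝ] G) {n : WithTop ℕ∞} (hf : ContDiffAt ℝ n f q)
    (hg : ContDiffAt ℝ n g q) : ContDiffAt ℝ n (fun z => B (f z) (g z)) q :=
  ((bilinCLM B).contDiff.contDiffAt.comp q hf).clm_apply hg

theorem fderiv_bilin (B : E →ₗ[ℝ] F →ₗ[ℝ] G) (hf : DifferentiableAt ℝ f q)
    (hg : DifferentiableAt ℝ g q) (v : P) :
    fderiv ℝ (fun z => B (f z) (g z)) q v = B (f q) (fderiv ℝ g q v) + B (fderiv ℝ f q v) (g q) := by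
  have h := (bilinCLM B).hasFDerivAt_of_bilinear hf.hasFDerivAt hg.hasFDerivAt
  exact congrArg (fun T => T v) h.fderiv

end Bilinear

section CurryBil

variable {E F : Type*} [NormedAddCommGroup E] [NormedSpace ℝ E]
  [NormedAddCommGroup F] [NormedSpace ℝ F]

/-- The interior product as a bilinear map. -/
noncomputable def curryBil (k : ℕ) (E F : Type*) [NormedAddCommGroup E] [NormedSpace ℝ E]
    [NormedAddCommGroup F] [NormedSpace ℝ F] :
    (E [⋀^Fin (k + 1)]→L[ℝ] F) →ₗ[ℝ] E →ₗ[ℝ] (E [⋀^Fin k]→L[ℝ] F) :=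
  LinearMap.mk₂ ℝ (fun η v => η.curryLeft v)
    (fun _ _ _ => rfl) (fun _ _ _ => rfl)
    (fun η v w => map_add η.curryLeft v w) (fun r η v => map_smul η.curryLeft r v)

end CurryBil

/-! ### Operations on smooth families of forms -/

section Closure

variable {n k : ℕ} {F W : Type*} [NormedAddCommGroup F] [NormedSpace ℝ F] [FiniteDimensional ℝ F]
  [NormedAddCommGroup W] [NormedSpace ℝ W] [FiniteDimensional ℝ W]
  {M : Type*} [TopologicalSpace M] [ChartedSpace (Vec n) M] [IsManifold (𝓡 n) ∞ M]

theorem eventually_snd_mem_target {c : M} {q : Par} {y : Vec n}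
    (hy : y ∈ (extChartAt (𝓡 n) c).target) :
    ∀ᶠ z : Par × Vec n in 𝓝 (q, y), z.2 ∈ (extChartAt (𝓡 n) c).target :=
  continuousAt_snd.eventually_mem (target_mem_nhds hy)

theorem SmoothFormFamily.intProd {X : Par → M → Vec n} (hX : SmoothVecFamily X)
    {η : Par → M → Vec n [⋀^Fin (k + 1)]→L[ℝ] F} (hη : SmoothFormFamily (𝓡 n) η) :
    SmoothFormFamily (𝓡 n) (fun q => intProd (X q) (η q)) := by
  refine smoothFormFamily_iff.2 fun c q y hy => ?_
  have h := contDiffAt_bilin (curryBil k (Vec n) F) (smoothFormFamily_iff.1 hη c q y hy) (hX c q y hy)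
  refine h.congr_of_eventuallyEq ?_
  filter_upwards [eventually_snd_mem_target hy] with z hz
  exact chartRep_intProd hz _ _

theorem SmoothFormFamily.lieD {X : Par → M → Vec n} (hX : SmoothVecFamily X)
    {η : Par → M → Vec n [⋀^Fin k]→L[ℝ] F} (hη : SmoothFormFamily (𝓡 n) η) :
    SmoothFormFamily (𝓡 n) (fun q => lieD (𝓡 n) (X q) (η q)) := by
  cases k with
  | zero => exact SmoothFormFamily.intProd hX hη.extD
  | succ k =>
    exact (SmoothFormFamily.intProd hX hη.extD).add (SmoothFormFamily.intProd hX hη).extD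

theorem chartRep_wedgeOne (c : M) (a : M → Vec n [⋀^Fin 1]→L[ℝ] W)
    (Q : M → Vec n [⋀^Fin k]→L[ℝ] (W →L[ℝ] ℝ)) (y : Vec n) :
    chartRep (𝓡 n) c (fun x => wedgeOne (a x) (Q x)) y =
      wedgeOne (chartRep (𝓡 n) c a y) (chartRep (𝓡 n) c Q y) :=
  wedgeOne_comp _ _ _

theorem chartRep_pairZero (c : M) (b : M → Vec n [⋀^Fin 0]→L[ℝ] W)
    (Q : M → Vec n [⋀^Fin k]→L[ℝ] (W →L[ℝ] ℝ)) (y : Vec n) :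
    chartRep (𝓡 n) c (fun x => pairZero (b x 0) (Q x)) y =
      pairZero (chartRep (𝓡 n) c b y 0) (chartRep (𝓡 n) c Q y) := by
  rw [chartRep_zero_apply]
  exact pairZero_comp _ _ _

/-- Evaluation of `0`-covectors. -/
noncomputable def evalZero (n : ℕ) (W : Type*) [NormedAddCommGroup W] [NormedSpace ℝ W] :
    (Vec n [⋀^Fin 0]→L[ℝ] W) →L[ℝ] W := ContinuousAlternatingMap.apply ℝ (Vec n) W 0

theorem evalZero_apply (b : Vec n [⋀^Fin 0]→L[ℝ] W) : evalZero n W b = b 0 := rfl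

theorem contDiffAt_evalZero {P : Type*} [NormedAddCommGroup P] [NormedSpace ℝ P]
    {f : P → Vec n [⋀^Fin 0]→L[ℝ] W} {q : P} {r : WithTop ℕ∞} (hf : ContDiffAt ℝ r f q) :
    ContDiffAt ℝ r (fun z => f z 0) q :=
  (evalZero n W).contDiff.contDiffAt.comp q hf

theorem SmoothFormFamily.wedgeOne {a : Par → M → Vec n [⋀^Fin 1]→L[ℝ] W}
    {Q : Par → M → Vec n [⋀^Fin k]→L[ℝ] (W →L[ℝ] ℝ)} (ha : SmoothFormFamily (𝓡 n) a)
    (hQ : SmoothFormFamily (𝓡 n) Q) :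
    SmoothFormFamily (𝓡 n) (fun q x => wedgeOne (a q x) (Q q x)) := by
  refine smoothFormFamily_iff.2 fun c q y hy => ?_
  have h := contDiffAt_bilin (wedgeBil n k W) (smoothFormFamily_iff.1 ha c q y hy)
    (smoothFormFamily_iff.1 hQ c q y hy)
  exact h.congr_of_eventuallyEq (Eventually.of_forall fun z => chartRep_wedgeOne _ _ _ _)

theorem SmoothFormFamily.pairZero {b : Par → M → Vec n [⋀^Fin 0]→L[ℝ] W}
    {Q : Par → M → Vec n [⋀^Fin k]→L[ℝ] (W →L[ℝ] ℝ)} (hb : SmoothFormFamily (𝓡 n) b)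
    (hQ : SmoothFormFamily (𝓡 n) Q) :
    SmoothFormFamily (𝓡 n) (fun q x => pairZero (b q x 0) (Q q x)) := by
  refine smoothFormFamily_iff.2 fun c q y hy => ?_
  have h := contDiffAt_bilin (pairBil n k W)
    (contDiffAt_evalZero (smoothFormFamily_iff.1 hb c q y hy)) (smoothFormFamily_iff.1 hQ c q y hy)
  exact h.congr_of_eventuallyEq (Eventually.of_forall fun z => chartRep_pairZero _ _ _ _)

/-! ### Leibniz rules -/

theorem dAt_wedgeOne {a : M → Vec n [⋀^Fin 1]→L[ℝ] W}
    {Q : M → Vec n [⋀^Fin k]→L[ℝ] (W →L[ℝ] ℝ)} (ha : SmoothForm (𝓡 n) a)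
    (hQ : SmoothForm (𝓡 n) Q) (x : M) :
    dAt (fun x => wedgeOne (a x) (Q x)) x =
      (wedgeLeft k (a x)).comp (dAt Q x) + (wedgeRight (Q x)).comp (dAt a x) := by
  ext1 v
  have h := fderiv_bilin (wedgeBil n k W) (ha.differentiableAt x) (hQ.differentiableAt x) v
  rw [chartRep_center, chartRep_center] at h
  have h2 : chartRep (𝓡 n) x (fun x => wedgeOne (a x) (Q x)) = fun y =>
      wedgeBil n k W (chartRep (𝓡 n) x a y) (chartRep (𝓡 n) x Q y) :=
    funext fun y => chartRep_wedgeOne _ _ _ _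
  rw [dAt, h2]
  exact h

theorem dAt_pairZero {b : M → Vec n [⋀^Fin 0]→L[ℝ] W}
    {Q : M → Vec n [⋀^Fin k]→L[ℝ] (W →L[ℝ] ℝ)} (hb : SmoothForm (𝓡 n) b)
    (hQ : SmoothForm (𝓡 n) Q) (x : M) (v : Vec n) :
    dAt (fun x => pairZero (b x 0) (Q x)) x v =
      pairZero (b x 0) (dAt Q x v) + pairZero (dAt b x v 0) (Q x) := by
  have h1 := ContinuousLinearMap.fderiv_comp_apply (evalZero n W) (hb.differentiableAt x) v
  have h := fderiv_bilin (pairBil n k W) h1.1 (hQ.differentiableAt x) v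
  rw [h1.2, chartRep_center, chartRep_center] at h
  have h2 : chartRep (𝓡 n) x (fun x => pairZero (b x 0) (Q x)) = fun y =>
      pairBil n k W (evalZero n W (chartRep (𝓡 n) x b y)) (chartRep (𝓡 n) x Q y) :=
    funext fun y => chartRep_pairZero _ _ _ _
  rw [dAt, h2]
  exact h

theorem extD_pairZero {b : M → Vec n [⋀^Fin 0]→L[ℝ] W}
    {Q : M → Vec n [⋀^Fin k]→L[ℝ] (W →L[ℝ] ℝ)} (hb : SmoothForm (𝓡 n) b)
    (hQ : SmoothForm (𝓡 n) Q) (x : M) :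
    extD (𝓡 n) (fun x => pairZero (b x 0) (Q x)) x =
      wedgeOne (extD (𝓡 n) b x) (Q x) + pairZero (b x 0) (extD (𝓡 n) Q x) := by
  rw [extD_eq_dAt, extD_eq_dAt, extD_eq_dAt, add_comm (wedgeOne _ _)]
  ext v
  rw [ContinuousAlternatingMap.add_apply, wedgeOne_apply, pairZero_apply,
    alternatizeUncurryFin_apply, alternatizeUncurryFin_apply]
  simp only [dAt_pairZero hb hQ, ContinuousAlternatingMap.add_apply, pairZero_apply, smul_add,
    Finset.sum_add_distrib]
  congr 1
  · simp
  · refine Finset.sum_congr rfl fun i _ => ?_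
    simp [alternatizeUncurryFin_apply]
    congr 2
    exact Subsingleton.elim (α := Fin 0 → Vec n) _ _

/-- The graded Leibniz rule, with minus sign from moving `d` past the `1`-form `a`. The term `da ∧
Q` involves `Q` only at the point `x`, so `T` need represent `Q` only there. -/
theorem extD_wedgeOne_coeff2 {l : ℕ} {M : Type*} [TopologicalSpace M] [ChartedSpace (Vec (l + 2)) M]
    [IsManifold (𝓡 (l + 2)) ∞ M] {a : M → Vec (l + 2) [⋀^Fin 1]→L[ℝ] W}
    {Q : M → Vec (l + 2) [⋀^Fin l]→L[ℝ] (W →L[ℝ] ℝ)} (ha : SmoothForm (𝓡 (l + 2)) a)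
    (hQ : SmoothForm (𝓡 (l + 2)) Q) (x : M)
    (T : (Vec (l + 2) [⋀^Fin 2]→L[ℝ] W) →L[ℝ] (Vec (l + 2) [⋀^Fin (l + 2)]→L[ℝ] ℝ))
    (hT : Q x = coeff2 T) :
    extD (𝓡 (l + 2)) (fun x => wedgeOne (a x) (Q x)) x =
      T (extD (𝓡 (l + 2)) a x) - wedgeOne (a x) (extD (𝓡 (l + 2)) Q x) := by
  rw [extD_eq_dAt, extD_eq_dAt, extD_eq_dAt, dAt_wedgeOne ha hQ, alternatizeUncurryFin_add,
    alternatize_wedgeLeft, hT, alternatize_wedgeOne_coeff2]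
  abel

/-! ### Cartan's formula -/

theorem dAt_intProd {X : M → Vec n} (hX : SmoothVec X) {η : M → Vec n [⋀^Fin (k + 1)]→L[ℝ] F}
    (hη : SmoothForm (𝓡 n) η) (x : M) :
    dAt (intProd X η) x = (η x).curryLeft.comp (dVec X x) + (iota k F (X x)).comp (dAt η x) := by
  ext1 v
  have h := fderiv_bilin (curryBil k (Vec n) F) (hη.differentiableAt x)
    ((hX x _ (mem_extChartAt_target x)).differentiableAt (by simp)) v
  rw [chartRep_center, chartVec_center] at h
  have h2 : chartRep (𝓡 n) x (intProd X η) =ᶠ[𝓝 (extChartAt (𝓡 n) x x)] fun y =>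
      curryBil k (Vec n) F (chartRep (𝓡 n) x η y) (chartVec x X y) := by
    filter_upwards [target_mem_nhds (mem_extChartAt_target x)] with y hy
    exact chartRep_intProd hy X η
  rw [dAt, h2.fderiv_eq]
  exact h

/-- Cartan's formula: the Lie derivative in the preferred chart. -/
theorem lieD_eq {X : M → Vec n} (hX : SmoothVec X) {η : M → Vec n [⋀^Fin k]→L[ℝ] F}
    (hη : SmoothForm (𝓡 n) η) (x : M) :
    lieD (𝓡 n) X η x = dAt η x (X x) +
      (η x).fderivCompContinuousLinearMap (ContinuousLinearMap.id ℝ (Vec n)) (dVec X x) := by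
  cases k with
  | zero =>
    have h : (η x).fderivCompContinuousLinearMap (ContinuousLinearMap.id ℝ (Vec n)) (dVec X x) = 0 := by
      ext v
      simp [fderivCompContinuousLinearMap_apply]
    rw [h, add_zero]
    change (extD (𝓡 n) η x).curryLeft (X x) = _
    rw [extD_eq_dAt, curryLeft_alternatizeUncurryFin_zero]
  | succ k =>
    change (extD (𝓡 n) η x).curryLeft (X x) + extD (𝓡 n) (intProd X η) x = _
    rw [extD_eq_dAt, extD_eq_dAt, curryLeft_alternatizeUncurryFin, dAt_intProd hX hη,
      alternatizeUncurryFin_add, fderivComp_id]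
    abel

theorem lieD_add {X : M → Vec n} {η ζ : M → Vec n [⋀^Fin k]→L[ℝ] F}
    (hX : SmoothVec X) (hη : SmoothForm (𝓡 n) η) (hζ : SmoothForm (𝓡 n) ζ) :
    lieD (𝓡 n) X (η + ζ) = lieD (𝓡 n) X η + lieD (𝓡 n) X ζ := by
  have h : SmoothForm (𝓡 n) (η + ζ) := fun c => (hη c).add (hζ c)
  funext x
  rw [Pi.add_apply, lieD_eq hX h, lieD_eq hX hη, lieD_eq hX hζ]
  have h1 : dAt (η + ζ) x = dAt η x + dAt ζ x :=
    fderiv_add (hη.differentiableAt x) (hζ.differentiableAt x)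
  rw [h1]
  ext v
  simp only [fderivCompContinuousLinearMap_apply, ContinuousAlternatingMap.add_apply,
    _root_.add_apply, Pi.add_apply, Finset.sum_add_distrib]
  abel

theorem lieD_neg {X : M → Vec n} {η : M → Vec n [⋀^Fin k]→L[ℝ] F}
    (hX : SmoothVec X) (hη : SmoothForm (𝓡 n) η) :
    lieD (𝓡 n) X (-η) = - lieD (𝓡 n) X η := by
  have h : SmoothForm (𝓡 n) (-η) := fun c => (hη c).neg
  funext x
  rw [Pi.neg_apply, lieD_eq hX h, lieD_eq hX hη]
  have h1 : dAt (-η) x = - dAt η x :=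
    fderiv_neg (f := chartRep (𝓡 n) x η)
  rw [h1]
  ext v
  simp only [fderivCompContinuousLinearMap_apply, ContinuousAlternatingMap.add_apply,
    _root_.neg_apply, Pi.neg_apply, ContinuousAlternatingMap.neg_apply, Finset.sum_neg_distrib]
  abel

theorem SmoothForm.intProd {X : M → Vec n} (hX : SmoothVec X)
    {η : M → Vec n [⋀^Fin (k + 1)]→L[ℝ] F} (hη : SmoothForm (𝓡 n) η) :
    SmoothForm (𝓡 n) (intProd X η) := by
  intro c y hy
  have h := contDiffAt_bilin (curryBil k (Vec n) F) (hη.contDiffAt hy) (hX c y hy)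
  refine (h.congr_of_eventuallyEq ?_).contDiffWithinAt
  filter_upwards [target_mem_nhds hy] with z hz
  exact chartRep_intProd hz _ _

theorem SmoothForm.extD {η : M → Vec n [⋀^Fin k]→L[ℝ] F} (hη : SmoothForm (𝓡 n) η) :
    SmoothForm (𝓡 n) (extD (𝓡 n) η) := by
  intro c y hy
  have h := contDiffAt_alternatizeUncurryFin ((hη.contDiffAt hy).fderiv_right (m := ∞) (by simp))
  refine (h.congr_of_eventuallyEq ?_).contDiffWithinAt
  filter_upwards [target_mem_nhds hy] with z hz
  exact hη.chartRep_extD' hz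

/-- The Lie derivative commutes with the exterior derivative. -/
theorem lieD_extD {X : M → Vec n} (hX : SmoothVec X) {η : M → Vec n [⋀^Fin k]→L[ℝ] F}
    (hη : SmoothForm (𝓡 n) η) :
    lieD (𝓡 n) X (extD (𝓡 n) η) = extD (𝓡 n) (lieD (𝓡 n) X η) := by
  have h1 : lieD (𝓡 n) X (CovPhase.extD (𝓡 n) η) =
      CovPhase.extD (𝓡 n) (CovPhase.intProd X (CovPhase.extD (𝓡 n) η)) := by
    change CovPhase.intProd X (CovPhase.extD (𝓡 n) (CovPhase.extD (𝓡 n) η)) + _ = _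
    rw [hη.extD_extD]
    have : CovPhase.intProd X (0 : M → Vec n [⋀^Fin (k + 1 + 1)]→L[ℝ] F) = 0 := by
      funext x
      simp [CovPhase.intProd, curryLeft_zero]
    rw [this, zero_add]
  rw [h1]
  -- Both sides equal `d ι_X dη`, using `d² = 0`. Degree zero is separate because there `lieD` has
  -- no term `d ι_X`.
  cases k with
  | zero => rfl
  | succ k =>
    change _ = CovPhase.extD (𝓡 n) (CovPhase.intProd X (CovPhase.extD (𝓡 n) η) +
      CovPhase.extD (𝓡 n) (CovPhase.intProd X η))
    rw [extD_add (SmoothForm.intProd hX hη.extD) (SmoothForm.intProd hX hη).extD,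
      (SmoothForm.intProd hX hη).extD_extD, add_zero]

/-- The infinitesimal action of `h` is a sum over slots. The slot filled by `v` gives `ι_{h v} η`,
and the others act on `ι_v η`. -/
theorem curryLeft_fderivComp (η : Vec n [⋀^Fin (k + 1)]→L[ℝ] F) (h : Vec n →L[ℝ] Vec n)
    (v : Vec n) :
    (η.fderivCompContinuousLinearMap (ContinuousLinearMap.id ℝ (Vec n)) h).curryLeft v =
      η.curryLeft (h v) + (η.curryLeft v).fderivCompContinuousLinearMap
        (ContinuousLinearMap.id ℝ (Vec n)) h := by
  ext w
  rw [curryLeft_apply_apply, fderivCompContinuousLinearMap_apply, Fin.sum_univ_succ,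
    ContinuousAlternatingMap.add_apply, fderivCompContinuousLinearMap_apply]
  congr 1
  · rw [curryLeft_apply_apply]
    congr 1
    funext i
    refine Fin.cases ?_ (fun i => ?_) i <;> simp
  · refine Finset.sum_congr rfl fun i _ => ?_
    rw [curryLeft_apply_apply]
    congr 1
    funext j
    refine Fin.cases ?_ (fun j => ?_) j
    · rw [Function.update_of_ne (Fin.succ_ne_zero i).symm]
      simp
    · by_cases hij : j = i
      · subst hij; simp
      · simp [hij]

/-- `[𝔏_X, ι_Y] = ι_{[X, Y]}`. -/
theorem lieD_intProd {X Y : M → Vec n} (hX : SmoothVec X) (hY : SmoothVec Y)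
    {η : M → Vec n [⋀^Fin (k + 1)]→L[ℝ] F} (hη : SmoothForm (𝓡 n) η) (x : M) :
    lieD (𝓡 n) X (intProd Y η) x = (lieD (𝓡 n) X η x).curryLeft (Y x) +
      (η x).curryLeft (dVec Y x (X x) - dVec X x (Y x)) := by
  rw [lieD_eq hX (SmoothForm.intProd hY hη), lieD_eq hX hη, dAt_intProd hY hη, intProd, map_sub]
  have h := curryLeft_fderivComp (η x) (dVec X x) (Y x)
  have h2 : ∀ a b : Vec n [⋀^Fin (k + 1)]→L[ℝ] F, (a + b).curryLeft (Y x) =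
    a.curryLeft (Y x) + b.curryLeft (Y x) := fun a b => rfl
  rw [h2, h]
  simp only [_root_.add_apply, ContinuousLinearMap.comp_apply, iota_apply]
  abel

end Closure

/-! ### Smooth families of diffeomorphisms -/

section Diffeo

variable {n k : ℕ} {M : Type*} [TopologicalSpace M] [ChartedSpace (Vec n) M]
  {N : Type*} [TopologicalSpace N] [ChartedSpace (Vec n) N]

/-- Joint smoothness of a family of diffeomorphisms. -/
def SmoothDiffFamily (u : Par → (N ≃ₘ^∞⟮𝓡 n, 𝓡 n⟯ M)) : Prop :=
  ContMDiff (𝓘(ℝ, Par).prod (𝓡 n)) (𝓡 n) ∞ (fun z : Par × N => u z.1 z.2)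

/-- The coordinate expression of a family of diffeomorphisms. -/
noncomputable def coordFam (c : N) (c' : M) (u : Par → (N ≃ₘ^∞⟮𝓡 n, 𝓡 n⟯ M)) (z : Par × Vec n) :
    Vec n :=
  extChartAt (𝓡 n) c' (u z.1 ((extChartAt (𝓡 n) c).symm z.2))

variable {u : Par → (N ≃ₘ^∞⟮𝓡 n, 𝓡 n⟯ M)} {c : N} {c' : M} {q : Par} {y : Vec n}

variable [IsManifold (𝓡 n) ∞ M] [IsManifold (𝓡 n) ∞ N]

theorem SmoothDiffFamily.eventually_mem_source (hu : SmoothDiffFamily u)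
    (hy : y ∈ (extChartAt (𝓡 n) c).target)
    (hc : u q ((extChartAt (𝓡 n) c).symm y) ∈ (extChartAt (𝓡 n) c').source) :
    ∀ᶠ z : Par × Vec n in 𝓝 (q, y), z.2 ∈ (extChartAt (𝓡 n) c).target ∧
      u z.1 ((extChartAt (𝓡 n) c).symm z.2) ∈ (extChartAt (𝓡 n) c').source := by
  refine Filter.Eventually.and (eventually_snd_mem_target hy) ?_
  have h1 : ContinuousAt (extChartAt (𝓡 n) c).symm y := continuousAt_extChartAt_symm'' hy
  have h2 : ContinuousAt (fun z : Par × Vec n => (z.1, (extChartAt (𝓡 n) c).symm z.2)) (q, y) :=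
    continuousAt_fst.prodMk (ContinuousAt.comp (x := (q, y)) h1 continuousAt_snd)
  have h3 : ContinuousAt (fun z : Par × Vec n => u z.1 ((extChartAt (𝓡 n) c).symm z.2)) (q, y) :=
    ContinuousAt.comp (g := fun z : Par × N => u z.1 z.2) (x := (q, y))
      hu.continuous.continuousAt h2
  exact h3.eventually_mem ((isOpen_extChartAt_source c').mem_nhds hc)

theorem SmoothDiffFamily.contDiffAt_coordFam (hu : SmoothDiffFamily u)
    (hy : y ∈ (extChartAt (𝓡 n) c).target)
    (hc : u q ((extChartAt (𝓡 n) c).symm y) ∈ (extChartAt (𝓡 n) c').source) :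
    ContDiffAt ℝ ∞ (coordFam c c' u) (q, y) := by
  rw [← contMDiffAt_iff_contDiffAt]
  have h1 : ContMDiffAt 𝓘(ℝ, Vec n) (𝓡 n) ∞ (extChartAt (𝓡 n) c).symm y :=
    (contMDiffOn_extChartAt_symm c).contMDiffAt (target_mem_nhds hy)
  have h2 : ContMDiffAt 𝓘(ℝ, Par × Vec n) (𝓡 n) ∞
      (fun z : Par × Vec n => (extChartAt (𝓡 n) c).symm z.2) (q, y) :=
    ContMDiffAt.comp (q, y) h1 contDiff_snd.contMDiff.contMDiffAt
  have h3 : ContMDiffAt 𝓘(ℝ, Par × Vec n) (𝓘(ℝ, Par).prod (𝓡 n)) ∞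
      (fun z : Par × Vec n => (z.1, (extChartAt (𝓡 n) c).symm z.2)) (q, y) :=
    (contDiff_fst.contMDiff.contMDiffAt (n := ∞)).prodMk h2
  have h4 : ContMDiffAt 𝓘(ℝ, Par × Vec n) (𝓡 n) ∞
      (fun z : Par × Vec n => u z.1 ((extChartAt (𝓡 n) c).symm z.2)) (q, y) :=
    ContMDiffAt.comp (g := fun z : Par × N => u z.1 z.2) (q, y) hu.contMDiffAt h3
  rw [extChartAt_source] at hc
  exact ContMDiffAt.comp (q, y) (contMDiffAt_extChartAt' hc) h4

theorem SmoothDiffFamily.contMDiffAt_param (hu : SmoothDiffFamily u) (q : Par) (w : N) :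
    ContMDiffAt 𝓘(ℝ, Par) (𝓡 n) ∞ (fun q' => u q' w) q := by
  have h3 : ContMDiffAt 𝓘(ℝ, Par) (𝓘(ℝ, Par).prod (𝓡 n)) ∞ (fun q' : Par => (q', w)) q :=
    contMDiffAt_id.prodMk contMDiffAt_const
  exact ContMDiffAt.comp (g := fun z : Par × N => u z.1 z.2) q hu.contMDiffAt h3

/-- The velocity `∂_i u ∘ u⁻¹` of a family of diffeomorphisms. -/
noncomputable def logVel (u : Par → (N ≃ₘ^∞⟮𝓡 n, 𝓡 n⟯ M)) (i : Fin 2) (q : Par) (x : M) : Vec n :=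
  (mfderiv 𝓘(ℝ, Par) (𝓡 n) (fun q' => u q' ((u q).symm x)) q : Par →L[ℝ] Vec n) (basisVec i)

/-- At the moving point `u_q(w)` the field `X_i` is the parameter derivative of `u` with `w` fixed.
Read in charts, this makes `X_i` along the family a partial derivative of its coordinate expression;
smoothness, Maurer-Cartan and Cartan's formula all rest on it. -/
theorem SmoothDiffFamily.chartVec_logVel (hu : SmoothDiffFamily u)
    (hc : u q ((extChartAt (𝓡 n) c).symm y) ∈ (extChartAt (𝓡 n) c').source) (i : Fin 2) :
    chartVec c' (logVel u i q) (coordFam c c' u (q, y)) =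
      fderiv ℝ (fun q' => coordFam c c' u (q', y)) q (basisVec i) := by
  set w := (extChartAt (𝓡 n) c).symm y with hw
  have h1 : chartVec c' (logVel u i q) (coordFam c c' u (q, y)) =
      (mfderiv (𝓡 n) 𝓘(ℝ, Vec n) (extChartAt (𝓡 n) c') (u q w) : Vec n →L[ℝ] Vec n)
        (logVel u i q (u q w)) := by
    rw [chartVec, coordFam, (extChartAt (𝓡 n) c').left_inv hc]
  have h2 : logVel u i q (u q w) =
      (mfderiv 𝓘(ℝ, Par) (𝓡 n) (fun q' => u q' w) q : Par →L[ℝ] Vec n) (basisVec i) := by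
    rw [logVel, Diffeomorph.symm_apply_apply]
  rw [h1, h2]
  have hc' := hc
  rw [extChartAt_source] at hc'
  have h3 : MDifferentiableAt (𝓡 n) 𝓘(ℝ, Vec n) (extChartAt (𝓡 n) c') (u q w) :=
    mdifferentiableAt_extChartAt hc'
  have h4 := (hu.contMDiffAt_param q w).mdifferentiableAt (by simp)
  have h5 := mfderiv_comp q h3 h4
  have h6 := congrArg (fun T : Par →L[ℝ] Vec n => T (basisVec i)) h5
  exact h6.symm.trans (congrArg (fun T : Par →L[ℝ] Vec n => T (basisVec i)) mfderiv_eq_fderiv)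

/-- The inverse family, in coordinates. -/
theorem SmoothDiffFamily.exists_inverse (hu : SmoothDiffFamily u) (q₀ : Par)
    (hy : y ∈ (extChartAt (𝓡 n) c').target)
    (hc : c = (u q₀).symm ((extChartAt (𝓡 n) c').symm y)) :
    ∃ v : Par × Vec n → Vec n, ContDiffAt ℝ ∞ v (q₀, y) ∧ v (q₀, y) = extChartAt (𝓡 n) c c ∧
      ∀ᶠ z in 𝓝 (q₀, y), v z ∈ (extChartAt (𝓡 n) c).target ∧
        u z.1 ((extChartAt (𝓡 n) c).symm (v z)) ∈ (extChartAt (𝓡 n) c').source ∧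
        coordFam c c' u (z.1, v z) = z.2 := by
  set z₀ := extChartAt (𝓡 n) c c with hz₀
  have hz : z₀ ∈ (extChartAt (𝓡 n) c).target := mem_extChartAt_target c
  have hsz : (extChartAt (𝓡 n) c).symm z₀ = c := extChartAt_to_inv c
  have huc : u q₀ c = (extChartAt (𝓡 n) c').symm y := by rw [hc, Diffeomorph.apply_symm_apply]
  have hs : u q₀ ((extChartAt (𝓡 n) c).symm z₀) ∈ (extChartAt (𝓡 n) c').source := by
    rw [hsz, huc]
    exact (extChartAt (𝓡 n) c').map_target hy
  have hval : coordFam c c' u (q₀, z₀) = y := by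
    rw [coordFam]
    change extChartAt (𝓡 n) c' (u q₀ ((extChartAt (𝓡 n) c).symm z₀)) = y
    rw [hsz, huc, (extChartAt (𝓡 n) c').right_inv hy]
  have hU := hu.contDiffAt_coordFam hz hs
  have hUd := hU.differentiableAt (by simp)
  set D := fderiv ℝ (coordFam c c' u) (q₀, z₀) with hD
  -- the partial derivative in the space variables is injective
  have hinj : ∀ b : Vec n, D (0, b) = 0 → b = 0 := by
    intro b hb
    have h1 := hasFDerivAt_snd hUd
    have h2 : DifferentiableAt ℝ (coordMap (𝓡 n) (𝓡 n) c' c (u q₀).symm) (coordFam c c' u (q₀, z₀)) := by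
      rw [hval]
      have h3 := contDiffWithinAt_coordMap (n := ∞) (c' := c) hy ((u q₀).symm.contMDiff.contMDiffAt)
        (by rw [← hc]; exact mem_extChartAt_source c)
      rw [ModelWithCorners.range_eq_univ, contDiffWithinAt_univ] at h3
      exact h3.differentiableAt (by simp)
    have h3 := HasFDerivAt.comp z₀ h2.hasFDerivAt h1
    have h4 : (coordMap (𝓡 n) (𝓡 n) c' c (u q₀).symm ∘ fun y' => coordFam c c' u (q₀, y')) =ᶠ[𝓝 z₀]
        id := by
      have h5 : ContinuousAt (fun y' : Vec n => (q₀, y')) z₀ := by fun_prop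
      filter_upwards [h5.eventually (hu.eventually_mem_source hz hs)] with y' hy'
      rw [Function.comp_apply, coordMap_apply, coordFam, (extChartAt (𝓡 n) c').left_inv hy'.2,
        Diffeomorph.symm_apply_apply, (extChartAt (𝓡 n) c).right_inv hy'.1]
      rfl
    have h6 := (h3.congr_of_eventuallyEq h4.symm).unique (hasFDerivAt_id z₀)
    have h7 := congrArg (fun T : Vec n →L[ℝ] Vec n => T b) h6
    simp only [ContinuousLinearMap.comp_apply, ContinuousLinearMap.inr_apply,
      ContinuousLinearMap.id_apply] at h7
    rw [← h7, ← hD, hb, _root_.map_zero]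
  -- Inverse function theorem for `(q, y) ↦ (q, u_q(y))`, which retains the parameter. Its
  -- derivative is block triangular with injective space block, hence an injective endomorphism in
  -- finite dimension, hence invertible.
  let Φ : Par × Vec n → Par × Vec n := fun z => (z.1, coordFam c c' u z)
  have hΦ : ContDiffAt ℝ ∞ Φ (q₀, z₀) := contDiffAt_fst.prodMk hU
  let T : Par × Vec n →L[ℝ] Par × Vec n := (ContinuousLinearMap.fst ℝ Par (Vec n)).prod D
  have hT : HasFDerivAt Φ T (q₀, z₀) := _root_.hasFDerivAt_fst.prodMk hUd.hasFDerivAt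
  have hTinj : Function.Injective T := by
    rw [injective_iff_map_eq_zero]
    rintro ⟨a, b⟩ hab
    have h1 : a = 0 := congrArg Prod.fst hab
    have h2 : D (a, b) = 0 := congrArg Prod.snd hab
    subst h1
    rw [hinj b h2]
    rfl
  let e : (Par × Vec n) ≃L[ℝ] (Par × Vec n) :=
    (LinearEquiv.ofInjectiveEndo T.toLinearMap hTinj).toContinuousLinearEquiv
  have he : (e : Par × Vec n →L[ℝ] Par × Vec n) = T := by
    exact ContinuousLinearMap.ext fun z => rfl
  rw [← he] at hT
  have hΦ0 : Φ (q₀, z₀) = (q₀, y) := Prod.ext rfl hval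
  let g := hΦ.localInverse hT (by simp)
  have hg := hΦ.to_localInverse hT (by simp)
  have hg0 : g (q₀, y) = (q₀, z₀) := by
    rw [← hΦ0]; exact hΦ.localInverse_apply_image hT (by simp)
  have hg1 := (hΦ.hasStrictFDerivAt' hT (by simp)).eventually_right_inverse
  rw [hΦ0] at hg hg1
  have hgv : ContDiffAt ℝ ∞ (fun z => (g z).2) (q₀, y) := contDiffAt_snd.comp _ hg
  refine ⟨fun z => (g z).2, hgv, congrArg Prod.snd hg0, ?_⟩
  have hgc : Tendsto g (𝓝 (q₀, y)) (𝓝 (q₀, z₀)) := by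
    have := hg.continuousAt.tendsto
    change Tendsto g (𝓝 (q₀, y)) (𝓝 (g (q₀, y))) at this
    rwa [hg0] at this
  filter_upwards [hgc.eventually (hu.eventually_mem_source hz hs), hg1] with z h1 h2
  replace h2 : Φ (g z) = z := h2
  have h3 : (g z).1 = z.1 := (congrArg Prod.fst h2 : (Φ (g z)).1 = z.1)
  have h4 : coordFam c c' u (g z) = z.2 := (congrArg Prod.snd h2 : (Φ (g z)).2 = z.2)
  refine ⟨h1.1, h3 ▸ h1.2, ?_⟩
  rw [← h3]
  exact h4

/-- In coordinates `X_i` is `∂_i u` evaluated at the inverse family. Joint smoothness of that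
inverse is supplied by `exists_inverse`. -/
theorem SmoothDiffFamily.smoothVecFamily_logVel (hu : SmoothDiffFamily u) (i : Fin 2) :
    SmoothVecFamily (logVel u i) := by
  intro c' q₀ y hy
  obtain ⟨v, hv, hv0, hv1⟩ := hu.exists_inverse q₀ hy rfl
  set c := (u q₀).symm ((extChartAt (𝓡 n) c').symm y) with hc
  have h0 := hv1.self_of_nhds
  have h1 := contDiffAt_partial_fst (hu.contDiffAt_coordFam h0.1 h0.2.1) (basisVec i)
  have h2 : ContDiffAt ℝ ∞ (fun z : Par × Vec n => (z.1, v z)) (q₀, y) := contDiffAt_fst.prodMk hv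
  have h3 := ContDiffAt.comp (q₀, y) h1 h2
  refine h3.congr_of_eventuallyEq ?_
  filter_upwards [hv1] with z hz
  have h4 := hu.chartVec_logVel hz.2.1 i
  rw [hz.2.2] at h4
  exact h4

/-- The parameter derivative of a family of vector fields. -/
noncomputable def pdVec (i : Fin 2) (X : Par → M → Vec n) (q : Par) (x : M) : Vec n :=
  fderiv ℝ (fun q' => X q' x) q (basisVec i)

theorem hasFDerivAt_comp_pair {F : Type*} [NormedAddCommGroup F] [NormedSpace ℝ F]
    {R : Par × Vec n → F} {f : Par → Vec n} {q : Par}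
    (hR : DifferentiableAt ℝ R (q, f q)) (hf : DifferentiableAt ℝ f q) (v : Par) :
    DifferentiableAt ℝ (fun q' => R (q', f q')) q ∧
    fderiv ℝ (fun q' => R (q', f q')) q v = fderiv ℝ (fun q' => R (q', f q)) q v +
      fderiv ℝ (fun y => R (q, y)) (f q) (fderiv ℝ f q v) := by
  have h1 : HasFDerivAt (fun q' => (q', f q')) _ q := (hasFDerivAt_id q).prodMk hf.hasFDerivAt
  have h2 := HasFDerivAt.comp q hR.hasFDerivAt h1
  refine ⟨h2.differentiableAt, ?_⟩
  have h3 := congrArg (fun T : Par →L[ℝ] F => T v) h2.fderiv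
  rw [(hasFDerivAt_fst hR).fderiv, (hasFDerivAt_snd hR).fderiv]
  refine h3.trans ?_
  simp [← map_add]

/-- The Maurer-Cartan equation `∂₀X₁ - ∂₁X₀ = [X₁, X₀]` for the velocities of a family of
diffeomorphisms. -/
theorem SmoothDiffFamily.maurerCartan (hu : SmoothDiffFamily u) (q : Par) (x : M) :
    pdVec 0 (logVel u 1) q x + dVec (logVel u 1 q) x (logVel u 0 q x) =
      pdVec 1 (logVel u 0) q x + dVec (logVel u 0 q) x (logVel u 1 q x) := by
  set c := (u q).symm x with hc
  set z₀ := extChartAt (𝓡 n) c c with hz₀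
  have hz : z₀ ∈ (extChartAt (𝓡 n) c).target := mem_extChartAt_target c
  have hsz : (extChartAt (𝓡 n) c).symm z₀ = c := extChartAt_to_inv c
  have huc : u q c = x := by rw [hc, Diffeomorph.apply_symm_apply]
  have hs : u q ((extChartAt (𝓡 n) c).symm z₀) ∈ (extChartAt (𝓡 n) x).source := by
    rw [hsz, huc]; exact mem_extChartAt_source x
  have hval : coordFam c x u (q, z₀) = extChartAt (𝓡 n) x x := by
    change extChartAt (𝓡 n) x (u q ((extChartAt (𝓡 n) c).symm z₀)) = _
    rw [hsz, huc]
  have hU := hu.contDiffAt_coordFam hz hs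
  have hq : ContDiffAt ℝ ∞ (fun q' : Par => (q', z₀)) q := by fun_prop
  have hf : ContDiffAt ℝ ∞ (fun q' => coordFam c x u (q', z₀)) q :=
    ContDiffAt.comp (g := coordFam c x u) q hU hq
  -- Differentiate `X_j(q', u_{q'}(c)) = ∂_j u_{q'}(c)` in the direction `i`. The chain rule gives
  -- `∂_i X_j + dX_j(X_i)` on the left and a second derivative of `u` on the right, which is
  -- symmetric in `i` and `j`.
  have key : ∀ i j : Fin 2, pdVec i (logVel u j) q x + dVec (logVel u j q) x (logVel u i q x) =
      fderiv ℝ (fderiv ℝ (fun q' => coordFam c x u (q', z₀))) q (basisVec i) (basisVec j) := by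
    intro i j
    have hY := hu.smoothVecFamily_logVel j x q _ (mem_extChartAt_target x)
    have h1 := (hasFDerivAt_comp_pair (R := fun z : Par × Vec n => chartVec x (logVel u j z.1) z.2)
      (f := fun q' => coordFam c x u (q', z₀)) (q := q)
      (by rw [hval]; exact hY.differentiableAt (by simp)) (hf.differentiableAt (by simp))
      (basisVec i)).2
    have h2 : (fun q' => chartVec x (logVel u j q') (coordFam c x u (q', z₀))) =ᶠ[𝓝 q]
        fun q' => fderiv ℝ (fun q'' => coordFam c x u (q'', z₀)) q' (basisVec j) := by
      filter_upwards [hq.continuousAt.eventually (hu.eventually_mem_source hz hs)] with q' hq'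
      exact hu.chartVec_logVel hq'.2 j
    rw [h2.fderiv_eq] at h1
    have h3 := ((hf.fderiv_right (m := ∞) (by simp)).differentiableAt (by simp)).hasFDerivAt.clm_apply
      (hasFDerivAt_const (basisVec j : Par) q)
    have h4 := congrArg (fun T : Par →L[ℝ] Vec n => T (basisVec i)) h3.fderiv
    simp only [ContinuousLinearMap.comp_zero, zero_add, ContinuousLinearMap.flip_apply] at h4
    have h5 := hu.chartVec_logVel hs i
    rw [hval, chartVec_center] at h5
    rw [← h5, hval] at h1
    refine Eq.trans ?_ (h1.symm.trans h4)
    congr 1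
    rw [pdVec]
    congr 2
    funext q'
    exact (chartVec_center x _).symm
  rw [key, key]
  exact (hf.isSymmSndFDerivAt minSmoothness_two_le).eq _ _

/-! ### Pullback of families of forms -/

variable {F : Type*} [NormedAddCommGroup F] [NormedSpace ℝ F] [FiniteDimensional ℝ F]
  {η : Par → M → Vec n [⋀^Fin k]→L[ℝ] F}

theorem chartRep_pullForm_diffeo (hy : y ∈ (extChartAt (𝓡 n) c).target)
    (hc : u q ((extChartAt (𝓡 n) c).symm y) ∈ (extChartAt (𝓡 n) c').source)
    (ζ : M → Vec n [⋀^Fin k]→L[ℝ] F) :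
    chartRep (𝓡 n) c (pullForm (𝓡 n) (𝓡 n) (u q) ζ) y =
      (chartRep (𝓡 n) c' ζ (coordFam c c' u (q, y))).compContinuousLinearMap
        (fderiv ℝ (fun y' => coordFam c c' u (q, y')) y) := by
  have h := chartRep_pullForm (I := 𝓡 n) (I' := 𝓡 n) (f := u q) hy
    ((u q).contMDiff.mdifferentiable (by simp) _) hc ζ
  rw [h, ModelWithCorners.range_eq_univ, fderivWithin_univ]
  rfl

theorem SmoothFormFamily.pullForm (hη : SmoothFormFamily (𝓡 n) η) (hu : SmoothDiffFamily u) :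
    SmoothFormFamily (𝓡 n) (fun q => pullForm (𝓡 n) (𝓡 n) (u q) (η q)) := by
  refine smoothFormFamily_iff.2 fun c q y hy => ?_
  set c' := u q ((extChartAt (𝓡 n) c).symm y) with hc'
  have hc : u q ((extChartAt (𝓡 n) c).symm y) ∈ (extChartAt (𝓡 n) c').source :=
    mem_extChartAt_source _
  have hU := hu.contDiffAt_coordFam hy hc
  have hR := smoothFormFamily_iff.1 hη c' q (coordFam c c' u (q, y))
    ((extChartAt (𝓡 n) c').map_source hc)
  have h2 : ContDiffAt ℝ ∞ (fun z : Par × Vec n => (z.1, coordFam c c' u z)) (q, y) :=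
    contDiffAt_fst.prodMk hU
  have h3 := ContDiffAt.comp (q, y) hR h2
  have h4 := contDiffWithinAt_compContinuousLinearMap (s := univ) h3.contDiffWithinAt
    (contDiffAt_partial_snd hU).contDiffWithinAt
  rw [contDiffWithinAt_univ] at h4
  refine h4.congr_of_eventuallyEq ?_
  filter_upwards [hu.eventually_mem_source hy hc] with z hz
  exact chartRep_pullForm_diffeo hz.1 hz.2 _

/-- Cartan's formula for families: `∂_i (u^* η) = u^* (∂_i η + 𝔏_{X_i} η)`. -/
theorem pd_pullForm (hη : SmoothFormFamily (𝓡 n) η) (hu : SmoothDiffFamily u) (i : Fin 2) (q : Par) :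
    pd i (fun q => pullForm (𝓡 n) (𝓡 n) (u q) (η q)) q =
      pullForm (𝓡 n) (𝓡 n) (u q) (pd i η q + lieD (𝓡 n) (logVel u i q) (η q)) := by
  funext c
  set x := u q c with hx
  set z₀ := extChartAt (𝓡 n) c c with hz₀
  have hz : z₀ ∈ (extChartAt (𝓡 n) c).target := mem_extChartAt_target c
  have hsz : (extChartAt (𝓡 n) c).symm z₀ = c := extChartAt_to_inv c
  have hs : u q ((extChartAt (𝓡 n) c).symm z₀) ∈ (extChartAt (𝓡 n) x).source := by
    rw [hsz]; exact mem_extChartAt_source x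
  have hval : coordFam c x u (q, z₀) = extChartAt (𝓡 n) x x := by
    change extChartAt (𝓡 n) x (u q ((extChartAt (𝓡 n) c).symm z₀)) = _
    rw [hsz]
  have hU := hu.contDiffAt_coordFam hz hs
  have hq : ContDiffAt ℝ ∞ (fun q' : Par => (q', z₀)) q := by fun_prop
  have hf : DifferentiableAt ℝ (fun q' => coordFam c x u (q', z₀)) q :=
    (ContDiffAt.comp (g := coordFam c x u) q hU hq).differentiableAt (by simp)
  have hX := hu.smoothVecFamily_logVel i
  -- the factors
  obtain ⟨h1, h2⟩ := hasFDerivAt_comp_pair (R := fun z : Par × Vec n => chartRep (𝓡 n) x (η z.1) z.2)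
    (f := fun q' => coordFam c x u (q', z₀)) (q := q)
    (by
      rw [hval]
      exact (smoothFormFamily_iff.1 hη x q _ (mem_extChartAt_target x)).differentiableAt (by simp))
    hf (basisVec i)
  obtain ⟨h3, h4⟩ := fderiv_fst_fderiv_snd hU (basisVec i)
  have hvel := hu.chartVec_logVel hs i
  rw [hval, chartVec_center] at hvel
  rw [← hvel, hval] at h2
  set g : Vec n →L[ℝ] Vec n := fderiv ℝ (fun y' => coordFam c x u (q, y')) z₀ with hg
  -- The parameter derivative of the Jacobian is the space derivative of the velocity. Since the
  -- velocity is `X_i ∘ u`, the chain rule makes it `dX_i` composed with the Jacobian.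
  have h5 : fderiv ℝ (fun y' => fderiv ℝ (fun q' => coordFam c x u (q', y')) q (basisVec i)) z₀ =
      (dVec (logVel u i q) x).comp g := by
    have h6 : (fun y' => fderiv ℝ (fun q' => coordFam c x u (q', y')) q (basisVec i)) =ᶠ[𝓝 z₀]
        fun y' => chartVec x (logVel u i q) (coordFam c x u (q, y')) := by
      have h7 : ContinuousAt (fun y' : Vec n => (q, y')) z₀ := by fun_prop
      filter_upwards [h7.eventually (hu.eventually_mem_source hz hs)] with y' hy'
      exact (hu.chartVec_logVel hy'.2 i).symm
    rw [h6.fderiv_eq]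
    have h8 : DifferentiableAt ℝ (chartVec x (logVel u i q)) (coordFam c x u (q, z₀)) := by
      rw [hval]
      exact (hX.slice q x _ (mem_extChartAt_target x)).differentiableAt (by simp)
    have h9 := HasFDerivAt.comp z₀ h8.hasFDerivAt
      (hasFDerivAt_snd (hU.differentiableAt (by simp))).differentiableAt.hasFDerivAt
    rw [hval] at h9
    exact h9.fderiv
  rw [h5] at h4
  have h10 := h1.hasFDerivAt.continuousAlternatingMapCompContinuousLinearMap h3.hasFDerivAt
  -- For parameters near `q` the image of `c` stays in the single chart centred at `u q c`, so the
  -- whole family can be differentiated in that chart.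
  have h11 : (fun q' => pullForm (𝓡 n) (𝓡 n) (u q') (η q') c) =ᶠ[𝓝 q] fun q' =>
      (chartRep (𝓡 n) x (η q') (coordFam c x u (q', z₀))).compContinuousLinearMap
        (fderiv ℝ (fun y' => coordFam c x u (q', y')) z₀) := by
    filter_upwards [hq.continuousAt.eventually (hu.eventually_mem_source hz hs)] with q' hq'
    rw [← chartRep_pullForm_diffeo hq'.1 hq'.2, chartRep_center]
  -- Product rule. The first term differentiates the form, explicitly and along `X_i`; the second
  -- differentiates the Jacobian. By `lieD_eq` the two terms containing `X_i` form the Lie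
  -- derivative.
  have h12 : pd i (fun q => pullForm (𝓡 n) (𝓡 n) (u q) (η q)) q c =
      (CovPhase.pd i η q x + dAt (η q) x (logVel u i q x)).compContinuousLinearMap g +
      ((η q x).fderivCompContinuousLinearMap (ContinuousLinearMap.id ℝ (Vec n))
        (dVec (logVel u i q) x)).compContinuousLinearMap g := by
    rw [← fderivComp_mul, ← h4, CovPhase.pd, h11.fderiv_eq, h10.fderiv]
    have h13 : chartRep (𝓡 n) x (η q) (coordFam c x u (q, z₀)) = η q x := by
      rw [hval, chartRep_center]
    have h14 : fderiv ℝ (fun q' => chartRep (𝓡 n) x (η q') (extChartAt (𝓡 n) x x)) q (basisVec i) =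
        CovPhase.pd i η q x := by
      rw [CovPhase.pd]
      congr 2
      funext q'
      exact chartRep_center x _
    rw [h14] at h2
    have h15 : fderiv ℝ (fun q' => chartRep (𝓡 n) x (η q') (coordFam c x u (q', z₀))) q
        (basisVec i) = CovPhase.pd i η q x + dAt (η q) x (logVel u i q x) := h2
    rw [← h15, ← h13]
    rfl
  rw [h12, CovPhase.pullForm]
  have h16 := chartRep_center (I := 𝓡 n) c (CovPhase.pullForm (𝓡 n) (𝓡 n) (u q)
    (CovPhase.pd i η q + CovPhase.lieD (𝓡 n) (logVel u i q) (η q)))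
  rw [← hz₀, chartRep_pullForm_diffeo hz hs, hval, chartRep_center, ← hg, Pi.add_apply,
    lieD_eq (hX.slice q) (hη.slice q)] at h16
  refine Eq.trans ?_ h16
  ext v
  simp only [compContinuousLinearMap_apply, ContinuousAlternatingMap.add_apply]
  abel

end Diffeo

/-! ### Coefficients of linear functionals depend linearly on the functional -/

section CoeffLin

variable {n k : ℕ} {W : Type*} [NormedAddCommGroup W] [NormedSpace ℝ W]

/-- `coeff0` as a linear map. -/
noncomputable def coeff0Lin (n k : ℕ) (W : Type*) [NormedAddCommGroup W] [NormedSpace ℝ W] :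
    ((Vec n [⋀^Fin 0]→L[ℝ] W) →L[ℝ] (Vec n [⋀^Fin k]→L[ℝ] ℝ)) →ₗ[ℝ]
      (Vec n [⋀^Fin k]→L[ℝ] (W →L[ℝ] ℝ)) where
  toFun := coeff0
  map_add' T T' := by
    ext v c
    rfl
  map_smul' r T := by
    ext v c
    rfl

/-- `coeff1` as a linear map. -/
noncomputable def coeff1Lin (n k : ℕ) (W : Type*) [NormedAddCommGroup W] [NormedSpace ℝ W] :
    ((Vec n [⋀^Fin 1]→L[ℝ] W) →L[ℝ] (Vec n [⋀^Fin (k + 1)]→L[ℝ] ℝ)) →ₗ[ℝ]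
      (Vec n [⋀^Fin k]→L[ℝ] (W →L[ℝ] ℝ)) where
  toFun := coeff1
  map_add' T T' := by
    ext v c
    simp [coeff1, Finset.sum_add_distrib]
  map_smul' r T := by
    ext v c
    simp [coeff1, Finset.mul_sum]

/-- `coeff2` as a linear map. -/
noncomputable def coeff2Lin (n k : ℕ) (W : Type*) [NormedAddCommGroup W] [NormedSpace ℝ W] :
    ((Vec n [⋀^Fin 2]→L[ℝ] W) →L[ℝ] (Vec n [⋀^Fin (k + 2)]→L[ℝ] ℝ)) →ₗ[ℝ]
      (Vec n [⋀^Fin k]→L[ℝ] (W →L[ℝ] ℝ)) where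
  toFun := coeff2
  map_add' T T' := by
    ext v c
    simp [coeff2, Finset.sum_add_distrib]
  map_smul' r T := by
    ext v c
    simp [coeff2, Finset.mul_sum, mul_left_comm]

end CoeffLin

section Jets

variable {m : ℕ} {W V : Type*} [NormedAddCommGroup W] [NormedSpace ℝ W] [FiniteDimensional ℝ W]
    [NormedAddCommGroup V] [NormedSpace ℝ V] [FiniteDimensional ℝ V]
  {M : Type*} [TopologicalSpace M] [ChartedSpace (Vec (m + 2)) M] [IsManifold (𝓡 (m + 2)) ∞ M]
  {N : Type*} [TopologicalSpace N] [ChartedSpace (Vec (m + 2)) N] [IsManifold (𝓡 (m + 2)) ∞ N]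
  (L : Lagrangian m W V)

/-! ### Covariant functions of jets -/

/-- A smooth function of jets with values in covectors, natural under changes of frame. -/
structure Lagrangian.Covariant {k : ℕ} {G : Type*} [NormedAddCommGroup G] [NormedSpace ℝ G]
    (μ : Jet m W V → Vec (m + 2) [⋀^Fin k]→L[ℝ] G) : Prop where
  contDiffAt : ∀ J ∈ L.dom, ContDiffAt ℝ ∞ μ J
  pull : ∀ g : Vec (m + 2) ≃L[ℝ] Vec (m + 2), ∀ J ∈ L.dom,
    μ (Jet.pull g J) = (μ J).compContinuousLinearMap g

theorem Lagrangian.covariant_density : L.Covariant L.density :=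
  ⟨fun _ hJ => L.contDiffAt_density hJ, L.natural⟩

theorem Lagrangian.contDiffAt_fderiv_comp {J : Jet m W V} (hJ : J ∈ L.dom) {E : Type*}
    [NormedAddCommGroup E] [NormedSpace ℝ E] (T : E →L[ℝ] Jet m W V) :
    ContDiffAt ℝ ∞ (fun J => (fderiv ℝ L.density J).comp T) J :=
  ((L.contDiffAt_density hJ).fderiv_right (m := ∞) (by simp)).clm_comp contDiffAt_const

theorem contDiffAt_linear {E F G : Type*} [NormedAddCommGroup E] [NormedSpace ℝ E]
    [FiniteDimensional ℝ E] [NormedAddCommGroup F] [NormedSpace ℝ F] [NormedAddCommGroup G]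
    [NormedSpace ℝ G] {f : G → E} {x : G} {n : WithTop ℕ∞} (T : E →ₗ[ℝ] F)
    (hf : ContDiffAt ℝ n f x) : ContDiffAt ℝ n (fun y => T (f y)) x :=
  (LinearMap.toContinuousLinearMap T).contDiff.contDiffAt.comp x hf

theorem Lagrangian.covariant_partA : L.Covariant (fun J => coeff1 (L.partA J)) where
  contDiffAt J hJ := by
    have h : ContDiffAt ℝ ∞ L.partA J := L.contDiffAt_fderiv_comp hJ _
    exact contDiffAt_linear
      (E := (Vec (m + 2) [⋀^Fin 1]→L[ℝ] W) →L[ℝ] (Vec (m + 2) [⋀^Fin (m + 2)]→L[ℝ] ℝ))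
      (F := Vec (m + 2) [⋀^Fin (m + 1)]→L[ℝ] (W →L[ℝ] ℝ)) (coeff1Lin (m + 2) (m + 1) W) h
  pull g _ hJ := coeff1_natural g (L.partA_pull g hJ)

theorem Lagrangian.covariant_partPhi : L.Covariant (fun J => coeff0 (L.partPhi J)) where
  contDiffAt J hJ := by
    have h : ContDiffAt ℝ ∞ L.partPhi J := L.contDiffAt_fderiv_comp hJ _
    exact contDiffAt_linear
      (E := (Vec (m + 2) [⋀^Fin 0]→L[ℝ] V) →L[ℝ] (Vec (m + 2) [⋀^Fin (m + 2)]→L[ℝ] ℝ))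
      (F := Vec (m + 2) [⋀^Fin (m + 2)]→L[ℝ] (V →L[ℝ] ℝ)) (coeff0Lin (m + 2) (m + 2) V) h
  pull g _ hJ := coeff0_natural g (L.partPhi_pull g hJ)

theorem Lagrangian.covariant_partDA : L.Covariant (fun J => coeff2 (L.partDA J)) where
  contDiffAt J hJ := by
    have h : ContDiffAt ℝ ∞ L.partDA J := L.contDiffAt_fderiv_comp hJ _
    exact contDiffAt_linear
      (E := (Vec (m + 2) [⋀^Fin 2]→L[ℝ] W) →L[ℝ] (Vec (m + 2) [⋀^Fin (m + 2)]→L[ℝ] ℝ))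
      (F := Vec (m + 2) [⋀^Fin m]→L[ℝ] (W →L[ℝ] ℝ)) (coeff2Lin (m + 2) m W) h
  pull g _ hJ := coeff2_natural g (L.partDA_pull g hJ)

theorem Lagrangian.covariant_partDPhi : L.Covariant (fun J => coeff1 (L.partDPhi J)) where
  contDiffAt J hJ := by
    have h : ContDiffAt ℝ ∞ L.partDPhi J := L.contDiffAt_fderiv_comp hJ _
    exact contDiffAt_linear
      (E := (Vec (m + 2) [⋀^Fin 1]→L[ℝ] V) →L[ℝ] (Vec (m + 2) [⋀^Fin (m + 2)]→L[ℝ] ℝ))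
      (F := Vec (m + 2) [⋀^Fin (m + 1)]→L[ℝ] (V →L[ℝ] ℝ)) (coeff1Lin (m + 2) (m + 1) V) h
  pull g _ hJ := coeff1_natural g (L.partDPhi_pull g hJ)

/-- The derivative of the inverse chart as an equivalence. -/
theorem exists_chart_equiv {n : ℕ} {M : Type*} [TopologicalSpace M] [ChartedSpace (Vec n) M]
    [IsManifold (𝓡 n) ∞ M] {c : M} {y : Vec n} (hy : y ∈ (extChartAt (𝓡 n) c).target) :
    ∃ g : Vec n ≃L[ℝ] Vec n, (g : Vec n →L[ℝ] Vec n) =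
      (mfderivWithin 𝓘(ℝ, Vec n) (𝓡 n) (extChartAt (𝓡 n) c).symm (range (𝓡 n)) y :
        Vec n →L[ℝ] Vec n) := by
  have h1 := mfderivWithin_extChartAt_symm_comp_mfderiv_extChartAt hy
  have h2 := mfderiv_extChartAt_comp_mfderivWithin_extChartAt_symm hy
  refine ⟨ContinuousLinearEquiv.equivOfInverse
    (mfderivWithin 𝓘(ℝ, Vec n) (𝓡 n) (extChartAt (𝓡 n) c).symm (range (𝓡 n)) y :
      Vec n →L[ℝ] Vec n)
    (mfderiv (𝓡 n) 𝓘(ℝ, Vec n) (extChartAt (𝓡 n) c) ((extChartAt (𝓡 n) c).symm y) :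
      Vec n →L[ℝ] Vec n) (fun v => ?_) (fun v => ?_), ?_⟩
  · exact congrArg (fun T : Vec n →L[ℝ] Vec n => T v) h2
  · exact congrArg (fun T : Vec n →L[ℝ] Vec n => T v) h1
  · rfl

/-- The coordinate expression of a jet. -/
noncomputable def jetRep (c : M) (φ : Fields m W V M) (y : Vec (m + 2)) : Jet m W V :=
  (chartRep (𝓡 (m + 2)) c φ.1 y, chartRep (𝓡 (m + 2)) c φ.2 y,
    chartRep (𝓡 (m + 2)) c (extD (𝓡 (m + 2)) φ.1) y,
    chartRep (𝓡 (m + 2)) c (extD (𝓡 (m + 2)) φ.2) y)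

section
variable {L} {k : ℕ} {G : Type*} [NormedAddCommGroup G] [NormedSpace ℝ G] [FiniteDimensional ℝ G]
  {μ : Jet m W V → Vec (m + 2) [⋀^Fin k]→L[ℝ] G}

/-- The coordinate jet is the intrinsic jet transformed by the derivative of the inverse chart, a
change of frame. Naturality lets `μ` be evaluated in coordinates, where its smoothness can be used.
-/
theorem Lagrangian.Covariant.chartRep (hμ : L.Covariant μ) {φ : Fields m W V M} {c : M}
    {y : Vec (m + 2)} (hy : y ∈ (extChartAt (𝓡 (m + 2)) c).target)
    (hφ : jet φ ((extChartAt (𝓡 (m + 2)) c).symm y) ∈ L.dom) :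
    jetRep c φ y ∈ L.dom ∧
    chartRep (𝓡 (m + 2)) c (fun x => μ (jet φ x)) y = μ (jetRep c φ y) := by
  obtain ⟨g, hg⟩ := exists_chart_equiv hy
  have h : jetRep c φ y = Jet.pull g (jet φ ((extChartAt (𝓡 (m + 2)) c).symm y)) := by
    unfold jetRep Jet.pull CovPhase.chartRep
    rw [hg]
    rfl
  rw [h]
  refine ⟨L.pull_mem g _ hφ, ?_⟩
  rw [hμ.pull g _ hφ, hg]
  rfl

end

/-- A smooth family of fields in the domain of the Lagrangian. -/
structure Lagrangian.AdmissibleFamily (p : Par → Fields m W V M) : Prop where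
  smoothA : SmoothFormFamily (𝓡 (m + 2)) (fun q => (p q).1)
  smoothPhi : SmoothFormFamily (𝓡 (m + 2)) (fun q => (p q).2)
  jet_mem : ∀ q x, jet (p q) x ∈ L.dom

variable {L} {p : Par → Fields m W V M}

theorem Lagrangian.Covariant.smoothFormFamily {k : ℕ} {G : Type*} [NormedAddCommGroup G]
    [NormedSpace ℝ G] [FiniteDimensional ℝ G] {μ : Jet m W V → Vec (m + 2) [⋀^Fin k]→L[ℝ] G}
    (hμ : L.Covariant μ) (hp : L.AdmissibleFamily p) :
    SmoothFormFamily (𝓡 (m + 2)) (fun q x => μ (jet (p q) x)) := by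
  refine smoothFormFamily_iff.2 fun c q y hy => ?_
  have h1 : ContDiffAt ℝ ∞ (fun z : Par × Vec (m + 2) => jetRep c (p z.1) z.2) (q, y) :=
    (smoothFormFamily_iff.1 hp.smoothA c q y hy).prodMk
      ((smoothFormFamily_iff.1 hp.smoothPhi c q y hy).prodMk
        ((smoothFormFamily_iff.1 hp.smoothA.extD c q y hy).prodMk
          (smoothFormFamily_iff.1 hp.smoothPhi.extD c q y hy)))
  have h2 := hμ.contDiffAt _ (hμ.chartRep (φ := p q) hy (hp.jet_mem q _)).1
  have h3 := ContDiffAt.comp (q, y) h2 h1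
  refine h3.congr_of_eventuallyEq ?_
  filter_upwards [eventually_snd_mem_target hy] with z hz
  exact (hμ.chartRep hz (hp.jet_mem _ _)).2

theorem extD_pullForm_diffeo {n k : ℕ} {F : Type*} [NormedAddCommGroup F] [NormedSpace ℝ F]
    {M : Type*} [TopologicalSpace M] [ChartedSpace (Vec n) M] [IsManifold (𝓡 n) ∞ M]
    {N : Type*} [TopologicalSpace N] [ChartedSpace (Vec n) N] [IsManifold (𝓡 n) ∞ N]
    (u : N ≃ₘ^∞⟮𝓡 n, 𝓡 n⟯ M) {η : M → Vec n [⋀^Fin k]→L[ℝ] F} (hη : SmoothForm (𝓡 n) η) (y : N) :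
    extD (𝓡 n) (pullForm (𝓡 n) (𝓡 n) u η) y = pullForm (𝓡 n) (𝓡 n) u (extD (𝓡 n) η) y := by
  have h2 : (2 : WithTop ℕ∞) ≤ ∞ := WithTop.coe_le_coe.2 (le_top : (2 : ℕ∞) ≤ ⊤)
  have : IsManifold (𝓡 n) 2 M := IsManifold.of_le h2
  have : IsManifold (𝓡 n) 2 N := IsManifold.of_le h2
  exact extD_pullForm (u.contMDiff.contMDiffAt.of_le h2)
    (hη.differentiableWithinAt (mem_extChartAt_target _))

/-- The jet of a pulled back field. -/
theorem jet_pullFields {φ : Fields m W V M} (h1 : SmoothForm (𝓡 (m + 2)) φ.1)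
    (h2 : SmoothForm (𝓡 (m + 2)) φ.2) (u : N ≃ₘ^∞⟮𝓡 (m + 2), 𝓡 (m + 2)⟯ M) (y : N) :
    ∃ g : Vec (m + 2) ≃L[ℝ] Vec (m + 2), (g : Vec (m + 2) →L[ℝ] Vec (m + 2)) =
        (mfderiv (𝓡 (m + 2)) (𝓡 (m + 2)) u y : Vec (m + 2) →L[ℝ] Vec (m + 2)) ∧
      jet (pullFields u φ) y = Jet.pull g (jet φ (u y)) := by
  refine ⟨u.mfderivToContinuousLinearEquiv (by simp) y, rfl, ?_⟩
  have h3 := extD_pullForm_diffeo u h1 y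
  have h4 := extD_pullForm_diffeo u h2 y
  unfold jet
  simp only [pullFields]
  rw [h3, h4]
  rfl

theorem Lagrangian.Covariant.pullFields {k : ℕ} {G : Type*} [NormedAddCommGroup G]
    [NormedSpace ℝ G] {μ : Jet m W V → Vec (m + 2) [⋀^Fin k]→L[ℝ] G}
    (hμ : L.Covariant μ) {φ : Fields m W V M} (h1 : SmoothForm (𝓡 (m + 2)) φ.1)
    (h2 : SmoothForm (𝓡 (m + 2)) φ.2) (hφ : ∀ x, jet φ x ∈ L.dom)
    (u : N ≃ₘ^∞⟮𝓡 (m + 2), 𝓡 (m + 2)⟯ M) (y : N) :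
    μ (jet (pullFields u φ) y) = pullForm (𝓡 (m + 2)) (𝓡 (m + 2)) u (fun x => μ (jet φ x)) y := by
  obtain ⟨g, hg, hj⟩ := jet_pullFields h1 h2 u y
  rw [hj, hμ.pull g _ (hφ _), hg]
  rfl

/-- The pulled back family is admissible. -/
theorem Lagrangian.AdmissibleFamily.pullFields (hp : L.AdmissibleFamily p)
    {u : Par → (N ≃ₘ^∞⟮𝓡 (m + 2), 𝓡 (m + 2)⟯ M)} (hu : SmoothDiffFamily u) :
    L.AdmissibleFamily (fun q => pullFields (u q) (p q)) where
  smoothA := hp.smoothA.pullForm hu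
  smoothPhi := hp.smoothPhi.pullForm hu
  jet_mem q y := by
    obtain ⟨g, -, hj⟩ := jet_pullFields (hp.smoothA.slice q) (hp.smoothPhi.slice q) (u q) y
    rw [hj]
    exact L.pull_mem g _ (hp.jet_mem _ _)

/-! ### The presymplectic potential -/

theorem wedgeOne_add_left {n k : ℕ} (a b : Vec n [⋀^Fin 1]→L[ℝ] W)
    (P : Vec n [⋀^Fin k]→L[ℝ] (W →L[ℝ] ℝ)) : wedgeOne (a + b) P = wedgeOne a P + wedgeOne b P := by
  rw [← wedgeBil_apply, map_add, LinearMap.add_apply]; rfl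

theorem wedgeOne_add_right {n k : ℕ} (a : Vec n [⋀^Fin 1]→L[ℝ] W)
    (P Q : Vec n [⋀^Fin k]→L[ℝ] (W →L[ℝ] ℝ)) : wedgeOne a (P + Q) = wedgeOne a P + wedgeOne a Q := by
  rw [← wedgeBil_apply, map_add]; rfl

theorem pairZero_add_left {n k : ℕ} (a b : W)
    (P : Vec n [⋀^Fin k]→L[ℝ] (W →L[ℝ] ℝ)) : pairZero (a + b) P = pairZero a P + pairZero b P := by
  rw [← pairBil_apply, map_add, LinearMap.add_apply]; rfl

theorem pairZero_add_right {n k : ℕ} (a : W)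
    (P Q : Vec n [⋀^Fin k]→L[ℝ] (W →L[ℝ] ℝ)) : pairZero a (P + Q) = pairZero a P + pairZero a Q := by
  rw [← pairBil_apply, map_add]; rfl

theorem pairZero_sub_right {n k : ℕ} (a : W)
    (P Q : Vec n [⋀^Fin k]→L[ℝ] (W →L[ℝ] ℝ)) : pairZero a (P - Q) = pairZero a P - pairZero a Q := by
  ext v; simp [pairZero_apply]

theorem Lagrangian.theta_add (φ δ δ' : Fields m W V M) :
    L.theta φ (δ + δ') = L.theta φ δ + L.theta φ δ' := by
  funext x
  simp only [Lagrangian.theta, Pi.add_apply, Prod.fst_add, Prod.snd_add,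
    ContinuousAlternatingMap.add_apply, wedgeOne_add_left, pairZero_add_left]
  abel

/-- Covariance of the presymplectic potential. -/
theorem Lagrangian.theta_pullFields {φ : Fields m W V M} (h1 : SmoothForm (𝓡 (m + 2)) φ.1)
    (h2 : SmoothForm (𝓡 (m + 2)) φ.2) (hφ : ∀ x, jet φ x ∈ L.dom) (δ : Fields m W V M)
    (u : N ≃ₘ^∞⟮𝓡 (m + 2), 𝓡 (m + 2)⟯ M) :
    L.theta (CovPhase.pullFields u φ) (CovPhase.pullFields u δ) =
      pullForm (𝓡 (m + 2)) (𝓡 (m + 2)) u (L.theta φ δ) := by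
  funext y
  have h3 := L.covariant_partDA.pullFields h1 h2 hφ u y
  have h4 := L.covariant_partDPhi.pullFields h1 h2 hφ u y
  have h5 : (CovPhase.pullFields u δ).2 y 0 = δ.2 (u y) 0 :=
    congrArg (δ.2 (u y)) (Subsingleton.elim (α := Fin 0 → Vec (m + 2)) _ _)
  have h6 : L.momDA (CovPhase.pullFields u φ) y = _ := h3
  have h7 : L.momDPhi (CovPhase.pullFields u φ) y = _ := h4
  rw [Lagrangian.theta, h5, h6, h7]
  exact congrArg₂ (· + ·)
    (wedgeOne_comp (δ.1 (u y)) (L.momDA φ (u y))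
      (mfderiv (𝓡 (m + 2)) (𝓡 (m + 2)) u y : Vec (m + 2) →L[ℝ] Vec (m + 2))).symm
    (pairZero_comp (δ.2 (u y) 0) (L.momDPhi φ (u y))
      (mfderiv (𝓡 (m + 2)) (𝓡 (m + 2)) u y : Vec (m + 2) →L[ℝ] Vec (m + 2))).symm

end Jets

theorem pd_comm {n k : ℕ} {F : Type*} [NormedAddCommGroup F] [NormedSpace ℝ F]
    {M : Type*} [TopologicalSpace M] [ChartedSpace (Vec n) M] [IsManifold (𝓡 n) ∞ M]
    {η : Par → M → Vec n [⋀^Fin k]→L[ℝ] F} (hη : SmoothFormFamily (𝓡 n) η) (q : Par) (x : M) :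
    pd 0 (pd 1 η) q x = pd 1 (pd 0 η) q x := by
  have h := hη.contDiffAt_param q x
  have h1 := ((h.fderiv_right (m := ∞) (by simp)).differentiableAt (by simp)).hasFDerivAt
  have h2 : ∀ i j, pd i (pd j η) q x =
      fderiv ℝ (fderiv ℝ fun q' => η q' x) q (basisVec i) (basisVec j) := by
    intro i j
    have h3 := congrArg (fun T : Par →L[ℝ] _ => T (basisVec i))
      (h1.clm_apply (hasFDerivAt_const (basisVec j : Par) q)).fderiv
    simp only [ContinuousLinearMap.comp_zero, zero_add, ContinuousLinearMap.flip_apply] at h3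
    exact h3
  rw [h2, h2]
  exact (h.isSymmSndFDerivAt minSmoothness_two_le).eq _ _

/-! ### Noether identity, variation of the Lagrangian, presymplectic current -/

section Currents

variable {m : ℕ} {W V : Type*} [NormedAddCommGroup W] [NormedSpace ℝ W] [FiniteDimensional ℝ W]
    [NormedAddCommGroup V] [NormedSpace ℝ V] [FiniteDimensional ℝ V]
  {M : Type*} [TopologicalSpace M] [ChartedSpace (Vec (m + 2)) M] [IsManifold (𝓡 (m + 2)) ∞ M]
  {N : Type*} [TopologicalSpace N] [ChartedSpace (Vec (m + 2)) N] [IsManifold (𝓡 (m + 2)) ∞ N]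
  {L : Lagrangian m W V} {p : Par → Fields m W V M}

namespace Lagrangian.AdmissibleFamily

variable (hp : L.AdmissibleFamily p)
include hp

theorem smooth_form : SmoothFormFamily (𝓡 (m + 2)) (fun q => L.form (p q)) :=
  L.covariant_density.smoothFormFamily hp

theorem smooth_momA : SmoothFormFamily (𝓡 (m + 2)) (fun q => L.momA (p q)) :=
  L.covariant_partA.smoothFormFamily hp

theorem smooth_momPhi : SmoothFormFamily (𝓡 (m + 2)) (fun q => L.momPhi (p q)) :=
  L.covariant_partPhi.smoothFormFamily hp

theorem smooth_momDA : SmoothFormFamily (𝓡 (m + 2)) (fun q => L.momDA (p q)) :=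
  L.covariant_partDA.smoothFormFamily hp

theorem smooth_momDPhi : SmoothFormFamily (𝓡 (m + 2)) (fun q => L.momDPhi (p q)) :=
  L.covariant_partDPhi.smoothFormFamily hp

theorem smooth_eulerA : SmoothFormFamily (𝓡 (m + 2)) (fun q => L.eulerA (p q)) :=
  hp.smooth_momA.add hp.smooth_momDA.extD

theorem smooth_eulerPhi : SmoothFormFamily (𝓡 (m + 2)) (fun q => L.eulerPhi (p q)) :=
  hp.smooth_momPhi.sub hp.smooth_momDPhi.extD

variable {δ : Par → Fields m W V M} (h1 : SmoothFormFamily (𝓡 (m + 2)) (fun q => (δ q).1))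
  (h2 : SmoothFormFamily (𝓡 (m + 2)) (fun q => (δ q).2))

include h1 h2 in
theorem smooth_theta : SmoothFormFamily (𝓡 (m + 2)) (fun q => L.theta (p q) (δ q)) :=
  (h1.wedgeOne hp.smooth_momDA).add (h2.pairZero hp.smooth_momDPhi)

include h1 h2 in
theorem smooth_E : SmoothFormFamily (𝓡 (m + 2)) (fun q => L.E (p q) (δ q)) :=
  (h1.wedgeOne hp.smooth_eulerA).add (h2.pairZero hp.smooth_eulerPhi)

variable {X : Par → M → Vec (m + 2)} (hX : SmoothVecFamily X)

include hX in
theorem smooth_insTheta : SmoothFormFamily (𝓡 (m + 2)) (fun q => L.insTheta (p q) (X q)) :=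
  (SmoothFormFamily.intProd hX hp.smoothA).pairZero hp.smooth_momDA

include hX in
theorem smooth_insE : SmoothFormFamily (𝓡 (m + 2)) (fun q => L.insE (p q) (X q)) :=
  (SmoothFormFamily.intProd hX hp.smoothA).pairZero hp.smooth_eulerA

theorem smooth_velocity (i : Fin 2) :
    SmoothFormFamily (𝓡 (m + 2)) (fun q => (velocity p q i).1) ∧
    SmoothFormFamily (𝓡 (m + 2)) (fun q => (velocity p q i).2) :=
  ⟨hp.smoothA.pd i, hp.smoothPhi.pd i⟩

end Lagrangian.AdmissibleFamily

/-- The Lie derivative of a field. -/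
noncomputable def lieFields (X : M → Vec (m + 2)) (φ : Fields m W V M) : Fields m W V M :=
  (lieD (𝓡 (m + 2)) X φ.1, lieD (𝓡 (m + 2)) X φ.2)

/-- The Noether identity `θ(𝔏_X φ; φ) = ι_X L + dθ(ι_X φ; φ) - E(ι_X φ; φ)`. -/
theorem Lagrangian.AdmissibleFamily.theta_lieFields (hp : L.AdmissibleFamily p)
    {X : Par → M → Vec (m + 2)} (hX : SmoothVecFamily X) (q : Par) :
    L.theta (p q) (lieFields (X q) (p q)) = intProd (X q) (L.form (p q)) +
      extD (𝓡 (m + 2)) (L.insTheta (p q) (X q)) - L.insE (p q) (X q) := by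
  funext x
  have hb := SmoothForm.intProd (hX.slice q) (hp.smoothA.slice q)
  have h1 : extD (𝓡 (m + 2)) (L.insTheta (p q) (X q)) x = _ :=
    extD_pairZero hb (hp.smooth_momDA.slice q) x
  have h2 : intProd (X q) (L.form (p q)) x = _ := L.curryLeft_density (hp.jet_mem q x) (X q x)
  have h3 : L.theta (p q) (lieFields (X q) (p q)) x =
    wedgeOne (intProd (X q) (extD (𝓡 (m + 2)) (p q).1) x +
      extD (𝓡 (m + 2)) (intProd (X q) (p q).1) x) (L.momDA (p q) x) +
    pairZero (intProd (X q) (extD (𝓡 (m + 2)) (p q).2) x 0) (L.momDPhi (p q) x) := rfl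
  have h4 : L.insE (p q) (X q) x = pairZero (intProd (X q) (p q).1 x 0)
    (L.momA (p q) x + extD (𝓡 (m + 2)) (L.momDA (p q)) x) := rfl
  rw [Pi.sub_apply, Pi.add_apply, h1, h2, h3, h4, wedgeOne_add_left, pairZero_add_right]
  -- Here `b = d(ι_X A) ∧ ∂L/∂(dA)` occurs on both sides, while `d = ι_X A · ∂L/∂A` and `e = ι_X A ·
  -- d(∂L/∂(dA))` cancel between `ι_X L + dθ(ι_X φ; φ)` and `E(ι_X φ; φ)`. The letter `f` is a
  -- dummy.
  have h5 : ∀ a b c d e f : Vec (m + 2) [⋀^Fin (m + 1)]→L[ℝ] ℝ,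
      a + b + c = d + a + c + (b + e) - (d + e) := fun a b c d e f => by abel
  exact h5 _ _ _ _ _ 0

/-- The variational formula `δL = E(δφ; φ) + dθ(δφ; φ)`. -/
theorem Lagrangian.AdmissibleFamily.pd_form (hp : L.AdmissibleFamily p) (i : Fin 2) (q : Par) :
    pd i (fun q => L.form (p q)) q = L.E (p q) (velocity p q i) +
      extD (𝓡 (m + 2)) (L.theta (p q) (velocity p q i)) := by
  funext x
  obtain ⟨hv1, hv2⟩ := hp.smooth_velocity i
  have h1 : HasFDerivAt (fun q => jet (p q) x) _ q :=
    (hp.smoothA.differentiableAt_param q x).hasFDerivAt.prodMk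
      ((hp.smoothPhi.differentiableAt_param q x).hasFDerivAt.prodMk
        ((hp.smoothA.extD.differentiableAt_param q x).hasFDerivAt.prodMk
          (hp.smoothPhi.extD.differentiableAt_param q x).hasFDerivAt))
  have h2 := HasFDerivAt.comp q (L.differentiableAt_density (hp.jet_mem q x)).hasFDerivAt h1
  have h3 : pd i (fun q => L.form (p q)) q x = fderiv ℝ L.density (jet (p q) x)
      (pd i (fun q => (p q).1) q x, pd i (fun q => (p q).2) q x,
        pd i (fun q => extD (𝓡 (m + 2)) (p q).1) q x,
        pd i (fun q => extD (𝓡 (m + 2)) (p q).2) q x) :=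
    congrArg (fun T : Par →L[ℝ] _ => T (basisVec i)) h2.fderiv
  rw [h3, pd_extD hp.smoothA, pd_extD hp.smoothPhi, L.fderiv_density_apply]
  simp only
  have h4 : extD (𝓡 (m + 2)) (L.theta (p q) (velocity p q i)) x =
      extD (𝓡 (m + 2)) (fun x => wedgeOne ((velocity p q i).1 x) (L.momDA (p q) x)) x +
      extD (𝓡 (m + 2)) (fun x => pairZero ((velocity p q i).2 x 0) (L.momDPhi (p q) x)) x :=
    congrFun (extD_add ((hv1.wedgeOne hp.smooth_momDA).slice q)
      ((hv2.pairZero hp.smooth_momDPhi).slice q)) x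
  have h5 := extD_wedgeOne_coeff2 (hv1.slice q) (hp.smooth_momDA.slice q) x
    (L.partDA (jet (p q) x)) rfl
  have h6 := extD_pairZero (hv2.slice q) (hp.smooth_momDPhi.slice q) x
  rw [Pi.add_apply, h4, h5, h6]
  have h7 : L.E (p q) (velocity p q i) x = wedgeOne ((velocity p q i).1 x)
      (L.momA (p q) x + extD (𝓡 (m + 2)) (L.momDA (p q)) x) +
    pairZero ((velocity p q i).2 x 0) (L.momPhi (p q) x - extD (𝓡 (m + 2)) (L.momDPhi (p q)) x) :=
    rfl
  rw [h7, wedgeOne_add_right, pairZero_sub_right]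
  have h8 : wedgeOne ((velocity p q i).1 x) (L.momA (p q) x) = L.partA (jet (p q) x) _ :=
    wedgeOne_coeff1 _ _
  have h9 : pairZero ((velocity p q i).2 x 0) (L.momPhi (p q) x) = L.partPhi (jet (p q) x) _ :=
    pairZero_coeff0 _ _
  have h10 : wedgeOne (extD (𝓡 (m + 2)) (velocity p q i).2 x) (L.momDPhi (p q) x) =
    L.partDPhi (jet (p q) x) _ := wedgeOne_coeff1 _ _
  rw [h8, h9, h10]
  -- Integration by parts: `e = δA ∧ d(∂L/∂(dA))` and `f = δϕ · d(∂L/∂(dϕ))` enter `E` and `dθ` with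
  -- opposite signs.
  have h11 : ∀ a b c d e f : Vec (m + 2) [⋀^Fin (m + 2)]→L[ℝ] ℝ,
    a + b + c + d = a + e + (b - f) + (c - e + (d + f)) := fun a b c d e f => by abel
  exact h11 _ _ _ _ _ _

/-! ### The presymplectic current along a family -/

/-- The derivative of `θ` with respect to the values of the background field. -/
noncomputable def Lagrangian.thetaLin (L : Lagrangian m W V) (J K : Jet m W V)
    (a : Vec (m + 2) [⋀^Fin 1]→L[ℝ] W) (b : Vec (m + 2) [⋀^Fin 0]→L[ℝ] V) :
    Vec (m + 2) [⋀^Fin (m + 1)]→L[ℝ] ℝ :=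
  wedgeOne a (fderiv ℝ (fun J => coeff2 (L.partDA J)) J K) +
    pairZero (b 0) (fderiv ℝ (fun J => coeff1 (L.partDPhi J)) J K)

/-- The presymplectic potential as a function of jets and variations. -/
noncomputable def Lagrangian.thetaJet (L : Lagrangian m W V) (J : Jet m W V)
    (a : Vec (m + 2) [⋀^Fin 1]→L[ℝ] W) (b : Vec (m + 2) [⋀^Fin 0]→L[ℝ] V) :
    Vec (m + 2) [⋀^Fin (m + 1)]→L[ℝ] ℝ :=
  wedgeOne a (coeff2 (L.partDA J)) + pairZero (b 0) (coeff1 (L.partDPhi J))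

/-- Product rule for the two pairings in `θ`. It separates the derivative of the inserted variation
from that of the background jet, which is what comparing `Θ` with the derivative of `θ` along a plot
requires. -/
theorem Lagrangian.fderiv_thetaJet {P : Type*} [NormedAddCommGroup P] [NormedSpace ℝ P]
    {f : P → Jet m W V} {a : P → Vec (m + 2) [⋀^Fin 1]→L[ℝ] W}
    {b : P → Vec (m + 2) [⋀^Fin 0]→L[ℝ] V} {s : P} (hf : DifferentiableAt ℝ f s)
    (ha : DifferentiableAt ℝ a s) (hb : DifferentiableAt ℝ b s) (hs : f s ∈ L.dom) (v : P) :
    fderiv ℝ (fun s => L.thetaJet (f s) (a s) (b s)) s v =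
      L.thetaJet (f s) (fderiv ℝ a s v) (fderiv ℝ b s v) +
        L.thetaLin (f s) (fderiv ℝ f s v) (a s) (b s) := by
  have h1 : DifferentiableAt ℝ (fun J => coeff2 (L.partDA J)) (f s) :=
    (L.covariant_partDA.contDiffAt _ hs).differentiableAt (by simp)
  have h2 : DifferentiableAt ℝ (fun J => coeff1 (L.partDPhi J)) (f s) :=
    (L.covariant_partDPhi.contDiffAt _ hs).differentiableAt (by simp)
  have h3 := HasFDerivAt.comp (g := fun J => coeff2 (L.partDA J)) s h1.hasFDerivAt hf.hasFDerivAt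
  have h4 := HasFDerivAt.comp (g := fun J => coeff1 (L.partDPhi J)) s h2.hasFDerivAt hf.hasFDerivAt
  have h5 := ContinuousLinearMap.fderiv_comp_apply (evalZero (m + 2) V) hb v
  have h6 := (bilinCLM (wedgeBil (m + 2) m W)).hasFDerivAt_of_bilinear ha.hasFDerivAt h3
  have h7 := (bilinCLM (pairBil (m + 2) (m + 1) V)).hasFDerivAt_of_bilinear h5.1.hasFDerivAt h4
  have h8 := congrArg (fun T => T v) (h6.add h7).fderiv
  refine h8.trans ?_
  have h9 : ∀ A B C D : Vec (m + 2) [⋀^Fin (m + 1)]→L[ℝ] ℝ, A + B + (C + D) = B + D + (A + C) :=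
    fun A B C D => by abel
  refine (h9 _ _ _ _).trans ?_
  simp only [Lagrangian.thetaJet, Lagrangian.thetaLin]
  rw [← evalZero_apply (fderiv ℝ b s v), ← h5.2]
  rfl

theorem jet_add_smul {φ α : Fields m W V M} (h1 : SmoothForm (𝓡 (m + 2)) φ.1)
    (h2 : SmoothForm (𝓡 (m + 2)) φ.2) (h3 : SmoothForm (𝓡 (m + 2)) α.1)
    (h4 : SmoothForm (𝓡 (m + 2)) α.2) (s : ℝ) (x : M) :
    jet (φ + s • α) x = jet φ x + s • jet α x := by
  have h5 : SmoothForm (𝓡 (m + 2)) (s • α.1) := fun c => (h3 c).const_smul s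
  have h6 : SmoothForm (𝓡 (m + 2)) (s • α.2) := fun c => (h4 c).const_smul s
  refine Prod.ext rfl (Prod.ext rfl (Prod.ext ?_ ?_))
  · change extD (𝓡 (m + 2)) (φ.1 + s • α.1) x = _
    rw [extD_add h1 h5, extD_smul s h3]
    rfl
  · change extD (𝓡 (m + 2)) (φ.2 + s • α.2) x = _
    rw [extD_add h2 h6, extD_smul s h4]
    rfl

/-- The variation `δ` is held constant and the jet is affine in `s`, so only the background part of
the product rule survives. -/
theorem Lagrangian.deriv_theta {φ α : Fields m W V M} (h1 : SmoothForm (𝓡 (m + 2)) φ.1)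
    (h2 : SmoothForm (𝓡 (m + 2)) φ.2) (h3 : SmoothForm (𝓡 (m + 2)) α.1)
    (h4 : SmoothForm (𝓡 (m + 2)) α.2) {x : M} (hx : jet φ x ∈ L.dom) (δ : Fields m W V M) :
    deriv (fun s : ℝ => L.theta (φ + s • α) δ x) 0 =
      L.thetaLin (jet φ x) (jet α x) (δ.1 x) (δ.2 x) := by
  have hf : HasDerivAt (fun s : ℝ => jet φ x + s • jet α x) (jet α x) 0 := by
    simpa using ((hasDerivAt_id (0 : ℝ)).smul_const (jet α x)).const_add (jet φ x)
  have h5 : (fun s : ℝ => L.theta (φ + s • α) δ x) =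
      fun s => L.thetaJet (jet φ x + s • jet α x) (δ.1 x) (δ.2 x) := by
    funext s
    rw [← jet_add_smul h1 h2 h3 h4]
    rfl
  have h6 := Lagrangian.fderiv_thetaJet (L := L) (s := (0 : ℝ)) hf.differentiableAt
    (differentiableAt_const (δ.1 x)) (differentiableAt_const (δ.2 x)) (by simpa using hx) 1
  have h7 : fderiv ℝ (fun s : ℝ => jet φ x + s • jet α x) 0 1 = jet α x := by
    rw [fderiv_apply_one_eq_deriv, hf.deriv]
  rw [h5, ← fderiv_apply_one_eq_deriv, h6, h7]
  simp only [zero_smul, add_zero]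
  have h8 : L.thetaJet (jet φ x) (fderiv ℝ (fun _ : ℝ => δ.1 x) 0 1)
      (fderiv ℝ (fun _ : ℝ => δ.2 x) 0 1) = 0 := by
    simp only [Lagrangian.thetaJet, fderiv_fun_const, Pi.zero_apply, _root_.zero_apply,
      ContinuousAlternatingMap.coe_zero]
    rw [← wedgeBil_apply, ← pairBil_apply]
    simp
  rw [h8, zero_add]

/-- The presymplectic current is the exterior derivative of the presymplectic potential. -/
theorem Lagrangian.AdmissibleFamily.plotPresymp_eq (hp : L.AdmissibleFamily p) (q : Par) :
    L.plotPresymp p q = pd 0 (fun q => L.theta (p q) (velocity p q 1)) q -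
      pd 1 (fun q => L.theta (p q) (velocity p q 0)) q := by
  funext x
  have hjet : HasFDerivAt (fun q => jet (p q) x) _ q :=
    (hp.smoothA.differentiableAt_param q x).hasFDerivAt.prodMk
      ((hp.smoothPhi.differentiableAt_param q x).hasFDerivAt.prodMk
        ((hp.smoothA.extD.differentiableAt_param q x).hasFDerivAt.prodMk
          (hp.smoothPhi.extD.differentiableAt_param q x).hasFDerivAt))
  have hjetv : ∀ i, fderiv ℝ (fun q => jet (p q) x) q (basisVec i) = jet (velocity p q i) x := by
    intro i
    rw [hjet.fderiv]
    refine Prod.ext rfl (Prod.ext rfl (Prod.ext ?_ ?_))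
    · exact congrFun (pd_extD hp.smoothA i q) x
    · exact congrFun (pd_extD hp.smoothPhi i q) x
  have h1 : ∀ i j, pd i (fun q => L.theta (p q) (velocity p q j)) q x =
      L.thetaJet (jet (p q) x) (pd i (pd j (fun q => (p q).1)) q x)
        (pd i (pd j (fun q => (p q).2)) q x) +
      L.thetaLin (jet (p q) x) (jet (velocity p q i) x) ((velocity p q j).1 x)
        ((velocity p q j).2 x) := by
    intro i j
    have h := Lagrangian.fderiv_thetaJet (L := L) hjet.differentiableAt
      ((hp.smooth_velocity j).1.differentiableAt_param q x)
      ((hp.smooth_velocity j).2.differentiableAt_param q x) (hp.jet_mem q x) (basisVec i)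
    rw [hjetv] at h
    exact h
  have h2 : ∀ i j, deriv (fun s : ℝ => L.theta (p q + s • velocity p q i) (velocity p q j) x) 0 =
      L.thetaLin (jet (p q) x) (jet (velocity p q i) x) ((velocity p q j).1 x)
        ((velocity p q j).2 x) := fun i j =>
    Lagrangian.deriv_theta (hp.smoothA.slice q) (hp.smoothPhi.slice q)
      ((hp.smooth_velocity i).1.slice q) ((hp.smooth_velocity i).2.slice q) (hp.jet_mem q x) _
  -- Along a plot the inserted variation also moves, which adds terms in the second derivatives of
  -- `p`. These are symmetric in the two parameters and drop out of the difference, leaving the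
  -- expression with constant variations.
  rw [Pi.sub_apply, h1, h1, pd_comm hp.smoothA, pd_comm hp.smoothPhi]
  change deriv _ 0 - deriv _ 0 = _
  rw [h2, h2]
  abel

end Currents

/-! ### Contraction of a top-degree form with Maurer-Cartan velocities -/

section TopForms

variable {n k : ℕ} {F : Type*} [NormedAddCommGroup F] [NormedSpace ℝ F] [FiniteDimensional ℝ F]
  {M : Type*} [TopologicalSpace M] [ChartedSpace (Vec n) M] [IsManifold (𝓡 n) ∞ M]

theorem pd_intProd {X : Par → M → Vec n} (hX : SmoothVecFamily X)
    {η : Par → M → Vec n [⋀^Fin (k + 1)]→L[ℝ] F} (hη : SmoothFormFamily (𝓡 n) η) (i : Fin 2)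
    (q : Par) (x : M) :
    pd i (fun q => intProd (X q) (η q)) q x =
      (η q x).curryLeft (pdVec i X q x) + (pd i η q x).curryLeft (X q x) := by
  have h1 := hX x q _ (mem_extChartAt_target x)
  have h2 : ContDiffAt ℝ ∞ (fun q' : Par => (q', extChartAt (𝓡 n) x x)) q := by fun_prop
  have h3 := h1.comp q h2
  have h4 : ContDiffAt ℝ ∞ (fun q' => X q' x) q :=
    h3.congr_of_eventuallyEq (Eventually.of_forall fun q' => (chartVec_center x (X q')).symm)
  exact fderiv_bilin (curryBil k (Vec n) F) (hη.differentiableAt_param q x)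
    (h4.differentiableAt (by simp)) (basisVec i)

theorem curryLeft_comm_neg (η : Vec n [⋀^Fin (k + 2)]→L[ℝ] F) (v w : Vec n) :
    (η.curryLeft v).curryLeft w = - (η.curryLeft w).curryLeft v := by
  ext z
  rw [ContinuousAlternatingMap.neg_apply, curryLeft_apply_apply, curryLeft_apply_apply,
    curryLeft_apply_apply, curryLeft_apply_apply]
  have h := η.toAlternatingMap.map_swap (Matrix.vecCons w (Matrix.vecCons v z)) (i := 0) (j := 1)
    (by simp)
  refine Eq.trans (congrArg η ?_) h
  funext i
  refine Fin.cases ?_ (fun i => Fin.cases ?_ (fun i => ?_) i) i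
  · simp
  · simp
  · rw [Function.comp_apply, Equiv.swap_apply_of_ne_of_ne]
    · rfl
    · exact Fin.succ_ne_zero _
    · intro h
      have := congrArg Fin.val h
      simp at this

theorem intProd_comm (X Y : M → Vec n) (η : M → Vec n [⋀^Fin (k + 2)]→L[ℝ] F) :
    intProd X (intProd Y η) = - intProd Y (intProd X η) :=
  funext fun _ => curryLeft_comm_neg _ _ _

/-- The variation of `ι_X ℓ` for a top degree form `ℓ` and Maurer-Cartan velocities `X`. -/
theorem pd_intProd_top {m : ℕ} {M : Type*} [TopologicalSpace M] [ChartedSpace (Vec (m + 2)) M]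
    [IsManifold (𝓡 (m + 2)) ∞ M] {X : Fin 2 → Par → M → Vec (m + 2)}
    (hX : ∀ i, SmoothVecFamily (X i)) {q : Par}
    (hMC : ∀ x, pdVec 0 (X 1) q x + dVec (X 1 q) x (X 0 q x) =
      pdVec 1 (X 0) q x + dVec (X 0 q) x (X 1 q x))
    {ℓ : Par → M → Vec (m + 2) [⋀^Fin (m + 2)]→L[ℝ] F} (hℓ : SmoothFormFamily (𝓡 (m + 2)) ℓ) :
    pd 0 (fun q => intProd (X 1 q) (ℓ q)) q + lieD (𝓡 (m + 2)) (X 0 q) (intProd (X 1 q) (ℓ q)) -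
      (pd 1 (fun q => intProd (X 0 q) (ℓ q)) q +
        lieD (𝓡 (m + 2)) (X 1 q) (intProd (X 0 q) (ℓ q))) =
    intProd (X 1 q) (pd 0 ℓ q) - intProd (X 0 q) (pd 1 ℓ q) +
      extD (𝓡 (m + 2)) (intProd (X 0 q) (intProd (X 1 q) (ℓ q))) := by
  have hXs := fun i => (hX i).slice q
  have hℓs := hℓ.slice q
  have hI := fun i => SmoothForm.intProd (hXs i) hℓs
  have hneg : SmoothForm (𝓡 (m + 2)) (intProd (X 1 q) (intProd (X 0 q) (ℓ q))) :=
    SmoothForm.intProd (hXs 1) (hI 0)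
  have hd : extD (𝓡 (m + 2)) (intProd (X 0 q) (intProd (X 1 q) (ℓ q))) =
      - extD (𝓡 (m + 2)) (intProd (X 1 q) (intProd (X 0 q) (ℓ q))) := by
    rw [intProd_comm, ← neg_one_smul ℝ (intProd (X 1 q) (intProd (X 0 q) (ℓ q))),
      extD_smul _ hneg, neg_one_smul]
  -- A form of top degree is closed, so only `d ι_X` remains in its Lie derivative.
  have htop : ∀ i, lieD (𝓡 (m + 2)) (X i q) (ℓ q) = extD (𝓡 (m + 2)) (intProd (X i q) (ℓ q)) := by
    intro i
    have h1 : extD (𝓡 (m + 2)) (ℓ q) = 0 := funext fun x => eq_zero_of_lt (by omega) _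
    change intProd (X i q) (extD (𝓡 (m + 2)) (ℓ q)) + _ = _
    rw [h1]
    have h2 : intProd (X i q) (0 : M → Vec (m + 2) [⋀^Fin (m + 2 + 1)]→L[ℝ] F) = 0 := by
      funext x
      simp [intProd, curryLeft_zero]
    rw [h2, zero_add]
  rw [hd]
  funext x
  have h1 := pd_intProd (hX 1) hℓ 0 q x
  have h2 := pd_intProd (hX 0) hℓ 1 q x
  have h3 := lieD_intProd (hXs 0) (hXs 1) hℓs x
  -- The two Lie derivatives are deliberately expanded differently: the first by `[𝔏_X, ι_Y] =
  -- ι_{[X, Y]}`, this one by Cartan's definition. Both produce `ι_{X_1} d ι_{X_0} ℓ`, which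
  -- cancels, and what remains is `ι_{[X_0, X_1]} ℓ` and an exact term.
  have h4 : lieD (𝓡 (m + 2)) (X 1 q) (intProd (X 0 q) (ℓ q)) x =
      (extD (𝓡 (m + 2)) (intProd (X 0 q) (ℓ q)) x).curryLeft (X 1 q x) +
        extD (𝓡 (m + 2)) (intProd (X 1 q) (intProd (X 0 q) (ℓ q))) x := rfl
  rw [htop] at h3
  simp only [Pi.add_apply, Pi.sub_apply, Pi.neg_apply]
  rw [h1, h2, h3, h4]
  -- The Maurer-Cartan equation: the bracket term exactly compensates the parameter derivatives of
  -- the velocities.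
  have h5 : (ℓ q x).curryLeft (pdVec 0 (X 1) q x) +
      (ℓ q x).curryLeft (dVec (X 1 q) x (X 0 q x) - dVec (X 0 q) x (X 1 q x)) =
      (ℓ q x).curryLeft (pdVec 1 (X 0) q x) := by
    rw [← _root_.map_add, ← add_sub_assoc, hMC x, add_sub_cancel_right]
  rw [← h5]
  change _ + (pd 0 ℓ q x).curryLeft (X 1 q x) + _ - (_ + (pd 1 ℓ q x).curryLeft (X 0 q x) + _) =
    (pd 0 ℓ q x).curryLeft (X 1 q x) - (pd 1 ℓ q x).curryLeft (X 0 q x) + _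
  abel

end TopForms

/-! ### Transformation of the presymplectic current -/

section Transformation

variable {m : ℕ} {W V : Type*} [NormedAddCommGroup W] [NormedSpace ℝ W] [FiniteDimensional ℝ W]
    [NormedAddCommGroup V] [NormedSpace ℝ V] [FiniteDimensional ℝ V]
  {M : Type*} [TopologicalSpace M] [ChartedSpace (Vec (m + 2)) M] [IsManifold (𝓡 (m + 2)) ∞ M]
  {N : Type*} [TopologicalSpace N] [ChartedSpace (Vec (m + 2)) N] [IsManifold (𝓡 (m + 2)) ∞ N]
  {L : Lagrangian m W V} {p : Par → Fields m W V M}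

/-- The derivative along Maurer-Cartan velocities of the transformed presymplectic potential. -/
theorem Lagrangian.AdmissibleFamily.transformed_potential (hp : L.AdmissibleFamily p)
    {X : Fin 2 → Par → M → Vec (m + 2)} (hX : ∀ i, SmoothVecFamily (X i)) (q : Par)
    (hMC : ∀ x, pdVec 0 (X 1) q x + dVec (X 1 q) x (X 0 q x) =
      pdVec 1 (X 0) q x + dVec (X 0 q) x (X 1 q x))
    (τ : Fin 2 → Par → M → Vec (m + 2) [⋀^Fin (m + 1)]→L[ℝ] ℝ)
    (hτ : ∀ i q, τ i q = L.theta (p q) (velocity p q i + lieFields (X i q) (p q))) :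
    pd 0 (τ 1) q + lieD (𝓡 (m + 2)) (X 0 q) (τ 1 q) -
      (pd 1 (τ 0) q + lieD (𝓡 (m + 2)) (X 1 q) (τ 0 q)) =
    L.plotPresymp p q + extD (𝓡 (m + 2)) (L.bdryTerm p X q) - L.bulkTerm p X q := by
  let t : Fin 2 → Par → M → Vec (m + 2) [⋀^Fin (m + 1)]→L[ℝ] ℝ :=
    fun i q => L.theta (p q) (velocity p q i)
  let ι : Fin 2 → Par → M → Vec (m + 2) [⋀^Fin (m + 1)]→L[ℝ] ℝ :=
    fun i q => intProd (X i q) (L.form (p q))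
  let b : Fin 2 → Par → M → Vec (m + 2) [⋀^Fin m]→L[ℝ] ℝ := fun i q => L.insTheta (p q) (X i q)
  let e : Fin 2 → Par → M → Vec (m + 2) [⋀^Fin (m + 1)]→L[ℝ] ℝ := fun i q => L.insE (p q) (X i q)
  have ht : ∀ i, SmoothFormFamily (𝓡 (m + 2)) (t i) := fun i =>
    hp.smooth_theta (hp.smooth_velocity i).1 (hp.smooth_velocity i).2
  have hι : ∀ i, SmoothFormFamily (𝓡 (m + 2)) (ι i) := fun i =>
    SmoothFormFamily.intProd (hX i) hp.smooth_form
  have hb : ∀ i, SmoothFormFamily (𝓡 (m + 2)) (b i) := fun i => hp.smooth_insTheta (hX i)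
  have he : ∀ i, SmoothFormFamily (𝓡 (m + 2)) (e i) := fun i => hp.smooth_insE (hX i)
  -- The Noether identity splits the transformed potential into `θ`, `ι_X L`, an exact term and an
  -- Euler-Lagrange term, which are then differentiated separately.
  have hτe : ∀ i, τ i = fun q => t i q + ι i q + extD (𝓡 (m + 2)) (b i q) - e i q := by
    intro i
    funext q
    rw [hτ, Lagrangian.theta_add, hp.theta_lieFields (hX i)]
    simp only [t, ι, b, e]
    abel
  have hpd : ∀ i j, pd i (τ j) q = pd i (t j) q + pd i (ι j) q +
      extD (𝓡 (m + 2)) (pd i (b j) q) - pd i (e j) q := by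
    intro i j
    rw [hτe, pd_sub (((ht j).add (hι j)).add (hb j).extD) (he j),
      pd_add ((ht j).add (hι j)) (hb j).extD, pd_add (ht j) (hι j), pd_extD (hb j)]
  have hlie : ∀ i j, lieD (𝓡 (m + 2)) (X i q) (τ j q) = lieD (𝓡 (m + 2)) (X i q) (t j q) +
      lieD (𝓡 (m + 2)) (X i q) (ι j q) + extD (𝓡 (m + 2)) (lieD (𝓡 (m + 2)) (X i q) (b j q)) -
      lieD (𝓡 (m + 2)) (X i q) (e j q) := by
    intro i j
    have hXi := (hX i).slice q
    have e1 : SmoothForm (𝓡 (m + 2)) (-(e j q)) := fun c => ((he j).slice q c).neg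
    rw [hτe]
    simp only
    rw [sub_eq_add_neg, lieD_add hXi ((((ht j).add (hι j)).add (hb j).extD).slice q) e1,
      lieD_add hXi (((ht j).add (hι j)).slice q) ((hb j).extD.slice q),
      lieD_add hXi ((ht j).slice q) ((hι j).slice q), lieD_neg hXi ((he j).slice q),
      lieD_extD hXi ((hb j).slice q), ← sub_eq_add_neg]
  -- The contribution of `ι_X L`, with the variation of `L` then replaced by `E + dθ`. It produces
  -- the bulk term `-ι_X E` and copies of `ι_X dθ`.
  have hF := pd_intProd_top hX hMC hp.smooth_form
  rw [hp.pd_form, hp.pd_form] at hF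
  have hint : ∀ i (α β : M → Vec (m + 2) [⋀^Fin (m + 2)]→L[ℝ] ℝ),
      intProd (X i q) (α + β) = intProd (X i q) α + intProd (X i q) β := fun _ _ _ => rfl
  rw [hint, hint] at hF
  -- Of the two parts of `𝔏_X θ`, the part `ι_X dθ` cancels against the variation of `L` and `d ι_X
  -- θ` belongs to the boundary.
  have hlt : ∀ i j, lieD (𝓡 (m + 2)) (X i q) (t j q) =
      intProd (X i q) (extD (𝓡 (m + 2)) (t j q)) + extD (𝓡 (m + 2)) (intProd (X i q) (t j q)) :=
    fun i j => rfl
  -- the exterior derivative of the boundary term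
  have s1 : SmoothFormFamily (𝓡 (m + 2)) (fun q => pd 0 (b 1) q - pd 1 (b 0) q) :=
    ((hb 1).pd 0).sub ((hb 0).pd 1)
  have s2 : ∀ i j, SmoothForm (𝓡 (m + 2)) (intProd (X i q) (t j q)) := fun i j =>
    SmoothForm.intProd ((hX i).slice q) ((ht j).slice q)
  have s3 : ∀ i j, SmoothForm (𝓡 (m + 2)) (lieD (𝓡 (m + 2)) (X i q) (b j q)) := fun i j =>
    (SmoothFormFamily.lieD (hX i) (hb j)).slice q
  have s4 : ∀ i j, SmoothForm (𝓡 (m + 2)) (intProd (X i q) (ι j q)) := fun i j =>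
    SmoothForm.intProd ((hX i).slice q) ((hι j).slice q)
  have hbdry : L.bdryTerm p X q = (pd 0 (b 1) q - pd 1 (b 0) q) +
      (intProd (X 0 q) (t 1 q) - intProd (X 1 q) (t 0 q)) +
      (lieD (𝓡 (m + 2)) (X 0 q) (b 1 q) - lieD (𝓡 (m + 2)) (X 1 q) (b 0 q)) +
      intProd (X 0 q) (ι 1 q) := by
    -- Contractions anticommute, so `skew` doubles the term and the factor one half leaves a single
    -- double contraction.
    have h1 : (1 / 2 : ℝ) • skew (fun i j => intProd (X i q) (intProd (X j q) (L.form (p q)))) =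
        intProd (X 0 q) (ι 1 q) := by
      have h2 : intProd (X 1 q) (intProd (X 0 q) (L.form (p q))) =
        - intProd (X 0 q) (intProd (X 1 q) (L.form (p q))) := intProd_comm _ _ _
      simp only [skew, ι]
      rw [h2, sub_neg_eq_add, ← two_smul ℝ, smul_smul]
      norm_num
    rw [Lagrangian.bdryTerm, h1]
    rfl
  have sub_s : ∀ {k : ℕ} {α β : M → Vec (m + 2) [⋀^Fin k]→L[ℝ] ℝ}, SmoothForm (𝓡 (m + 2)) α →
      SmoothForm (𝓡 (m + 2)) β → SmoothForm (𝓡 (m + 2)) (α - β) := fun h1 h2 c => (h1 c).sub (h2 c)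
  have add_s : ∀ {k : ℕ} {α β : M → Vec (m + 2) [⋀^Fin k]→L[ℝ] ℝ}, SmoothForm (𝓡 (m + 2)) α →
      SmoothForm (𝓡 (m + 2)) β → SmoothForm (𝓡 (m + 2)) (α + β) := fun h1 h2 c => (h1 c).add (h2 c)
  have hdb : extD (𝓡 (m + 2)) (L.bdryTerm p X q) =
      (extD (𝓡 (m + 2)) (pd 0 (b 1) q) - extD (𝓡 (m + 2)) (pd 1 (b 0) q)) +
      (extD (𝓡 (m + 2)) (intProd (X 0 q) (t 1 q)) - extD (𝓡 (m + 2)) (intProd (X 1 q) (t 0 q))) +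
      (extD (𝓡 (m + 2)) (lieD (𝓡 (m + 2)) (X 0 q) (b 1 q)) -
        extD (𝓡 (m + 2)) (lieD (𝓡 (m + 2)) (X 1 q) (b 0 q))) +
      extD (𝓡 (m + 2)) (intProd (X 0 q) (ι 1 q)) := by
    rw [hbdry, extD_add (add_s (add_s (s1.slice q) (sub_s (s2 0 1) (s2 1 0)))
        (sub_s (s3 0 1) (s3 1 0))) (s4 0 1),
      extD_add (add_s (s1.slice q) (sub_s (s2 0 1) (s2 1 0))) (sub_s (s3 0 1) (s3 1 0)),
      extD_add (s1.slice q) (sub_s (s2 0 1) (s2 1 0)),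
      extD_sub (((hb 1).pd 0).slice q) (((hb 0).pd 1).slice q), extD_sub (s2 0 1) (s2 1 0),
      extD_sub (s3 0 1) (s3 1 0)]
  have hbulk : L.bulkTerm p X q = (intProd (X 0 q) (L.E (p q) (velocity p q 1)) -
      intProd (X 1 q) (L.E (p q) (velocity p q 0))) + (pd 0 (e 1) q - pd 1 (e 0) q) +
      (lieD (𝓡 (m + 2)) (X 0 q) (e 1 q) - lieD (𝓡 (m + 2)) (X 1 q) (e 0 q)) := rfl
  have hF' : pd 0 (ι 1) q + lieD (𝓡 (m + 2)) (X 0 q) (ι 1 q) -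
      (pd 1 (ι 0) q + lieD (𝓡 (m + 2)) (X 1 q) (ι 0 q)) =
    intProd (X 1 q) (L.E (p q) (velocity p q 0)) + intProd (X 1 q) (extD (𝓡 (m + 2)) (t 0 q)) -
      (intProd (X 0 q) (L.E (p q) (velocity p q 1)) + intProd (X 0 q) (extD (𝓡 (m + 2)) (t 1 q))) +
      extD (𝓡 (m + 2)) (intProd (X 0 q) (ι 1 q)) := hF
  have hplot : L.plotPresymp p q = pd 0 (t 1) q - pd 1 (t 0) q := hp.plotPresymp_eq q
  rw [hpd, hpd, hlie, hlie, hlt, hlt, hdb, hbulk, hplot]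
  rw [← sub_eq_zero] at hF' ⊢
  rw [← hF']
  abel

theorem pullForm_symm_pullForm {n k : ℕ} {F : Type*} [NormedAddCommGroup F] [NormedSpace ℝ F]
    {M : Type*} [TopologicalSpace M] [ChartedSpace (Vec n) M]
    {N : Type*} [TopologicalSpace N] [ChartedSpace (Vec n) N]
    (u : N ≃ₘ^∞⟮𝓡 n, 𝓡 n⟯ M) (η : M → Vec n [⋀^Fin k]→L[ℝ] F) :
    pullForm (𝓡 n) (𝓡 n) u.symm (pullForm (𝓡 n) (𝓡 n) u η) = η := by
  funext x
  have h1 : MDifferentiableAt (𝓡 n) (𝓡 n) u (u.symm x) := u.contMDiff.mdifferentiable (by simp) _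
  have h2 : MDifferentiableAt (𝓡 n) (𝓡 n) u.symm x := u.symm.contMDiff.mdifferentiable (by simp) _
  have h3 := mfderiv_comp x h1 h2
  have h4 : (u ∘ u.symm : M → M) = id := funext fun x => u.apply_symm_apply x
  rw [h4, mfderiv_id] at h3
  have h5 : ∀ v : Vec n, (mfderiv (𝓡 n) (𝓡 n) u (u.symm x) : Vec n →L[ℝ] Vec n)
      ((mfderiv (𝓡 n) (𝓡 n) u.symm x : Vec n →L[ℝ] Vec n) v) = v := fun v =>
    (congrArg (fun T : Vec n →L[ℝ] Vec n => T v) h3).symm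
  refine ContinuousAlternatingMap.ext fun v => ?_
  change η (u (u.symm x)) (fun i => (mfderiv (𝓡 n) (𝓡 n) u (u.symm x) : Vec n →L[ℝ] Vec n)
      ((mfderiv (𝓡 n) (𝓡 n) u.symm x : Vec n →L[ℝ] Vec n) (v i))) = η x v
  rw [u.apply_symm_apply]
  exact congrArg (η x) (funext fun i => h5 (v i))

/-- The transformed presymplectic current, pulled back to `M`. -/
theorem Lagrangian.AdmissibleFamily.plotPresymp_pullFields (hp : L.AdmissibleFamily p)
    {u : Par → (N ≃ₘ^∞⟮𝓡 (m + 2), 𝓡 (m + 2)⟯ M)} (hu : SmoothDiffFamily u) (q : Par) :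
    L.plotPresymp (fun q => CovPhase.pullFields (u q) (p q)) q =
      pullForm (𝓡 (m + 2)) (𝓡 (m + 2)) (u q) (L.plotPresymp p q +
        extD (𝓡 (m + 2)) (L.bdryTerm p (logVelocity u) q) - L.bulkTerm p (logVelocity u) q) := by
  have hX : ∀ i, SmoothVecFamily (logVelocity u i) := hu.smoothVecFamily_logVel
  let τ : Fin 2 → Par → M → Vec (m + 2) [⋀^Fin (m + 1)]→L[ℝ] ℝ :=
    fun i q => L.theta (p q) (velocity p q i + lieFields (logVelocity u i q) (p q))
  have hτs : ∀ i, SmoothFormFamily (𝓡 (m + 2)) (τ i) := fun i =>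
    hp.smooth_theta (((hp.smooth_velocity i).1).add (SmoothFormFamily.lieD (hX i) hp.smoothA))
      (((hp.smooth_velocity i).2).add (SmoothFormFamily.lieD (hX i) hp.smoothPhi))
  -- The variation of the transformed fields is the pullback of the original variation corrected by
  -- the Lie derivative along the velocity of the diffeomorphisms.
  have hvel : ∀ i q, velocity (fun q => CovPhase.pullFields (u q) (p q)) q i =
      CovPhase.pullFields (u q) (velocity p q i + lieFields (logVelocity u i q) (p q)) := by
    intro i q
    exact Prod.ext (pd_pullForm hp.smoothA hu i q) (pd_pullForm hp.smoothPhi hu i q)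
  have hθ : ∀ i, (fun q => L.theta (CovPhase.pullFields (u q) (p q))
      (velocity (fun q => CovPhase.pullFields (u q) (p q)) q i)) =
      fun q => pullForm (𝓡 (m + 2)) (𝓡 (m + 2)) (u q) (τ i q) := by
    intro i
    funext q
    rw [hvel]
    exact Lagrangian.theta_pullFields (hp.smoothA.slice q) (hp.smoothPhi.slice q) (hp.jet_mem q) _ _
  rw [(hp.pullFields hu).plotPresymp_eq q, hθ, hθ, pd_pullForm (hτs 1) hu, pd_pullForm (hτs 0) hu,
    ← hp.transformed_potential hX q (hu.maurerCartan q) τ (fun _ _ => rfl)]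
  rfl

end Transformation

/-! ### Stokes' theorem in the half space -/

section HalfSpace

variable {m : ℕ}

theorem bdryIncl_toLp (x : Fin m → ℝ) :
    bdryIncl (WithLp.toLp 2 x) = WithLp.toLp 2 (Fin.insertNth 0 0 x : Fin (m + 1) → ℝ) := by
  rw [Fin.insertNth_zero]
  rfl

/-- Divergence theorem on a box that contains the support within the half space. Only the face `y 0
= 0` can meet the support; it is a lower face, whence the minus sign. Differentiability is required
only in the interior, which fits chart expressions at a boundary. -/
theorem integral_halfSpace (u : Vec (m + 1) → Vec (m + 1) [⋀^Fin m]→L[ℝ] ℝ)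
    (u' : Vec (m + 1) → Vec (m + 1) →L[ℝ] Vec (m + 1) [⋀^Fin m]→L[ℝ] ℝ) {K : Set (Vec (m + 1))}
    (hK : IsCompact K) (hu : ∀ y ∉ K, u y = 0) (hu' : ∀ y ∉ K, u' y = 0)
    (hc : ContinuousOn u {y | 0 ≤ y 0}) (hd : ∀ y : Vec (m + 1), 0 < y 0 → HasFDerivAt u (u' y) y)
    (hi : IntegrableOn (fun y => alternatizeUncurryFin (u' y) basisVec) {y | 0 ≤ y 0}) :
    ∫ y in {y : Vec (m + 1) | 0 ≤ y 0}, alternatizeUncurryFin (u' y) basisVec =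
      -∫ z : Vec m, u (bdryIncl z) (fun i : Fin m => basisVec i.succ) := by
  -- Strictness matters: the faces of the box at coordinates `R` and `-R` must miss `K`.
  obtain ⟨R, hR0, hR⟩ : ∃ R : ℝ, 0 < R ∧ ∀ y ∈ K, ∀ i, |y i| < R := by
    obtain ⟨R, hR⟩ := hK.isBounded.exists_norm_le
    refine ⟨max R 0 + 1, by positivity, fun y hy i => ?_⟩
    have h1 : ‖y i‖ ≤ ‖y‖ := PiLp.norm_apply_le y i
    have h2 := hR y hy
    have h3 := le_max_left R 0
    rw [Real.norm_eq_abs] at h1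
    linarith
  let a : Fin (m + 1) → ℝ := Fin.cons 0 fun _ => -R
  let b : Fin (m + 1) → ℝ := fun _ => R
  have hab : a ≤ b := by
    intro i
    refine Fin.cases ?_ (fun i => ?_) i
    · exact hR0.le
    · change -R ≤ R; linarith
  let D : Vec (m + 1) → ℝ := fun y => alternatizeUncurryFin (u' y) basisVec
  let L : (Fin (m + 1) → ℝ) →L[ℝ] Vec (m + 1) :=
    (PiLp.continuousLinearEquiv 2 ℝ (fun _ : Fin (m + 1) => ℝ)).symm
  have hL : ∀ x, L x = WithLp.toLp 2 x := fun x => rfl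
  -- The components of the vector field dual to `u`. The signs are chosen so that its divergence is
  -- `du` evaluated on the standard basis.
  let ev : Fin (m + 1) → (Vec (m + 1) [⋀^Fin m]→L[ℝ] ℝ) →L[ℝ] ℝ := fun i =>
    (-1 : ℝ) ^ (i : ℕ) • ContinuousAlternatingMap.apply ℝ (Vec (m + 1)) ℝ (i.removeNth basisVec)
  let f : Fin (m + 1) → (Fin (m + 1) → ℝ) → ℝ := fun i x => ev i (u (L x))
  let f' : Fin (m + 1) → (Fin (m + 1) → ℝ) → (Fin (m + 1) → ℝ) →L[ℝ] ℝ := fun i x =>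
    ((ev i).comp (u' (L x))).comp L
  have hsum : ∀ x, ∑ i, f' i x (Pi.single i 1) = D (L x) := by
    intro x
    simp only [D]
    rw [alternatizeUncurryFin_apply]
    refine Finset.sum_congr rfl fun i _ => ?_
    simp only [f', ev, ContinuousLinearMap.comp_apply]
    rw [← Int.cast_smul_eq_zsmul ℝ]
    push_cast
    rfl
  have hD0 : ∀ y ∉ K, D y = 0 := by
    intro y hy
    simp only [D, hu' y hy]
    rw [alternatizeUncurryFin_apply]
    simp
  have mp := PiLp.volume_preserving_toLp (Fin (m + 1))
  have me : MeasurableEmbedding (WithLp.toLp 2 : (Fin (m + 1) → ℝ) → Vec (m + 1)) :=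
    (MeasurableEquiv.toLp 2 (Fin (m + 1) → ℝ)).measurableEmbedding
  have hpre : (WithLp.toLp 2 : (Fin (m + 1) → ℝ) → Vec (m + 1)) ⁻¹' {y | 0 ≤ y 0} =
      {x | 0 ≤ x 0} := rfl
  have hsub : Icc a b ⊆ {x : Fin (m + 1) → ℝ | 0 ≤ x 0} := fun x hx => hx.1 0
  have hHi : IntegrableOn (fun x => D (L x)) {x : Fin (m + 1) → ℝ | 0 ≤ x 0} := by
    have h := (mp.integrableOn_comp_preimage me (f := D) (s := {y | 0 ≤ y 0})).2 hi
    exact h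
  have hIcc : ∫ y in {y : Vec (m + 1) | 0 ≤ y 0}, D y = ∫ x in Icc a b, D (L x) := by
    rw [← mp.setIntegral_preimage_emb me, hpre]
    refine setIntegral_eq_of_subset_of_forall_sdiff_eq_zero
      (measurableSet_le measurable_const (measurable_pi_apply 0)) hsub ?_
    rintro x ⟨hx, hxn⟩
    refine hD0 _ fun hxK => hxn ⟨fun i => ?_, fun i => ?_⟩
    · refine Fin.cases hx (fun i => ?_) i
      exact (abs_lt.1 (hR _ hxK i.succ)).1.le
    · exact (abs_lt.1 (hR _ hxK i)).2.le
  have hdiv := integral_divergence_of_hasFDerivAt_off_countable' a b hab f f' ∅ countable_empty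
    (fun i => by
      refine (ev i).continuous.comp_continuousOn (hc.comp L.continuous.continuousOn ?_)
      exact hsub)
    (fun x hx i => by
      have h0 : 0 < (L x) 0 := (hx.1 0 (mem_univ 0)).1
      exact (ev i).hasFDerivAt.comp x ((hd _ h0).comp x L.hasFDerivAt))
    (by simp only [hsum]; exact hHi.mono_set hsub)
  simp only [hsum] at hdiv
  have hfront : ∀ i x, f i (i.insertNth (b i) x) = 0 := by
    intro i x
    have : L (i.insertNth (b i) x) ∉ K := by
      intro hxK
      have h := (abs_lt.1 (hR _ hxK i)).2
      have h2 : (L (i.insertNth (b i) x)) i = R := by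
        change (i.insertNth (b i) x : Fin (m + 1) → ℝ) i = R
        rw [Fin.insertNth_apply_same]
      rw [h2] at h
      exact lt_irrefl _ h
    simp only [f]
    rw [hu _ this, _root_.map_zero]
  have hback : ∀ (i : Fin m) x, f i.succ (i.succ.insertNth (a i.succ) x) = 0 := by
    intro i x
    have : L (i.succ.insertNth (a i.succ) x) ∉ K := by
      intro hxK
      have h := (abs_lt.1 (hR _ hxK i.succ)).1
      have h2 : (L (i.succ.insertNth (a i.succ) x)) i.succ = -R := by
        change (i.succ.insertNth (a i.succ) x : Fin (m + 1) → ℝ) i.succ = -R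
        rw [Fin.insertNth_apply_same]
        rfl
      rw [h2] at h
      exact lt_irrefl _ h
    simp only [f]
    rw [hu _ this, _root_.map_zero]
  rw [Fin.sum_univ_succ] at hdiv
  simp only [hfront, hback, integral_zero, sub_zero, Finset.sum_const_zero, add_zero,
    zero_sub] at hdiv
  change ∫ y in {y : Vec (m + 1) | 0 ≤ y 0}, D y = _
  rw [hIcc, hdiv]
  congr 1
  have hface : ∀ x : Fin m → ℝ, f 0 (Fin.insertNth 0 (a 0) x) =
      u (bdryIncl (WithLp.toLp 2 x)) (fun i : Fin m => basisVec i.succ) := by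
    intro x
    rw [bdryIncl_toLp]
    simp only [f, ev]
    simp [hL, a]
    rfl
  have mp' := PiLp.volume_preserving_toLp (Fin m)
  have me' : MeasurableEmbedding (WithLp.toLp 2 : (Fin m → ℝ) → Vec m) :=
    (MeasurableEquiv.toLp 2 (Fin m → ℝ)).measurableEmbedding
  rw [← mp'.integral_comp me']
  simp only [hface]
  refine setIntegral_eq_integral_of_forall_compl_eq_zero fun x hxn => ?_
  rw [hu, ContinuousAlternatingMap.coe_zero, Pi.zero_apply]
  intro hxK
  refine hxn ⟨fun i => ?_, fun i => ?_⟩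
  · exact (abs_lt.1 (hR _ hxK i.succ)).1.le
  · exact (abs_lt.1 (hR _ hxK i.succ)).2.le

end HalfSpace

/-! ### Forms of top degree -/

section Top

variable {n : ℕ}

theorem top_apply_eq (η : Vec n [⋀^Fin n]→L[ℝ] ℝ) (v : Fin n → Vec n) :
    η v = η basisVec * (EuclideanSpace.basisFun (Fin n) ℝ).toBasis.det v := by
  have h := η.toAlternatingMap.eq_smul_basis_det (EuclideanSpace.basisFun (Fin n) ℝ).toBasis
  have h1 : ⇑(EuclideanSpace.basisFun (Fin n) ℝ).toBasis = basisVec := by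
    funext i
    simp [basisVec]
  rw [h1] at h
  exact congrArg (fun T => T v) h

theorem top_comp_basisVec (η : Vec n [⋀^Fin n]→L[ℝ] ℝ) (g : Vec n →L[ℝ] Vec n) :
    η.compContinuousLinearMap g basisVec = g.det * η basisVec := by
  have h1 : ⇑(EuclideanSpace.basisFun (Fin n) ℝ).toBasis = basisVec := by
    funext i
    simp [basisVec]
  have h2 := (EuclideanSpace.basisFun (Fin n) ℝ).toBasis.det_comp (g : Vec n →ₗ[ℝ] Vec n) basisVec
  have h3 : (EuclideanSpace.basisFun (Fin n) ℝ).toBasis.det basisVec = 1 := by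
    rw [← h1, Module.Basis.det_self]
  rw [h3, mul_one] at h2
  rw [compContinuousLinearMap_apply, top_apply_eq, mul_comm]
  exact congrArg (· * η basisVec) h2

theorem top_eq_zero {η : Vec n [⋀^Fin n]→L[ℝ] ℝ} (h : η basisVec = 0) : η = 0 := by
  ext v
  rw [top_apply_eq, h, zero_mul]
  rfl

/-- With `d` the Jacobian of a chart change, `w` the coefficient of the orientation form and `f`
that of the integrand: the orientation sign converts the Jacobian into the absolute value occurring
in the change of variables formula. -/
theorem sign_mul_mul (d w f : ℝ) : Real.sign (d * w) * (d * f) = |d| * (Real.sign w * f) := by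
  rcases lt_trichotomy d 0 with hd | hd | hd
  · rw [abs_of_neg hd]
    rcases lt_trichotomy w 0 with hw | hw | hw
    · rw [Real.sign_of_neg hw, Real.sign_of_pos (mul_pos_of_neg_of_neg hd hw)]; ring
    · simp [hw]
    · rw [Real.sign_of_pos hw, Real.sign_of_neg (mul_neg_of_neg_of_pos hd hw)]; ring
  · simp [hd]
  · rw [abs_of_pos hd]
    rcases lt_trichotomy w 0 with hw | hw | hw
    · rw [Real.sign_of_neg hw, Real.sign_of_neg (mul_neg_of_pos_of_neg hd hw)]; ring
    · simp [hw]
    · rw [Real.sign_of_pos hw, Real.sign_of_pos (mul_pos hd hw)]; ring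

end Top

/-! ### Integrals over charts -/

section ChartIntegral

variable {m : ℕ} {S : Type*} [TopologicalSpace S] [ChartedSpace (EuclideanHalfSpace (m + 1)) S]
  [IsManifold (𝓡∂ (m + 1)) ∞ S] (o : OrientationForm m S)

/-- A chart target need not be open in the vector space at boundary points. It is an open set
intersected with the closed half space, and the preimage of `U` is relatively open in it. -/
theorem measurableSet_target_inter (c : S) {U : Set S} (hU : IsOpen U) :
    MeasurableSet ((extChartAt (𝓡∂ (m + 1)) c).target ∩ (extChartAt (𝓡∂ (m + 1)) c).symm ⁻¹' U) := by
  have h1 : MeasurableSet (extChartAt (𝓡∂ (m + 1)) c).target := by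
    rw [extChartAt_target]
    exact (((chartAt _ c).open_target.preimage (𝓡∂ (m + 1)).continuous_symm).measurableSet).inter
      (𝓡∂ (m + 1)).isClosed_range.measurableSet
  obtain ⟨V, hV, hV2⟩ := (continuousOn_iff'.1 (continuousOn_extChartAt_symm (I := 𝓡∂ (m + 1)) c)) U hU
  rw [inter_comm, hV2]
  exact hV.measurableSet.inter h1

theorem measurableSet_target (c : S) : MeasurableSet (extChartAt (𝓡∂ (m + 1)) c).target := by
  have h := measurableSet_target_inter (m := m) c (isOpen_univ (X := S))
  simpa using h

theorem chartRep_form_ne_zero {c : S} {y : Vec (m + 1)}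
    (hy : y ∈ (extChartAt (𝓡∂ (m + 1)) c).target) :
    chartRep (𝓡∂ (m + 1)) c o.form y basisVec ≠ 0 := by
  intro h
  have h1 := top_eq_zero h
  refine o.ne_zero ((extChartAt (𝓡∂ (m + 1)) c).symm y) ?_
  have h2 := mfderivWithin_extChartAt_symm_comp_mfderiv_extChartAt hy
  refine ContinuousAlternatingMap.ext fun v => ?_
  let A : Vec (m + 1) →L[ℝ] Vec (m + 1) := mfderiv (𝓡∂ (m + 1)) 𝓘(ℝ, Vec (m + 1))
    (extChartAt (𝓡∂ (m + 1)) c) ((extChartAt (𝓡∂ (m + 1)) c).symm y)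
  have h3 := congrArg (fun T : Vec (m + 1) [⋀^Fin (m + 1)]→L[ℝ] ℝ => T (A ∘ v)) h1
  refine Eq.trans (congrArg (o.form ((extChartAt (𝓡∂ (m + 1)) c).symm y)) (funext fun i => ?_)) h3
  exact (congrArg (fun T : Vec (m + 1) →L[ℝ] Vec (m + 1) => T (v i)) h2).symm

/-- The coefficient of the orientation form is continuous and nowhere zero on the chart target, so
its sign is locally constant. In Stokes' theorem the sign may hence be treated as a constant under
differentiation. -/
theorem eventually_sgn_eq {c : S} {y : Vec (m + 1)} (hy : y ∈ (extChartAt (𝓡∂ (m + 1)) c).target) :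
    (fun y' => o.sgn c y') =ᶠ[𝓝[(extChartAt (𝓡∂ (m + 1)) c).target] y] fun _ => o.sgn c y := by
  have h1 : ContinuousWithinAt (fun y => chartRep (𝓡∂ (m + 1)) c o.form y basisVec)
      (extChartAt (𝓡∂ (m + 1)) c).target y :=
    ((ContinuousAlternatingMap.apply ℝ (Vec (m + 1)) ℝ basisVec).continuous.continuousAt).comp_continuousWithinAt
      ((o.smooth c).continuousOn y hy)
  rcases lt_or_gt_of_ne (chartRep_form_ne_zero o hy) with h | h
  · filter_upwards [h1.eventually (Iio_mem_nhds h)] with y' hy'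
    rw [OrientationForm.sgn, OrientationForm.sgn, Real.sign_of_neg h, Real.sign_of_neg hy']
  · filter_upwards [h1.eventually (Ioi_mem_nhds h)] with y' hy'
    rw [OrientationForm.sgn, OrientationForm.sgn, Real.sign_of_pos h, Real.sign_of_pos hy']

theorem continuousOn_sgn (c : S) :
    ContinuousOn (o.sgn c) (extChartAt (𝓡∂ (m + 1)) c).target := fun y hy =>
  (continuousWithinAt_const (b := o.sgn c y)).congr_of_eventuallyEq (eventually_sgn_eq o hy) rfl

/-- The integral of a form over a chart domain. -/
noncomputable def chartIntegral (c : S) (ζ : S → Vec (m + 1) [⋀^Fin (m + 1)]→L[ℝ] ℝ) : ℝ :=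
  ∫ y in (extChartAt (𝓡∂ (m + 1)) c).target,
    o.sgn c y * chartRep (𝓡∂ (m + 1)) c ζ y basisVec

theorem chartRep_eq_zero {k : ℕ} {c : S} {ζ : S → Vec (m + 1) [⋀^Fin k]→L[ℝ] ℝ} {y : Vec (m + 1)}
    (h : ζ ((extChartAt (𝓡∂ (m + 1)) c).symm y) = 0) : chartRep (𝓡∂ (m + 1)) c ζ y = 0 := by
  rw [chartRep, h]
  rfl

/-- Independence of the chart of the integral of a form supported in two charts. -/
theorem chartIntegral_change (c a : S) {ζ : S → Vec (m + 1) [⋀^Fin (m + 1)]→L[ℝ] ℝ}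
    (hc : ∀ x ∉ (extChartAt (𝓡∂ (m + 1)) c).source, ζ x = 0)
    (ha : ∀ x ∉ (extChartAt (𝓡∂ (m + 1)) a).source, ζ x = 0) :
    chartIntegral o c ζ = chartIntegral o a ζ := by
  let I := 𝓡∂ (m + 1)
  have h2 : (1 : WithTop ℕ∞) ≤ ∞ := WithTop.coe_le_coe.2 (le_top : (1 : ℕ∞) ≤ ⊤)
  have : IsManifold (𝓡∂ (m + 1)) 1 S := IsManifold.of_le h2
  -- The form vanishes outside the second chart as well, so each integral may be taken over the
  -- overlap, where the transition map is injective.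
  have red : ∀ c a : S, (∀ x ∉ (extChartAt I a).source, ζ x = 0) → chartIntegral o c ζ =
      ∫ y in (extChartAt I c).target ∩ (extChartAt I c).symm ⁻¹' (extChartAt I a).source,
        o.sgn c y * chartRep I c ζ y basisVec := by
    intro c a ha
    refine setIntegral_eq_of_subset_of_forall_sdiff_eq_zero (measurableSet_target c)
      inter_subset_left ?_
    rintro y ⟨hy, hyn⟩
    have h : ζ ((extChartAt I c).symm y) = 0 := ha _ fun h => hyn ⟨hy, h⟩
    rw [chartRep_eq_zero h]
    simp
  rw [red c a ha, red a c hc]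
  set D := (extChartAt I c).target ∩ (extChartAt I c).symm ⁻¹' (extChartAt I a).source with hD
  let τ := coordMap I I c a (id : S → S)
  have himg : τ '' D = (extChartAt I a).target ∩ (extChartAt I a).symm ⁻¹' (extChartAt I c).source := by
    ext z
    constructor
    · rintro ⟨y, hy, rfl⟩
      refine ⟨(extChartAt I a).map_source hy.2, ?_⟩
      change (extChartAt I a).symm (extChartAt I a ((extChartAt I c).symm y)) ∈ (extChartAt I c).source
      rw [(extChartAt I a).left_inv hy.2]
      exact (extChartAt I c).map_target hy.1
    · intro hz
      refine ⟨extChartAt I c ((extChartAt I a).symm z), ⟨(extChartAt I c).map_source hz.2, ?_⟩, ?_⟩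
      · change (extChartAt I c).symm (extChartAt I c ((extChartAt I a).symm z)) ∈ (extChartAt I a).source
        rw [(extChartAt I c).left_inv hz.2]
        exact (extChartAt I a).map_target hz.1
      · change extChartAt I a ((extChartAt I c).symm (extChartAt I c ((extChartAt I a).symm z))) = z
        rw [(extChartAt I c).left_inv hz.2, (extChartAt I a).right_inv hz.1]
  have hinj : InjOn τ D := by
    intro y hy y' hy' h
    have h1 : extChartAt I a ((extChartAt I c).symm y) = extChartAt I a ((extChartAt I c).symm y') := h
    have h2 := (extChartAt I a).injOn hy.2 hy'.2 h1
    exact (extChartAt I c).symm.injOn hy.1 hy'.1 h2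
  have hder : ∀ y ∈ D, HasFDerivWithinAt τ (fderivWithin ℝ τ (range I) y) D y := by
    intro y hy
    have h := contDiffWithinAt_coordMap (n := ∞) (f := (id : S → S)) (I := I) (I' := I) hy.1
      contMDiffAt_id hy.2
    exact (h.differentiableWithinAt (by simp)).hasFDerivWithinAt.mono fun z hz =>
      extChartAt_target_subset_range c hz.1
  have hmeas : MeasurableSet D := measurableSet_target_inter c (isOpen_extChartAt_source a)
  rw [← himg, integral_image_eq_integral_abs_det_fderiv_smul _ hmeas hder hinj]
  refine setIntegral_congr_fun hmeas fun y hy => ?_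
  have e1 := chartRep_change (I := I) hy.1 hy.2 ζ
  have e2 := chartRep_change (I := I) hy.1 hy.2 o.form
  simp only [OrientationForm.sgn]
  change Real.sign (chartRep I c o.form y basisVec) * chartRep I c ζ y basisVec =
    _ • (Real.sign (chartRep I a o.form (τ y) basisVec) * chartRep I a ζ (τ y) basisVec)
  -- The integrand and the orientation form acquire the same Jacobian determinant under the
  -- transition map.
  rw [e1, e2, top_comp_basisVec, top_comp_basisVec, sign_mul_mul, smul_eq_mul]

/-- Integrability of a continuous form with compact support in a chart. -/
theorem integrableOn_chart (c : S) {ζ : S → Vec (m + 1) [⋀^Fin (m + 1)]→L[ℝ] ℝ} {K : Set S}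
    (hK : IsCompact K) (hKc : K ⊆ (extChartAt (𝓡∂ (m + 1)) c).source) (hζ : ∀ x ∉ K, ζ x = 0)
    (hs : SmoothForm (𝓡∂ (m + 1)) ζ) :
    IntegrableOn (fun y => o.sgn c y * chartRep (𝓡∂ (m + 1)) c ζ y basisVec)
      (extChartAt (𝓡∂ (m + 1)) c).target := by
  set K' := extChartAt (𝓡∂ (m + 1)) c '' K with hK'
  have h1 : IsCompact K' := hK.image_of_continuousOn
    ((continuousOn_extChartAt c).mono hKc)
  have h2 : K' ⊆ (extChartAt (𝓡∂ (m + 1)) c).target := by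
    rintro _ ⟨x, hx, rfl⟩
    exact (extChartAt (𝓡∂ (m + 1)) c).map_source (hKc hx)
  have h3 : ContinuousOn (fun y => o.sgn c y * chartRep (𝓡∂ (m + 1)) c ζ y basisVec)
      (extChartAt (𝓡∂ (m + 1)) c).target := by
    refine (continuousOn_sgn o c).mul ?_
    exact (ContinuousAlternatingMap.apply ℝ (Vec (m + 1)) ℝ basisVec).continuous.comp_continuousOn
      (hs c).continuousOn
  refine IntegrableOn.of_forall_sdiff_eq_zero ((h3.mono h2).integrableOn_compact h1)
    (measurableSet_target c) ?_
  rintro y ⟨hy, hyn⟩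
  have h4 : ζ ((extChartAt (𝓡∂ (m + 1)) c).symm y) = 0 := hζ _ fun h =>
    hyn ⟨_, h, (extChartAt (𝓡∂ (m + 1)) c).right_inv hy⟩
  rw [chartRep_eq_zero h4]
  simp

end ChartIntegral

/-! ### Stokes' theorem on a compact manifold with boundary -/

section General

variable {E H F : Type*}
  [NormedAddCommGroup E] [NormedSpace ℝ E] [TopologicalSpace H]
  [NormedAddCommGroup F] [NormedSpace ℝ F]
  {M : Type*} [TopologicalSpace M] [ChartedSpace H M]
  {k : ℕ} {I : ModelWithCorners ℝ E H} [IsManifold I ∞ M]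

theorem SmoothForm.fun_smul {f : M → ℝ} (hf : ContMDiff I 𝓘(ℝ, ℝ) ∞ f)
    {η : M → E [⋀^Fin k]→L[ℝ] F} (hη : SmoothForm I η) : SmoothForm I (fun x => f x • η x) := by
  intro c
  have h1 : ContDiffOn ℝ ∞ (fun y => f ((extChartAt I c).symm y)) (extChartAt I c).target := by
    rw [← contMDiffOn_iff_contDiffOn]
    exact hf.comp_contMDiffOn (contMDiffOn_extChartAt_symm c)
  exact h1.smul (hη c)

theorem SmoothForm.add {η ζ : M → E [⋀^Fin k]→L[ℝ] F} (hη : SmoothForm I η) (hζ : SmoothForm I ζ) :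
    SmoothForm I (η + ζ) := fun c => (hη c).add (hζ c)

theorem SmoothForm.sub {η ζ : M → E [⋀^Fin k]→L[ℝ] F} (hη : SmoothForm I η) (hζ : SmoothForm I ζ) :
    SmoothForm I (η - ζ) := fun c => (hη c).sub (hζ c)

theorem SmoothForm.sum {ι : Type*} (J : Finset ι) {η : ι → M → E [⋀^Fin k]→L[ℝ] F}
    (hη : ∀ i ∈ J, SmoothForm I (η i)) : SmoothForm I (∑ i ∈ J, η i) := by
  classical
  induction J using Finset.induction_on with
  | empty => exact fun c => (contDiffOn_const (c := 0)).congr fun _ _ => rfl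
  | insert i J hi ih =>
    rw [Finset.sum_insert hi]
    exact (hη i (Finset.mem_insert_self i J)).add
      (ih fun j hj => hη j (Finset.mem_insert_of_mem hj))

/-- Locality of `d`: the exterior derivative of a cut-off form remains supported in the chart used
for the cutoff. -/
theorem extD_zero_of_eventuallyEq {η : M → E [⋀^Fin k]→L[ℝ] F} {x : M} (h : ∀ᶠ z in 𝓝 x, η z = 0) :
    extD I η x = 0 := by
  have hx : (extChartAt I x).symm (extChartAt I x x) = x := extChartAt_to_inv x
  have h0 : ∀ z, η ((extChartAt I x).symm z) = 0 → chartRep I x η z = 0 := fun z hz => by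
    rw [chartRep, hz]
    rfl
  have h1 : chartRep I x η =ᶠ[𝓝[range I] (extChartAt I x x)] fun _ => 0 := by
    rw [← hx] at h
    filter_upwards [eventually_coord (mem_extChartAt_target x) (by rwa [hx] at h ⊢)] with z hz
    exact h0 z hz.2
  have h2 : chartRep I x η (extChartAt I x x) = 0 := h0 _ (by rw [hx]; exact h.self_of_nhds)
  rw [extD, h1.extDerivWithin_eq h2]
  have : extDerivWithin (fun _ : E => (0 : E [⋀^Fin k]→L[ℝ] F)) (range I) (extChartAt I x x) = 0 := by
    rw [extDerivWithin, fderivWithin_const_apply]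
    exact _root_.map_zero (alternatizeUncurryFinCLM ℝ E F)
  exact this

theorem extD_sum {ι : Type*} (J : Finset ι) {η : ι → M → E [⋀^Fin k]→L[ℝ] F}
    (hη : ∀ i ∈ J, SmoothForm I (η i)) : extD I (∑ i ∈ J, η i) = ∑ i ∈ J, extD I (η i) := by
  classical
  induction J using Finset.induction_on with
  | empty =>
    funext x
    exact extD_zero_of_eventuallyEq (Eventually.of_forall fun _ => rfl)
  | insert i J hi ih =>
    have h1 := hη i (Finset.mem_insert_self i J)
    have h2 : ∀ j ∈ J, SmoothForm I (η j) := fun j hj => hη j (Finset.mem_insert_of_mem hj)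
    rw [Finset.sum_insert hi, Finset.sum_insert hi, ← ih h2]
    funext x
    exact extDerivWithin_add (uniqueDiffWithinAt_range (mem_extChartAt_target x))
      (h1.differentiableWithinAt (mem_extChartAt_target x))
      ((SmoothForm.sum J h2).differentiableWithinAt (mem_extChartAt_target x))

theorem SmoothForm.extD_withCorners [FiniteDimensional ℝ E] [FiniteDimensional ℝ F]
    {η : M → E [⋀^Fin k]→L[ℝ] F} (hη : SmoothForm I η) :
    SmoothForm I (CovPhase.extD I η) := by
  have h2 : (2 : WithTop ℕ∞) ≤ ∞ := WithTop.coe_le_coe.2 (le_top : (2 : ℕ∞) ≤ ⊤)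
  have : IsManifold I 2 M := IsManifold.of_le h2
  refine smoothForm_iff.2 fun c y hy => ?_
  have h1 : ContDiffWithinAt ℝ ∞ (fderivWithin ℝ (chartRep I c η) (range I)) (range I) y :=
    (hη.contDiffWithinAt hy).fderivWithin_right I.uniqueDiffOn (by simp)
      (extChartAt_target_subset_range c hy)
  have h3 : ContDiffWithinAt ℝ ∞ (extDerivWithin (chartRep I c η) (range I)) (range I) y :=
    (contDiffAt_alternatizeUncurryFin (f := fun T => T) contDiffAt_id).comp_contDiffWithinAt y h1
  refine h3.congr_of_eventuallyEq ?_ (hη.chartRep_extD hy)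
  filter_upwards [extChartAt_target_mem hy] with z hz
  exact hη.chartRep_extD hz

end General

section Stokes

variable {m : ℕ} {S : Type*} [TopologicalSpace S] [ChartedSpace (EuclideanHalfSpace (m + 1)) S]
  [IsManifold (𝓡∂ (m + 1)) ∞ S] (o : OrientationForm m S)

/-- The integral over the boundary points of a chart domain. -/
noncomputable def chartBdryIntegral (c : S) (ζ : S → Vec (m + 1) [⋀^Fin m]→L[ℝ] ℝ) : ℝ :=
  ∫ z in {z : Vec m | bdryIncl z ∈ (extChartAt (𝓡∂ (m + 1)) c).target},
    o.sgn c (bdryIncl z) * chartRep (𝓡∂ (m + 1)) c ζ (bdryIncl z) (fun i : Fin m => basisVec i.succ)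

theorem measurable_bdryIncl : Measurable (bdryIncl : Vec m → Vec (m + 1)) := by
  have h : Continuous (bdryIncl : Vec m → Vec (m + 1)) := by
    refine (PiLp.continuous_toLp 2 _).comp (continuous_pi fun i => ?_)
    refine Fin.cases ?_ (fun i => ?_) i
    · exact continuous_const
    · exact (EuclideanSpace.proj (𝕜 := ℝ) i).continuous
  exact h.measurable

theorem range_halfSpace : range (𝓡∂ (m + 1)) = {y : Vec (m + 1) | 0 ≤ y 0} :=
  range_modelWithCornersEuclideanHalfSpace (m + 1)

/-- Stokes' theorem for a form with compact support in a chart domain. -/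
theorem chartIntegral_extD (c : S) {ζ : S → Vec (m + 1) [⋀^Fin m]→L[ℝ] ℝ} {K : Set S}
    (hK : IsCompact K) (hKo : IsClosed K) (hKc : K ⊆ (extChartAt (𝓡∂ (m + 1)) c).source)
    (hζ : ∀ x ∉ K, ζ x = 0) (hs : SmoothForm (𝓡∂ (m + 1)) ζ) :
    chartIntegral o c (extD (𝓡∂ (m + 1)) ζ) = -chartBdryIntegral o c ζ := by
  classical
  have hle : (2 : WithTop ℕ∞) ≤ ∞ := WithTop.coe_le_coe.2 (le_top : (2 : ℕ∞) ≤ ⊤)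
  have : IsManifold (𝓡∂ (m + 1)) 2 S := IsManifold.of_le hle
  set I := 𝓡∂ (m + 1) with hI
  set T := (extChartAt I c).target with hT
  set R := {y : Vec (m + 1) | 0 ≤ y 0} with hR
  have hrange : range I = R := range_halfSpace
  have hTR : T ⊆ R := hrange ▸ extChartAt_target_subset_range c
  set K' := extChartAt I c '' K with hK'
  have hK'c : IsCompact K' := hK.image_of_continuousOn ((continuousOn_extChartAt c).mono hKc)
  have hK'T : K' ⊆ T := by
    rintro _ ⟨x, hx, rfl⟩
    exact (extChartAt I c).map_source (hKc hx)
  have hout : ∀ y ∈ T, y ∉ K' → (extChartAt I c).symm y ∉ K := fun y hy hyn h =>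
    hyn ⟨_, h, (extChartAt I c).right_inv hy⟩
  -- Extend the signed coordinate expression by zero to the half space. The extension is harmless
  -- because the support is compact inside the target, and the candidate derivative ignores the
  -- sign, which is locally constant.
  let u : Vec (m + 1) → Vec (m + 1) [⋀^Fin m]→L[ℝ] ℝ := fun y =>
    if y ∈ T then o.sgn c y • chartRep I c ζ y else 0
  let u' : Vec (m + 1) → Vec (m + 1) →L[ℝ] Vec (m + 1) [⋀^Fin m]→L[ℝ] ℝ := fun y =>
    if y ∈ T then o.sgn c y • fderivWithin ℝ (chartRep I c ζ) (range I) y else 0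
  have hu : ∀ y ∉ K', u y = 0 := by
    intro y hy
    by_cases h : y ∈ T
    · have h1 : chartRep I c ζ y = 0 := chartRep_eq_zero (hζ _ (hout y h hy))
      simp only [u, if_pos h, h1, smul_zero]
    · simp only [u, if_neg h]
  have hu' : ∀ y ∉ K', u' y = 0 := by
    intro y hy
    by_cases h : y ∈ T
    · have h1 : ∀ᶠ z in 𝓝[range I] y, chartRep I c ζ z = (fun _ => 0) z := by
        have h2 : ∀ᶠ x in 𝓝 ((extChartAt I c).symm y), x ∉ K :=
          hKo.isOpen_compl.mem_nhds (hout y h hy)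
        filter_upwards [eventually_coord h h2] with z hz
        exact chartRep_eq_zero (hζ _ hz.2)
      have h3 : fderivWithin ℝ (chartRep I c ζ) (range I) y = 0 := by
        rw [Filter.EventuallyEq.fderivWithin_eq h1 (chartRep_eq_zero (hζ _ (hout y h hy)))]
        exact fderivWithin_const_apply _
      simp only [u', if_pos h, h3, smul_zero]
    · simp only [u', if_neg h]
  have hTn : ∀ y ∈ T, T ∈ 𝓝[R] y := fun y hy => hrange ▸ extChartAt_target_mem hy
  have hsgn : ∀ y ∈ T, ∀ᶠ z in 𝓝[R] y, u z = o.sgn c y • chartRep I c ζ z := by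
    intro y hy
    have h1 : ∀ᶠ z in 𝓝[R] y, o.sgn c z = o.sgn c y := by
      have := eventually_sgn_eq o hy
      exact nhdsWithin_le_of_mem (hTn y hy) this
    filter_upwards [h1, hTn y hy] with z hz hz'
    simp only [u, if_pos hz', hz]
  have hc : ContinuousOn u R := by
    intro y hy
    by_cases h : y ∈ T
    · have h1 : ContinuousWithinAt (fun z => o.sgn c y • chartRep I c ζ z) R y := by
        rw [← hrange]
        have h2 : ContinuousWithinAt (chartRep I c ζ) (range I) y :=
          (hs.contDiffWithinAt h).continuousWithinAt
        exact ContinuousWithinAt.const_smul h2 (o.sgn c y)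
      exact h1.congr_of_eventuallyEq (hsgn y h) (by simp only [u, if_pos h])
    · have h1 : y ∉ K' := fun h' => h (hK'T h')
      have h2 : ∀ᶠ z in 𝓝[R] y, u z = (fun _ => 0) z := by
        filter_upwards [nhdsWithin_le_nhds (hK'c.isClosed.isOpen_compl.mem_nhds h1)] with z hz
        exact hu z hz
      exact continuousWithinAt_const.congr_of_eventuallyEq h2 (hu y h1)
  have hd : ∀ y : Vec (m + 1), 0 < y 0 → HasFDerivAt u (u' y) y := by
    intro y hy
    have hRn : R ∈ 𝓝 y := by
      have h1 : Continuous fun z : Vec (m + 1) => z 0 := (EuclideanSpace.proj (𝕜 := ℝ) 0).continuous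
      filter_upwards [h1.continuousAt.eventually (lt_mem_nhds hy)] with z hz
      exact hz.le
    by_cases h : y ∈ T
    · have h1 : HasFDerivWithinAt (fun z => o.sgn c y • chartRep I c ζ z)
          (o.sgn c y • fderivWithin ℝ (chartRep I c ζ) (range I) y) R y := by
        rw [← hrange]
        exact ((hs.differentiableWithinAt h).hasFDerivWithinAt).const_smul (o.sgn c y)
      have h2 := h1.congr_of_eventuallyEq (hsgn y h) (by simp only [u, if_pos h])
      have h3 : u' y = o.sgn c y • fderivWithin ℝ (chartRep I c ζ) (range I) y := by
        simp only [u', if_pos h]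
      rw [h3]
      exact h2.hasFDerivAt hRn
    · have h1 : y ∉ K' := fun h' => h (hK'T h')
      rw [hu' y h1]
      have h2 : u =ᶠ[𝓝 y] fun _ => 0 := by
        filter_upwards [hK'c.isClosed.isOpen_compl.mem_nhds h1] with z hz
        exact hu z hz
      exact (hasFDerivAt_const _ _).congr_of_eventuallyEq h2
  have halt : ∀ y ∈ T, alternatizeUncurryFin (u' y) basisVec =
      o.sgn c y * chartRep I c (extD I ζ) y basisVec := by
    intro y hy
    simp only [u', if_pos hy]
    rw [alternatizeUncurryFin_smul, hs.chartRep_extD hy]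
    rfl
  have halt0 : ∀ y ∉ T, alternatizeUncurryFin (u' y) basisVec = 0 := by
    intro y hy
    simp only [u', if_neg hy]
    exact congrArg (fun T : Vec (m + 1) [⋀^Fin (m + 1)]→L[ℝ] ℝ => T basisVec)
      (_root_.map_zero (alternatizeUncurryFinCLM ℝ (Vec (m + 1)) ℝ))
  have hRm : MeasurableSet R := hrange ▸ I.isClosed_range.measurableSet
  -- On the chart target this is the integrand for `dζ`, a smooth form supported in `K` and
  -- therefore integrable; elsewhere it is zero.
  have hi : IntegrableOn (fun y => alternatizeUncurryFin (u' y) basisVec) R := by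
    have h0 : ∀ x ∉ K, extD I ζ x = 0 := fun x hx => extD_zero_of_eventuallyEq (by
      filter_upwards [hKo.isOpen_compl.mem_nhds hx] with z hz
      exact hζ z hz)
    have h1 := integrableOn_chart o c hK hKc h0 hs.extD_withCorners
    refine IntegrableOn.of_forall_sdiff_eq_zero (h1.congr_fun (fun y hy => (halt y hy).symm)
      (measurableSet_target c)) hRm fun y hy => halt0 y hy.2
  have key := integral_halfSpace u u' hK'c hu hu' hc hd hi
  have e1 : chartIntegral o c (extD I ζ) = ∫ y in R, alternatizeUncurryFin (u' y) basisVec := by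
    rw [chartIntegral, setIntegral_eq_of_subset_of_forall_sdiff_eq_zero hRm hTR
      fun y hy => halt0 y hy.2]
    exact setIntegral_congr_fun (measurableSet_target c) fun y hy => (halt y hy).symm
  have e2 : chartBdryIntegral o c ζ = ∫ z : Vec m, u (bdryIncl z) (fun i : Fin m => basisVec i.succ) := by
    have hm : MeasurableSet {z : Vec m | bdryIncl z ∈ T} :=
      measurable_bdryIncl (measurableSet_target c)
    rw [chartBdryIntegral, ← setIntegral_univ (f := fun z => u (bdryIncl z) _),
      setIntegral_eq_of_subset_of_forall_sdiff_eq_zero MeasurableSet.univ (subset_univ _)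
        (s := {z : Vec m | bdryIncl z ∈ T})]
    · refine setIntegral_congr_fun hm fun z hz => ?_
      have hz' : bdryIncl z ∈ T := hz
      simp only [u, if_pos hz']
      rfl
    · intro z hz
      have hz' : bdryIncl z ∉ T := hz.2
      simp only [u, if_neg hz']
      rfl
  rw [e1, key, e2]

/-! ### Globalisation by the partition of unity -/

variable [CompactSpace S] [T2Space S]

variable (m S) in
theorem tsupport_chartPartition (c : S) :
    tsupport (chartPartition m S c) ⊆ (extChartAt (𝓡∂ (m + 1)) c).source := by
  rw [extChartAt_source]
  exact Classical.choose_spec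
    (SmoothPartitionOfUnity.exists_isSubordinate_chartAt_source (𝓡∂ (m + 1)) S) c

variable (m S) in
theorem finite_chartPartition :
    {c : S | (Function.support (chartPartition m S c)).Nonempty}.Finite :=
  (chartPartition m S).locallyFinite.finite_nonempty_of_compact

variable (m S) in
/-- The finite set of indices of the nonzero functions of the partition of unity. -/
noncomputable def chartIndices : Finset S := (finite_chartPartition m S).toFinset

theorem chartPartition_eq_zero {c : S} (hc : c ∉ chartIndices m S) (x : S) :
    chartPartition m S c x = 0 := by
  by_contra h
  exact hc ((finite_chartPartition m S).mem_toFinset.2 ⟨x, h⟩)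

theorem sum_chartPartition (x : S) : ∑ c ∈ chartIndices m S, chartPartition m S c x = 1 := by
  rw [← (chartPartition m S).sum_eq_one (mem_univ x)]
  refine (finsum_eq_sum_of_support_subset _ fun c hc => ?_).symm
  exact (finite_chartPartition m S).mem_toFinset.2 ⟨x, hc⟩

/-- The product of a form with a function of the partition of unity. -/
noncomputable def cutoff {k : ℕ} (c : S) (ζ : S → Vec (m + 1) [⋀^Fin k]→L[ℝ] ℝ) :
    S → Vec (m + 1) [⋀^Fin k]→L[ℝ] ℝ :=
  fun x => chartPartition m S c x • ζ x

section
variable {k : ℕ} {ζ : S → Vec (m + 1) [⋀^Fin k]→L[ℝ] ℝ}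

theorem SmoothForm.cutoff (hζ : SmoothForm (𝓡∂ (m + 1)) ζ) (c : S) :
    SmoothForm (𝓡∂ (m + 1)) (cutoff c ζ) :=
  hζ.fun_smul (chartPartition m S c).contMDiff

theorem cutoff_eq_zero (c : S) {x : S} (hx : x ∉ tsupport (chartPartition m S c)) :
    cutoff c ζ x = 0 := by
  rw [cutoff, image_eq_zero_of_notMem_tsupport hx, zero_smul]

theorem sum_cutoff (ζ : S → Vec (m + 1) [⋀^Fin k]→L[ℝ] ℝ) :
    ∑ c ∈ chartIndices m S, cutoff c ζ = ζ := by
  funext x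
  rw [Finset.sum_apply]
  simp only [cutoff]
  rw [← Finset.sum_smul, sum_chartPartition, one_smul]

end

theorem integral_eq_sum (ζ : S → Vec (m + 1) [⋀^Fin (m + 1)]→L[ℝ] ℝ) :
    integral o ζ = ∑ c ∈ chartIndices m S, chartIntegral o c (cutoff c ζ) := by
  rw [integral, finsum_eq_sum_of_support_subset (s := chartIndices m S)]
  · refine Finset.sum_congr rfl fun c _ => integral_congr_ae (Eventually.of_forall fun y => ?_)
    exact mul_assoc _ _ _
  · intro c hc
    by_contra h
    refine hc ?_
    simp only [chartPartition_eq_zero h, mul_zero, zero_mul, integral_zero]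

theorem bdryIntegral_eq_sum (ζ : S → Vec (m + 1) [⋀^Fin m]→L[ℝ] ℝ) :
    bdryIntegral o ζ = -∑ c ∈ chartIndices m S, chartBdryIntegral o c (cutoff c ζ) := by
  rw [bdryIntegral, finsum_eq_sum_of_support_subset (s := chartIndices m S)]
  · refine congrArg Neg.neg (Finset.sum_congr rfl fun c _ =>
      integral_congr_ae (Eventually.of_forall fun y => ?_))
    exact mul_assoc _ _ _
  · intro c hc
    by_contra h
    refine hc ?_
    simp only [chartPartition_eq_zero h, mul_zero, zero_mul, integral_zero]

theorem integrableOn_cutoff {ζ : S → Vec (m + 1) [⋀^Fin (m + 1)]→L[ℝ] ℝ}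
    (hζ : SmoothForm (𝓡∂ (m + 1)) ζ) (c : S) :
    IntegrableOn (fun y => o.sgn c y * chartRep (𝓡∂ (m + 1)) c (cutoff c ζ) y basisVec)
      (extChartAt (𝓡∂ (m + 1)) c).target :=
  integrableOn_chart o c (isClosed_tsupport _).isCompact (tsupport_chartPartition m S c)
    (fun _ hx => cutoff_eq_zero c hx) (hζ.cutoff c)

theorem integral_add {η ζ : S → Vec (m + 1) [⋀^Fin (m + 1)]→L[ℝ] ℝ}
    (hη : SmoothForm (𝓡∂ (m + 1)) η) (hζ : SmoothForm (𝓡∂ (m + 1)) ζ) :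
    integral o (η + ζ) = integral o η + integral o ζ := by
  simp only [integral_eq_sum]
  rw [← Finset.sum_add_distrib]
  refine Finset.sum_congr rfl fun c _ => ?_
  simp only [chartIntegral]
  rw [← MeasureTheory.integral_add (integrableOn_cutoff o hη c) (integrableOn_cutoff o hζ c)]
  refine integral_congr_ae (Eventually.of_forall fun y => ?_)
  let r := chartPartition m S c ((extChartAt (𝓡∂ (m + 1)) c).symm y)
  let a := chartRep (𝓡∂ (m + 1)) c η y basisVec
  let b := chartRep (𝓡∂ (m + 1)) c ζ y basisVec
  change o.sgn c y * (r * (a + b)) = o.sgn c y * (r * a) + o.sgn c y * (r * b)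
  ring

theorem integral_smul (r : ℝ) (η : S → Vec (m + 1) [⋀^Fin (m + 1)]→L[ℝ] ℝ) :
    integral o (r • η) = r * integral o η := by
  simp only [integral_eq_sum]
  rw [Finset.mul_sum]
  refine Finset.sum_congr rfl fun c _ => ?_
  simp only [chartIntegral]
  rw [← MeasureTheory.integral_const_mul]
  refine integral_congr_ae (Eventually.of_forall fun y => ?_)
  let t := chartPartition m S c ((extChartAt (𝓡∂ (m + 1)) c).symm y)
  let a := chartRep (𝓡∂ (m + 1)) c η y basisVec
  change o.sgn c y * (t * (r * a)) = r * (o.sgn c y * (t * a))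
  ring

theorem integral_sum {ι : Type*} (J : Finset ι)
    {η : ι → S → Vec (m + 1) [⋀^Fin (m + 1)]→L[ℝ] ℝ}
    (hη : ∀ i ∈ J, SmoothForm (𝓡∂ (m + 1)) (η i)) :
    integral o (∑ i ∈ J, η i) = ∑ i ∈ J, integral o (η i) := by
  classical
  induction J using Finset.induction_on with
  | empty =>
    have h := integral_smul o 0 (0 : S → Vec (m + 1) [⋀^Fin (m + 1)]→L[ℝ] ℝ)
    rw [zero_smul, zero_mul] at h
    exact h
  | insert i J hi ih =>
    have h2 : ∀ j ∈ J, SmoothForm (𝓡∂ (m + 1)) (η j) :=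
      fun j hj => hη j (Finset.mem_insert_of_mem hj)
    rw [Finset.sum_insert hi, Finset.sum_insert hi, ← ih h2,
      integral_add o (hη i (Finset.mem_insert_self i J)) (SmoothForm.sum J h2)]

/-- The integral of a form with compact support in a chart domain is computed in that chart. -/
theorem integral_eq_chartIntegral (c : S) {ζ : S → Vec (m + 1) [⋀^Fin (m + 1)]→L[ℝ] ℝ} {K : Set S}
    (hK : IsCompact K) (hKc : K ⊆ (extChartAt (𝓡∂ (m + 1)) c).source)
    (hζ : ∀ x ∉ K, ζ x = 0) (hs : SmoothForm (𝓡∂ (m + 1)) ζ) :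
    integral o ζ = chartIntegral o c ζ := by
  have h0 : ∀ a, ∀ x ∉ K, cutoff a ζ x = 0 := fun a x hx => by
    rw [cutoff, hζ x hx, smul_zero]
  -- Each piece is supported both in its own chart and in the chart at `c`, so all pieces can be
  -- moved to the latter and added there.
  have h1 : ∀ a : S, chartIntegral o a (cutoff a ζ) = chartIntegral o c (cutoff a ζ) := fun a =>
    chartIntegral_change o a c
      (fun x hx => cutoff_eq_zero a fun h => hx (tsupport_chartPartition m S a h))
      fun x hx => h0 a x fun h => hx (hKc h)
  rw [integral_eq_sum, Finset.sum_congr rfl fun a _ => h1 a]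
  simp only [chartIntegral]
  rw [← integral_finsetSum]
  · refine integral_congr_ae (Eventually.of_forall fun y => ?_)
    change ∑ a ∈ chartIndices m S, o.sgn c y *
      (chartPartition m S a ((extChartAt (𝓡∂ (m + 1)) c).symm y) *
        chartRep (𝓡∂ (m + 1)) c ζ y basisVec) = _
    rw [← Finset.mul_sum, ← Finset.sum_mul, sum_chartPartition, one_mul]
  · exact fun a _ => integrableOn_chart o c hK hKc (h0 a) (hs.cutoff a)

/-- Stokes' theorem. -/
theorem integral_extD {ζ : S → Vec (m + 1) [⋀^Fin m]→L[ℝ] ℝ} (hζ : SmoothForm (𝓡∂ (m + 1)) ζ) :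
    integral o (extD (𝓡∂ (m + 1)) ζ) = bdryIntegral o ζ := by
  -- The form is cut into finitely many pieces before differentiating, so no derivative of the
  -- partition functions has to be tracked. Each piece is covered by the one-chart version of
  -- Stokes.
  have h1 : extD (𝓡∂ (m + 1)) ζ = ∑ c ∈ chartIndices m S, extD (𝓡∂ (m + 1)) (cutoff c ζ) := by
    rw [← extD_sum _ fun c _ => hζ.cutoff c, sum_cutoff]
  rw [h1, integral_sum o _ fun c _ => (hζ.cutoff c).extD_withCorners, bdryIntegral_eq_sum,
    ← Finset.sum_neg_distrib]
  refine Finset.sum_congr rfl fun c _ => ?_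
  have hK := (isClosed_tsupport (chartPartition m S c)).isCompact
  have h2 : ∀ x ∉ tsupport (chartPartition m S c), extD (𝓡∂ (m + 1)) (cutoff c ζ) x = 0 :=
    fun x hx => extD_zero_of_eventuallyEq (by
      filter_upwards [(isClosed_tsupport _).isOpen_compl.mem_nhds hx] with z hz
      exact cutoff_eq_zero c hz)
  rw [integral_eq_chartIntegral o c hK (tsupport_chartPartition m S c) h2
      (hζ.cutoff c).extD_withCorners,
    chartIntegral_extD o c hK (isClosed_tsupport _) (tsupport_chartPartition m S c)
      (fun _ hx => cutoff_eq_zero c hx) (hζ.cutoff c)]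

end Stokes

/-! ### The transformed presymplectic form of a hypersurface -/

section Hypersurface

variable {m : ℕ} {W V : Type*} [NormedAddCommGroup W] [NormedSpace ℝ W] [FiniteDimensional ℝ W]
    [NormedAddCommGroup V] [NormedSpace ℝ V] [FiniteDimensional ℝ V]
  {M : Type*} [TopologicalSpace M] [ChartedSpace (Vec (m + 2)) M] [IsManifold (𝓡 (m + 2)) ∞ M]
  {N : Type*} [TopologicalSpace N] [ChartedSpace (Vec (m + 2)) N] [IsManifold (𝓡 (m + 2)) ∞ N]
  {S : Type*} [TopologicalSpace S] [ChartedSpace (EuclideanHalfSpace (m + 1)) S]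
  [IsManifold (𝓡∂ (m + 1)) ∞ S]
  {L : Lagrangian m W V}

section Smooth

variable {p : Par → Fields m W V M} {X : Fin 2 → Par → M → Vec (m + 2)}

theorem SmoothFormFamily.fieldD {k : ℕ} {β : Fin 2 → Par → M → Vec (m + 2) [⋀^Fin k]→L[ℝ] ℝ}
    (hβ : ∀ i, SmoothFormFamily (𝓡 (m + 2)) (β i)) (q : Par) :
    SmoothForm (𝓡 (m + 2)) (fieldD β q) :=
  (((hβ 1).pd 0).slice q).sub (((hβ 0).pd 1).slice q)

theorem SmoothForm.skew {k : ℕ} {B : Fin 2 → Fin 2 → M → Vec (m + 2) [⋀^Fin k]→L[ℝ] ℝ}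
    (hB : ∀ i j, SmoothForm (𝓡 (m + 2)) (B i j)) : SmoothForm (𝓡 (m + 2)) (skew B) :=
  (hB 0 1).sub (hB 1 0)

theorem Lagrangian.AdmissibleFamily.smooth_plotPresymp (hp : L.AdmissibleFamily p) (q : Par) :
    SmoothForm (𝓡 (m + 2)) (L.plotPresymp p q) := by
  rw [hp.plotPresymp_eq q]
  exact SmoothFormFamily.fieldD (β := fun i q => L.theta (p q) (velocity p q i))
    (fun i => hp.smooth_theta (hp.smooth_velocity i).1 (hp.smooth_velocity i).2) q

theorem Lagrangian.AdmissibleFamily.smooth_bdryTerm (hp : L.AdmissibleFamily p)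
    (hX : ∀ i, SmoothVecFamily (X i)) (q : Par) :
    SmoothForm (𝓡 (m + 2)) (L.bdryTerm p X q) := by
  have hXs := fun i => (hX i).slice q
  have h1 := SmoothFormFamily.fieldD (fun i => hp.smooth_insTheta (hX i)) q
  have h2 := SmoothForm.skew fun i j => SmoothForm.intProd (hXs i)
    ((hp.smooth_theta (hp.smooth_velocity j).1 (hp.smooth_velocity j).2).slice q)
  have h3 := SmoothForm.skew fun i j =>
    (SmoothFormFamily.lieD (hX i) (hp.smooth_insTheta (hX j))).slice q
  have h4 := SmoothForm.skew fun i j => SmoothForm.intProd (hXs i)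
    (SmoothForm.intProd (hXs j) (hp.smooth_form.slice q))
  exact ((h1.add h2).add h3).add fun c => (h4 c).const_smul (1 / 2 : ℝ)

theorem Lagrangian.AdmissibleFamily.smooth_bulkTerm (hp : L.AdmissibleFamily p)
    (hX : ∀ i, SmoothVecFamily (X i)) (q : Par) :
    SmoothForm (𝓡 (m + 2)) (L.bulkTerm p X q) := by
  have h1 := SmoothForm.skew fun i j => SmoothForm.intProd ((hX i).slice q)
    ((hp.smooth_E (hp.smooth_velocity j).1 (hp.smooth_velocity j).2).slice q)
  have h2 := SmoothFormFamily.fieldD (fun i => hp.smooth_insE (hX i)) q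
  have h3 := SmoothForm.skew fun i j =>
    (SmoothFormFamily.lieD (hX i) (hp.smooth_insE (hX j))).slice q
  exact (h1.add h2).add h3

end Smooth

theorem wedgeOne_zero {n k : ℕ} (a : Vec n [⋀^Fin 1]→L[ℝ] W) :
    wedgeOne a (0 : Vec n [⋀^Fin k]→L[ℝ] (W →L[ℝ] ℝ)) = 0 := by
  ext v
  simp [wedgeOne, alternatizeUncurryFin_apply, pairCLM, pairZero]

theorem pairZero_zero {n k : ℕ} (c : W) :
    pairZero c (0 : Vec n [⋀^Fin k]→L[ℝ] (W →L[ℝ] ℝ)) = 0 := by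
  ext v
  simp [pairZero]

theorem intProd_zero {n k : ℕ} (Y : M → Vec n) :
    intProd Y (0 : M → Vec n [⋀^Fin (k + 1)]→L[ℝ] ℝ) = 0 := rfl

theorem lieD_zero {k : ℕ} (Y : M → Vec (m + 2)) :
    lieD (𝓡 (m + 2)) Y (0 : M → Vec (m + 2) [⋀^Fin (k + 1)]→L[ℝ] ℝ) = 0 := by
  have h : ∀ {l : ℕ}, extD (𝓡 (m + 2)) (0 : M → Vec (m + 2) [⋀^Fin l]→L[ℝ] ℝ) = 0 := fun {l} =>
    funext fun x => extD_zero_of_eventuallyEq (Eventually.of_forall fun _ => rfl)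
  change intProd Y (extD (𝓡 (m + 2)) 0) + extD (𝓡 (m + 2)) (intProd Y 0) = 0
  rw [h, intProd_zero, intProd_zero, h, add_zero]

theorem Lagrangian.OnShell.E_eq_zero {φ : Fields m W V M} (h : L.OnShell φ) (δ : Fields m W V M) :
    L.E φ δ = 0 := by
  funext x
  rw [Lagrangian.E, (h x).1, (h x).2, wedgeOne_zero, pairZero_zero, add_zero]
  rfl

theorem Lagrangian.OnShell.insE_eq_zero {φ : Fields m W V M} (h : L.OnShell φ)
    (Y : M → Vec (m + 2)) : L.insE φ Y = 0 := by
  funext x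
  rw [Lagrangian.insE, (h x).1, pairZero_zero]
  rfl

/-- The term `𝐝 E(ι_X φ; φ)` differentiates in the parameters, so the field equations are imposed
along the whole family. This encodes tangency to the space of solutions. -/
theorem Lagrangian.bulkTerm_eq_zero {p : Par → Fields m W V M} (h : ∀ q, L.OnShell (p q))
    (X : Fin 2 → Par → M → Vec (m + 2)) (q : Par) : L.bulkTerm p X q = 0 := by
  have h1 : ∀ i j, intProd (X i q) (L.E (p q) (velocity p q j)) = 0 := fun i j => by
    rw [(h q).E_eq_zero, intProd_zero]
  have h2 : ∀ i q', L.insE (p q') (X i q') = 0 := fun i q' => (h q').insE_eq_zero _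
  have h3 : fieldD (fun i q' => L.insE (p q') (X i q')) q = 0 := by
    funext x
    simp only [fieldD, h2]
    simp
  have h4 : ∀ i j, lieD (𝓡 (m + 2)) (X i q) (L.insE (p q) (X j q)) = 0 := fun i j => by
    rw [h2, lieD_zero]
  rw [Lagrangian.bulkTerm, h3]
  simp only [skew, h1, h4, sub_self, add_zero]

theorem pullForm_comp {k n : ℕ} {E H : Type*} [NormedAddCommGroup E] [NormedSpace ℝ E]
    [TopologicalSpace H] {I : ModelWithCorners ℝ E H} {T : Type*} [TopologicalSpace T]
    [ChartedSpace H T] {M : Type*} [TopologicalSpace M] [ChartedSpace (Vec n) M]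
    {N : Type*} [TopologicalSpace N] [ChartedSpace (Vec n) N]
    {j : T → M} {v : M → N} (hj : MDifferentiable I (𝓡 n) j) (hv : MDifferentiable (𝓡 n) (𝓡 n) v)
    (η : N → Vec n [⋀^Fin k]→L[ℝ] ℝ) :
    pullForm I (𝓡 n) (v ∘ j) η = pullForm I (𝓡 n) j (pullForm (𝓡 n) (𝓡 n) v η) := by
  funext x
  have h := mfderiv_comp x (hv (j x)) (hj x)
  rw [pullForm, h]
  rfl

variable [CompactSpace S] [T2Space S] (o : OrientationForm m S) {j : S → M}
  (hj : ContMDiff (𝓡∂ (m + 1)) (𝓡 (m + 2)) ∞ j)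

include hj in
theorem hyperIntegral_extD {η : M → Vec (m + 2) [⋀^Fin m]→L[ℝ] ℝ}
    (hη : SmoothForm (𝓡 (m + 2)) η) :
    hyperIntegral o j (extD (𝓡 (m + 2)) η) = hyperBdryIntegral o j η := by
  have h2 : (2 : WithTop ℕ∞) ≤ ∞ := WithTop.coe_le_coe.2 (le_top : (2 : ℕ∞) ≤ ⊤)
  have : IsManifold (𝓡∂ (m + 1)) 2 S := IsManifold.of_le h2
  have : IsManifold (𝓡 (m + 2)) 2 M := IsManifold.of_le h2
  have h : extD (𝓡∂ (m + 1)) (pullForm (𝓡∂ (m + 1)) (𝓡 (m + 2)) j η) =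
      pullForm (𝓡∂ (m + 1)) (𝓡 (m + 2)) j (extD (𝓡 (m + 2)) η) :=
    funext fun x => extD_pullForm (hj.contMDiffAt.of_le h2)
      (hη.differentiableWithinAt (mem_extChartAt_target _))
  rw [hyperIntegral, ← h, integral_extD o (hη.pullForm hj)]
  rfl

include hj in
-- Additivity of the integral uses integrability, supplied here by smoothness and compactness. The
-- difference is reduced to sums by adding `ξ` back.
theorem hyperIntegral_add_sub {η ζ ξ : M → Vec (m + 2) [⋀^Fin (m + 1)]→L[ℝ] ℝ}
    (hη : SmoothForm (𝓡 (m + 2)) η) (hζ : SmoothForm (𝓡 (m + 2)) ζ)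
    (hξ : SmoothForm (𝓡 (m + 2)) ξ) :
    hyperIntegral o j (η + ζ - ξ) =
      hyperIntegral o j η + hyperIntegral o j ζ - hyperIntegral o j ξ := by
  have h := integral_add o ((hη.add hζ).sub hξ |>.pullForm hj) (hξ.pullForm hj)
  have h' := integral_add o (hη.pullForm hj) (hζ.pullForm hj)
  have e1 : pullForm (𝓡∂ (m + 1)) (𝓡 (m + 2)) j (η + ζ - ξ) +
      pullForm (𝓡∂ (m + 1)) (𝓡 (m + 2)) j ξ =
      pullForm (𝓡∂ (m + 1)) (𝓡 (m + 2)) j η + pullForm (𝓡∂ (m + 1)) (𝓡 (m + 2)) j ζ := by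
    change pullForm (𝓡∂ (m + 1)) (𝓡 (m + 2)) j (η + ζ - ξ + ξ) =
      pullForm (𝓡∂ (m + 1)) (𝓡 (m + 2)) j (η + ζ)
    rw [sub_add_cancel]
  rw [e1, h'] at h
  rw [hyperIntegral, hyperIntegral, hyperIntegral, hyperIntegral]
  linarith

include hj in
/-- The presymplectic form transformed by a field-dependent diffeomorphism. -/
theorem FieldSpace.transPresymp_eq (Φ : FieldSpace M L)
    (u : Φ.carrier → (N ≃ₘ^∞⟮𝓡 (m + 2), 𝓡 (m + 2)⟯ M)) (hu : Φ.IsSmoothMap u)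
    (p : Par → Φ.carrier) (hp : Φ.IsPlot p) (q : Par) :
    Φ.transPresymp o j u p q = L.hyperPresymp o j (fun q' => (p q').1) q
      + hyperBdryIntegral o j
          (L.bdryTerm (fun q' => (p q').1) (logVelocity (fun q' => u (p q'))) q)
      - hyperIntegral o j
          (L.bulkTerm (fun q' => (p q').1) (logVelocity (fun q' => u (p q'))) q) := by
  have hA : L.AdmissibleFamily (fun q' => (p q').1) :=
    ⟨hp.1, hp.2, fun q' => Φ.jet_mem _ (p q').2⟩
  have hD : SmoothDiffFamily (fun q' => u (p q')) := hu 2 p hp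
  have hX : ∀ i, SmoothVecFamily (logVelocity (fun q' => u (p q')) i) := hD.smoothVecFamily_logVel
  have hb := hA.smooth_bdryTerm hX q
  -- The transformed current is `u^*` of a form on `M`, and the hypersurface is `u⁻¹ ∘ j`. Pulling
  -- back along `u⁻¹` undoes `u^*`, so only the pullback along `j` remains.
  rw [FieldSpace.transPresymp, Lagrangian.hyperPresymp, hyperIntegral,
    hA.plotPresymp_pullFields hD q, pullForm_comp (hj.mdifferentiable (by simp))
      ((u (p q)).symm.contMDiff.mdifferentiable (by simp)), pullForm_symm_pullForm,
    ← hyperIntegral_extD o hj hb]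
  exact hyperIntegral_add_sub o hj (hA.smooth_plotPresymp q) hb.extD (hA.smooth_bulkTerm hX q)

include hj in
/-- On shell, only boundary terms remain. -/
theorem FieldSpace.transPresymp_eq_of_onShell (Φ : FieldSpace M L)
    (u : Φ.carrier → (N ≃ₘ^∞⟮𝓡 (m + 2), 𝓡 (m + 2)⟯ M)) (hu : Φ.IsSmoothMap u)
    (p : Par → Φ.carrier) (hp : Φ.IsPlot p) (q : Par) (hs : ∀ q', L.OnShell (p q').1) :
    Φ.transPresymp o j u p q = L.hyperPresymp o j (fun q' => (p q').1) q
      + hyperBdryIntegral o j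
          (L.bdryTerm (fun q' => (p q').1) (logVelocity (fun q' => u (p q'))) q) := by
  have h0 : hyperIntegral o j (0 : M → Vec (m + 2) [⋀^Fin (m + 1)]→L[ℝ] ℝ) = 0 := by
    have h := integral_smul o 0 (0 : S → Vec (m + 1) [⋀^Fin (m + 1)]→L[ℝ] ℝ)
    rw [zero_smul, zero_mul] at h
    exact h
  rw [Φ.transPresymp_eq o hj u hu p hp q, Lagrangian.bulkTerm_eq_zero hs, h0, sub_zero]

end Hypersurface

end CovPhase

/-- The dimension is `m + 2`, so `n ≥ 2` is built in. Identities of 2-forms on field space are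
stated by evaluation on the tangent pair of every two-parameter plot at every parameter. Both
clauses are instances of one identity for smooth maps into `Diff(N, M)`, the first with `N = M`. -/
theorem mainTheorem8 {m : ℕ} {W V : Type*}
    [NormedAddCommGroup W] [NormedSpace ℝ W] [FiniteDimensional ℝ W]
    [NormedAddCommGroup V] [NormedSpace ℝ V] [FiniteDimensional ℝ V]
    (L : CovPhase.Lagrangian m W V)
    {M : Type*} [TopologicalSpace M] [ChartedSpace (EuclideanSpace ℝ (Fin (m + 2))) M]
    [IsManifold (𝓡 (m + 2)) ∞ M]
    (Φ : CovPhase.FieldSpace M L)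
    {S : Type*} [TopologicalSpace S] [ChartedSpace (EuclideanHalfSpace (m + 1)) S]
    [IsManifold (𝓡∂ (m + 1)) ∞ S] [CompactSpace S] [T2Space S]
    (o : CovPhase.OrientationForm m S)
    (j : S → M) (hj : ContMDiff (𝓡∂ (m + 1)) (𝓡 (m + 2)) ∞ j) :
    -- field-dependent diffeomorphisms `ψ : Φ → Diff(M)`
    (∀ ψ : Φ.carrier → (M ≃ₘ^∞⟮𝓡 (m + 2), 𝓡 (m + 2)⟯ M), Φ.IsSmoothMap ψ →
      ∀ p : EuclideanSpace ℝ (Fin 2) → Φ.carrier, Φ.IsPlot p →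
      ∀ q : EuclideanSpace ℝ (Fin 2),
        Φ.transPresymp o j ψ p q
            = L.hyperPresymp o j (fun q' => (p q').1) q
              + CovPhase.hyperBdryIntegral o j
                  (L.bdryTerm (fun q' => (p q').1) (CovPhase.logVelocity (fun q' => ψ (p q'))) q)
              - CovPhase.hyperIntegral o j
                  (L.bulkTerm (fun q' => (p q').1) (CovPhase.logVelocity (fun q' => ψ (p q'))) q)
        ∧ ((∀ q', L.OnShell (p q').1) →
            Φ.transPresymp o j ψ p q
              = L.hyperPresymp o j (fun q' => (p q').1) q
                + CovPhase.hyperBdryIntegral o j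
                    (L.bdryTerm (fun q' => (p q').1)
                      (CovPhase.logVelocity (fun q' => ψ (p q'))) q)))
    ∧
    -- dressing fields `u : Φ → Diff(N, M)`
    (∀ {N : Type*} [TopologicalSpace N] [ChartedSpace (EuclideanSpace ℝ (Fin (m + 2))) N]
      [IsManifold (𝓡 (m + 2)) ∞ N]
      (u : Φ.carrier → (N ≃ₘ^∞⟮𝓡 (m + 2), 𝓡 (m + 2)⟯ M)), Φ.IsDressing u →
      ∀ p : EuclideanSpace ℝ (Fin 2) → Φ.carrier, Φ.IsPlot p →
      ∀ q : EuclideanSpace ℝ (Fin 2),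
        Φ.transPresymp o j u p q
            = L.hyperPresymp o j (fun q' => (p q').1) q
              + CovPhase.hyperBdryIntegral o j
                  (L.bdryTerm (fun q' => (p q').1) (CovPhase.logVelocity (fun q' => u (p q'))) q)
              - CovPhase.hyperIntegral o j
                  (L.bulkTerm (fun q' => (p q').1) (CovPhase.logVelocity (fun q' => u (p q'))) q)
        ∧ ((∀ q', L.OnShell (p q').1) →
            Φ.transPresymp o j u p q
              = L.hyperPresymp o j (fun q' => (p q').1) q
                + CovPhase.hyperBdryIntegral o j
                    (L.bdryTerm (fun q' => (p q').1)
                      (CovPhase.logVelocity (fun q' => u (p q'))) q))) := by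
  exact ⟨fun ψ hψ p hp q => ⟨Φ.transPresymp_eq o hj ψ hψ p hp q,
      Φ.transPresymp_eq_of_onShell o hj ψ hψ p hp q⟩,
    fun u hu p hp q => ⟨Φ.transPresymp_eq o hj u hu.smooth p hp q,
      Φ.transPresymp_eq_of_onShell o hj u hu.smooth p hp q⟩⟩
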